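/- Let $k\ge 4$ be an integer, let $\mathcal N$ be an odd square-free positive integer, $q$ a prime dividing $\mathcal N$, and $\mathcal N_0\mathcal N_1\mathcal N_2=\mathcal N/q$ a factorization into positive integers. Let $\chi$ be a real Dirichlet character modulo $\mathcal N$ (that is, $\chi^2=1$) with $\chi(-1)=(-1)^k$, and let $\chi_q$ be its $q$-component, a character modulo $q$ (so $\chi_q(a)=\chi(b)$ for $a$ prime to $q$, where $b\equiv a\ (q)$ and $b\equiv 1\ (\mathcal N/q)$). Write $\gamma=\begin{pmatrix}A_\gamma&B_\gamma\\C_\gamma&D_\gamma\end{pmatrix}$ in $2\times2$ blocks. Let $\Gamma_\infty=\{\gamma\in Sp_2(\mathbb Z): C_\gamma=0\}$ and $\Gamma_0(L)=\{\gamma\in Sp_2(\mathbb Z): C_\gamma\equiv 0\ (L)\}$, where $Sp_2$ denotes the group of $4\times 4$ symplectic matrices, and let $\mathcal H=\{X+iY: X,Y\in\mathbb R^{2,2}_{\rm sym},\ Y>0\}$. For $f:\mathcal H\to\mathbb C$ and $\gamma\in Sp_2(\mathbb Q)$ put $$(f|\gamma)(\tau)=\det(C_\gamma\tau+D_\gamma)^{-k}f\big((A_\gamma\tau+B_\gamma)(C_\gamma\tau+D_\gamma)^{-1}\big).$$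 For a multiple $L$ of $\mathcal N$ and a diagonal integral matrix $M$, let $\gamma_M=\begin{pmatrix}I&0\\M&I\end{pmatrix}$. The Eisenstein series of level $L$ and character $\chi$ attached to $M$ is $$\mathbb E^{L}_{M}(\tau)=\sum\overline\chi(\det D_\gamma)\,(1|\gamma_M\gamma)(\tau),$$ where the sum is over the distinct cosets $\Gamma_\infty\gamma_M\gamma$ with $\gamma\in\Gamma_0(L)$, one $\gamma$ being chosen for each coset. Let $M_{1,1},M_1,M_2$ be diagonal integral matrices each of which, for every prime $p\mid\mathcal N/q$, is congruent modulo $p$ to $0$, $\mathrm{diag}(1,0)$ or $I$ according as $p\mid\mathcal N_0$, $p\mid\mathcal N_1$ or $p\mid\mathcal N_2$, and with $$M_{1,1}\equiv\mathrm{diag}(1,0)\ (q^2),\qquad M_1\equiv\mathrm{diag}(1,0)\ (q),\qquad M_2\equiv I\ (q).$$ Put $\mathbb E_{1,1}=\mathbb E^{q\mathcal N}_{M_{1,1}}$ (level $q\mathcal N$), and $\mathbb E_1=\mathbb E^{\mathcal N}_{M_1}$, $\mathbb E_2=\mathbb E^{\mathcal N}_{M_2}$ (level $\mathcal N$). Let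 $T_1(q^2)$ be the Hecke operator of level $q\mathcal N$, weight $k$ and character $\chi$, $$f|T_1(q^2)=q^{k-3}\sum_{\gamma}\overline\chi(\det D_\gamma)\,f|\delta_1^{-1}\gamma,\qquad \delta_1=\mathrm{diag}(q,1,q^{-1},1),$$ where $\gamma$ runs over representatives of $\big(\delta_1\Gamma_0(q\mathcal N)\delta_1^{-1}\cap\Gamma_0(q\mathcal N)\big)\backslash\Gamma_0(q\mathcal N)$. **Proposition 5.10.** The series $\mathbb E_{1,1},\mathbb E_1,\mathbb E_2$ converge absolutely on $\mathcal H$, and on $\mathcal H$ $$\mathbb E_{1,1}|T_1(q^2)=\begin{cases}q^{2k-2}\,\mathbb E_{1,1}+q\,\mathbb E_1&\text{if }\chi_q\ne 1,\\ q^{-1}(q^2-1)\,\mathbb E_2+q^{2k-2}\,\mathbb E_{1,1}+q\,\mathbb E_1&\text{if }\chi_q=1.\end{cases}$$ -/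

import Mathlib

open Matrix

noncomputable section

namespace SiegelEisenstein

/-- Square matrices of size four, written in blocks of size two. -/
abbrev Mat4 (R : Type*) := Matrix (Fin 2 ⊕ Fin 2) (Fin 2 ⊕ Fin 2) R

/-- The symplectic group of degree two over `R`. -/
abbrev Sp2 (R : Type*) [CommRing R] := Matrix.symplecticGroup (Fin 2) R

/-- The homomorphism `Sp₂(R) → Sp₂(S)` obtained by applying a ring homomorphism to all entries. -/
def mapSp {R S : Type*} [CommRing R] [CommRing S] (f : R →+* S) : Sp2 R →* Sp2 S where
  toFun γ := ⟨f.mapMatrix (γ : Mat4 R), SymplecticGroup.map_mem γ.2 f⟩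
  map_one' := by
    apply Subtype.ext
    exact map_one f.mapMatrix
  map_mul' a b := by
    apply Subtype.ext
    exact map_mul f.mapMatrix _ _

/-- The elements of `Sp₂(R)` whose lower left block is zero. For `R = ℤ` this is `Γ_∞`. -/
def siegelParabolic (R : Type*) [CommRing R] : Subgroup (Sp2 R) where
  carrier := {γ | (γ : Mat4 R).toBlocks₂₁ = 0}
  one_mem' := by
    ext i j
    simp [Matrix.toBlocks₂₁]
  mul_mem' := by
    intro a b ha hb
    have e : ((a * b : Sp2 R) : Mat4 R).toBlocks₂₁
        = (a : Mat4 R).toBlocks₂₁ * (b : Mat4 R).toBlocks₁₁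
          + (a : Mat4 R).toBlocks₂₂ * (b : Mat4 R).toBlocks₂₁ := by
      ext i j
      simp [Matrix.toBlocks₂₁, Matrix.toBlocks₁₁, Matrix.toBlocks₂₂, Matrix.mul_apply]
    have ha' : (a : Mat4 R).toBlocks₂₁ = 0 := ha
    have hb' : (b : Mat4 R).toBlocks₂₁ = 0 := hb
    show ((a * b : Sp2 R) : Mat4 R).toBlocks₂₁ = 0
    rw [e, ha', hb', zero_mul, mul_zero, add_zero]
  inv_mem' := by
    intro a ha
    have ha' : (a : Mat4 R).toBlocks₂₁ = 0 := ha
    show ((a⁻¹ : Sp2 R) : Mat4 R).toBlocks₂₁ = 0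
    rw [SymplecticGroup.coe_inv]
    ext i j
    have h := congrFun (congrFun ha' j) i
    simp only [Matrix.toBlocks₂₁, Matrix.of_apply, Matrix.zero_apply] at h
    simp [Matrix.toBlocks₂₁, Matrix.J, Matrix.mul_apply, Matrix.one_apply, h]

/-- `Γ₀(L)`: the integral symplectic matrices whose lower left block vanishes modulo `L`. -/
def Gamma0 (L : ℕ) : Subgroup (Sp2 ℤ) :=
  (siegelParabolic (ZMod L)).comap (mapSp (Int.castRingHom (ZMod L)))

/-- The Siegel upper half space of degree two. -/
def siegelUpperHalfSpace : Set (Matrix (Fin 2) (Fin 2) ℂ) :=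
  {τ | τ.IsSymm ∧ (τ.map Complex.im).PosDef}

/-- The weight `k` action
`(f|γ)(τ) = det(Cτ + D)^{-k} f((Aτ + B)(Cτ + D)⁻¹)` of `γ = (A B; C D) ∈ Sp₂(ℚ)`.
The usual factor `(det γ)^{k/2}` is one, since symplectic matrices have determinant one.
Only values at points of the Siegel upper half space matter, where `Cτ + D` is invertible. -/
def slash (k : ℕ) (f : Matrix (Fin 2) (Fin 2) ℂ → ℂ) (γ : Sp2 ℚ)
    (τ : Matrix (Fin 2) (Fin 2) ℂ) : ℂ :=
  let g : Mat4 ℂ := (γ : Mat4 ℚ).map (fun x : ℚ => (x : ℂ))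
  ((g.toBlocks₂₁ * τ + g.toBlocks₂₂).det ^ k)⁻¹
    * f ((g.toBlocks₁₁ * τ + g.toBlocks₁₂) * (g.toBlocks₂₁ * τ + g.toBlocks₂₂)⁻¹)

/-- The inclusion of `Sp₂(ℤ)` in `Sp₂(ℚ)`. -/
abbrev toQ : Sp2 ℤ →* Sp2 ℚ := mapSp (Int.castRingHom ℚ)

/-- The conjugate value `χ̄(det D)` for `γ = (A B; C D)`. -/
def charDetD {N : ℕ} (χ : DirichletCharacter ℂ N) (γ : Sp2 ℤ) : ℂ :=
  (starRingEnd ℂ) (χ (((γ : Mat4 ℤ).toBlocks₂₂.det : ℤ) : ZMod N))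

/-- The subgroup of all `γ ∈ Γ₀(L)` with `Γ_∞ γ₀ γ = Γ_∞ γ₀`. -/
def orbitStabilizer (L : ℕ) (γ₀ : Sp2 ℤ) : Subgroup (Gamma0 L) :=
  ((siegelParabolic ℤ).comap (MulAut.conj γ₀).toMonoidHom).subgroupOf (Gamma0 L)

/-- The index set of the Eisenstein series attached to `γ₀`: right cosets `S γ` in `Γ₀(L)`, where
`S` is the stabilizer of `Γ_∞ γ₀`. The map `S γ ↦ Γ_∞ γ₀ γ` is a bijection onto the
`Γ₀(L)`-orbit of `Γ_∞ γ₀`. -/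
abbrev EisensteinIndex (L : ℕ) (γ₀ : Sp2 ℤ) : Type :=
  Quotient (QuotientGroup.rightRel (orbitStabilizer L γ₀))

/-- The term `χ̄(det D_γ) (1|γ₀γ)(τ)` of the Eisenstein series. -/
def eisensteinTerm {N : ℕ} (k : ℕ) (χ : DirichletCharacter ℂ N) (L : ℕ) (γ₀ : Sp2 ℤ)
    (τ : Matrix (Fin 2) (Fin 2) ℂ) (c : EisensteinIndex L γ₀) : ℂ :=
  charDetD χ (c.out : Sp2 ℤ) * slash k (fun _ => 1) (toQ (γ₀ * (c.out : Sp2 ℤ))) τ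

/-- The Eisenstein series of weight `k`, level `L` and character `χ` (a character modulo a divisor
`N` of `L`) attached to `γ₀`: the sum of `χ̄(det D_γ) 1|γ₀γ` over the orbit of `Γ_∞ γ₀` under
`Γ₀(L)`, with `γ ∈ Γ₀(L)` one element for each point `Γ_∞ γ₀ γ` of the orbit. -/
def eisenstein {N : ℕ} (k : ℕ) (χ : DirichletCharacter ℂ N) (L : ℕ) (γ₀ : Sp2 ℤ)
    (τ : Matrix (Fin 2) (Fin 2) ℂ) : ℂ :=
  ∑' c : EisensteinIndex L γ₀, eisensteinTerm k χ L γ₀ τ c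

/-- The matrix `(I 0; M I)` with `M = diag(d₀, d₁)`. -/
def lowerDiag (d : Fin 2 → ℤ) : Sp2 ℤ :=
  ⟨Matrix.fromBlocks 1 0 (Matrix.diagonal d) 1, by
    rw [SymplecticGroup.fromBlocks_mem_iff]
    simp⟩

/-- The diagonal matrix `M = diag(d₀, d₁)` represents the multiplicative partition
`(N₀, N₁, N₂)`: modulo a prime `p` it is `0`, `diag(1, 0)` or `I` according as `p` divides
`N₀`, `N₁` or `N₂`. -/
structure Represents (N₀ N₁ N₂ : ℕ) (d : Fin 2 → ℤ) : Prop where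
  rank_zero : ∀ p : ℕ, p.Prime → p ∣ N₀ → d 0 ≡ 0 [ZMOD p] ∧ d 1 ≡ 0 [ZMOD p]
  rank_one : ∀ p : ℕ, p.Prime → p ∣ N₁ → d 0 ≡ 1 [ZMOD p] ∧ d 1 ≡ 0 [ZMOD p]
  rank_two : ∀ p : ℕ, p.Prime → p ∣ N₂ → d 0 ≡ 1 [ZMOD p] ∧ d 1 ≡ 1 [ZMOD p]

/-- The matrix `δ₁ = diag(p, 1, 1/p, 1)`. -/
def delta1 (p : ℕ) [hp : Fact p.Prime] : Sp2 ℚ :=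
  ⟨Matrix.fromBlocks (Matrix.diagonal ![(p : ℚ), 1]) 0 0 (Matrix.diagonal ![(p : ℚ)⁻¹, 1]), by
    have h : (p : ℚ) ≠ 0 := by exact_mod_cast hp.out.ne_zero
    rw [SymplecticGroup.fromBlocks_mem_iff]
    refine ⟨by simp, by simp, ?_⟩
    ext i j
    fin_cases i <;> fin_cases j <;> simp [h]⟩

/-- The subgroup `δ₁ Γ₀(L) δ₁⁻¹ ∩ Γ₀(L)` of `Γ₀(L)`. -/
def heckeSubgroup (p : ℕ) [Fact p.Prime] (L : ℕ) : Subgroup (Gamma0 L) :=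
  ((((Gamma0 L).map toQ).map (MulAut.conj (delta1 p)).toMonoidHom).comap toQ).subgroupOf (Gamma0 L)

/-- The right cosets of `δ₁ Γ₀(L) δ₁⁻¹ ∩ Γ₀(L)` in `Γ₀(L)`. -/
abbrev HeckeCosets (p : ℕ) [Fact p.Prime] (L : ℕ) : Type :=
  Quotient (QuotientGroup.rightRel (heckeSubgroup p L))

/-- An element of `Sp₂(ℤ)` lies in `Γ₀(L)` iff `L` divides its lower left block. -/
theorem mem_Gamma0 {L : ℕ} {γ : Sp2 ℤ} :
    γ ∈ Gamma0 L ↔ ∀ i j, (L : ℤ) ∣ (γ : Mat4 ℤ) (Sum.inr i) (Sum.inl j) := by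
  constructor
  · intro h i j
    have h' : ((mapSp (Int.castRingHom (ZMod L)) γ : Sp2 (ZMod L)) : Mat4 (ZMod L)).toBlocks₂₁ = 0 := h
    have := congrFun (congrFun h' i) j
    exact (ZMod.intCast_zmod_eq_zero_iff_dvd _ _).1 this
  · intro h
    show ((mapSp (Int.castRingHom (ZMod L)) γ : Sp2 (ZMod L)) : Mat4 (ZMod L)).toBlocks₂₁ = 0
    ext i j
    exact (ZMod.intCast_zmod_eq_zero_iff_dvd _ _).2 (h i j)

/-- Elements of `Γ₀(L)` congruent to `I` modulo `p²` lie in `δ₁ Γ₀(L) δ₁⁻¹`. -/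
theorem mem_hecke_of_congr_one (p : ℕ) [hp : Fact p.Prime] (L : ℕ) (γ : Gamma0 L)
    (h : mapSp (Int.castRingHom (ZMod (p ^ 2))) (γ : Sp2 ℤ) = 1) : γ ∈ heckeSubgroup p L := by
  have hp0 : (p : ℚ) ≠ 0 := by exact_mod_cast hp.out.ne_zero
  have hz : ∀ i j, ∃ z : ℤ, ((γ : Sp2 ℤ) : Mat4 ℤ) i j = (1 : Mat4 ℤ) i j + (p : ℤ) ^ 2 * z := by
    intro i j
    have e := congrFun (congrFun (congrArg Subtype.val h) i) j
    have e' : ((((γ : Sp2 ℤ) : Mat4 ℤ) i j : ℤ) : ZMod (p ^ 2)) = (((1 : Mat4 ℤ) i j : ℤ) : ZMod (p ^ 2)) := by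
      refine e.trans ?_
      by_cases hij : i = j
      · subst hij; simp
      · simp [Matrix.one_apply_ne hij]
    have := (ZMod.intCast_eq_intCast_iff_dvd_sub _ _ _).1 e'.symm
    obtain ⟨z, hz⟩ := this
    refine ⟨z, ?_⟩
    push_cast at hz
    linarith
  choose Z hZ using hz
  -- weights of the rows and columns
  let a : Fin 2 ⊕ Fin 2 → ℤ := Sum.elim ![1, p] ![(p : ℤ) ^ 2, p]
  let b : Fin 2 ⊕ Fin 2 → ℤ := Sum.elim ![(p : ℤ) ^ 2, p] ![1, p]
  let K : Mat4 ℤ := Matrix.of fun i j => (1 : Mat4 ℤ) i j + a i * Z i j * b j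
  have hK : (Int.castRingHom ℚ).mapMatrix K
      = (((delta1 p)⁻¹ * toQ (γ : Sp2 ℤ) * delta1 p : Sp2 ℚ) : Mat4 ℚ) := by
    have hd : ((delta1 p : Sp2 ℚ) : Mat4 ℚ) * (Int.castRingHom ℚ).mapMatrix K
        = ((toQ (γ : Sp2 ℤ) : Sp2 ℚ) : Mat4 ℚ) * ((delta1 p : Sp2 ℚ) : Mat4 ℚ) := by
      have h1 : ((delta1 p : Sp2 ℚ) : Mat4 ℚ)
          = Matrix.diagonal (Sum.elim ![(p : ℚ), 1] ![(p : ℚ)⁻¹, 1]) := by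
        simp [delta1, Matrix.fromBlocks_diagonal]
      rw [h1]
      ext i j
      rw [Matrix.diagonal_mul, Matrix.mul_diagonal]
      have h2 : ((toQ (γ : Sp2 ℤ) : Sp2 ℚ) : Mat4 ℚ) i j
          = ((((1 : Mat4 ℤ) i j + (p : ℤ) ^ 2 * Z i j : ℤ)) : ℚ) := by
        rw [← hZ]; rfl
      rw [h2]
      have h3 : (Int.castRingHom ℚ).mapMatrix K i j
          = (((1 : Mat4 ℤ) i j + a i * Z i j * b j : ℤ) : ℚ) := rfl
      rw [h3]
      rcases i with i | i <;> rcases j with j | j <;> fin_cases i <;> fin_cases j <;>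
        simp [a, b] <;> field_simp
    calc _ = ((((delta1 p)⁻¹ * delta1 p : Sp2 ℚ)) : Mat4 ℚ) * (Int.castRingHom ℚ).mapMatrix K := by
            rw [inv_mul_cancel]; simp
      _ = (((delta1 p)⁻¹ : Sp2 ℚ) : Mat4 ℚ)
            * (((delta1 p : Sp2 ℚ) : Mat4 ℚ) * (Int.castRingHom ℚ).mapMatrix K) := by
            rw [← Matrix.mul_assoc]; rfl
      _ = _ := by
            rw [hd, ← Matrix.mul_assoc]; rfl
  have hinj : Function.Injective ((Int.castRingHom ℚ).mapMatrix : Mat4 ℤ →+* Mat4 ℚ) := by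
    intro x y hxy
    ext i j
    exact Int.cast_injective (α := ℚ) (congrFun (congrFun hxy i) j)
  have hKs : K ∈ Matrix.symplecticGroup (Fin 2) ℤ := by
    rw [SymplecticGroup.mem_iff]
    apply hinj
    have := SymplecticGroup.mem_iff.1 ((delta1 p)⁻¹ * toQ (γ : Sp2 ℤ) * delta1 p : Sp2 ℚ).2
    rw [← hK] at this
    rw [map_mul, map_mul]
    have hJ : (Int.castRingHom ℚ).mapMatrix (Matrix.J (Fin 2) ℤ) = Matrix.J (Fin 2) ℚ :=
      Matrix.map_J _ _
    rw [hJ]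
    exact this
  have hKG : (⟨K, hKs⟩ : Sp2 ℤ) ∈ Gamma0 L := by
    rw [mem_Gamma0]
    intro i j
    have h1 := mem_Gamma0.1 γ.2 i j
    rw [hZ] at h1
    show (L : ℤ) ∣ (1 : Mat4 ℤ) _ _ + a _ * Z _ _ * b _
    have h0 : (1 : Mat4 ℤ) (Sum.inr i) (Sum.inl j) = 0 := by simp
    rw [h0, zero_add] at h1 ⊢
    fin_cases i <;> fin_cases j <;> simp [a, b] at h1 ⊢ <;>
      first
        | exact (h1.mul_right ((p : ℤ) ^ 2)).trans (dvd_of_eq (by ring1))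
        | exact (h1.mul_right (p : ℤ)).trans (dvd_of_eq (by ring1))
        | exact h1.trans (dvd_of_eq (by ring1))
  refine ⟨toQ ⟨K, hKs⟩, ⟨_, hKG, rfl⟩, ?_⟩
  have : toQ ⟨K, hKs⟩ = (delta1 p)⁻¹ * toQ (γ : Sp2 ℤ) * delta1 p := Subtype.ext hK
  rw [this]
  simp [MulAut.conj_apply, mul_assoc]

/-- There are finitely many cosets, so the sum defining `T₁(p²)` is a genuine finite sum. -/
instance finite_heckeCosets (p : ℕ) [hp : Fact p.Prime] (L : ℕ) : Finite (HeckeCosets p L) := by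
  have : NeZero (p ^ 2) := ⟨pow_ne_zero 2 hp.out.ne_zero⟩
  have : Finite (Sp2 (ZMod (p ^ 2))) := Subtype.finite
  let F : HeckeCosets p L → Sp2 (ZMod (p ^ 2)) := fun c =>
    mapSp (Int.castRingHom (ZMod (p ^ 2))) (c.out : Sp2 ℤ)
  refine Finite.of_injective F ?_
  intro c c' h
  rw [← c.out_eq, ← c'.out_eq]
  apply Quotient.sound
  rw [← Quotient.eq_iff_equiv, Quotient.eq, QuotientGroup.rightRel_apply]
  apply mem_hecke_of_congr_one
  have h' : mapSp (Int.castRingHom (ZMod (p ^ 2))) (c.out : Sp2 ℤ)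
    = mapSp (Int.castRingHom (ZMod (p ^ 2))) (c'.out : Sp2 ℤ) := h
  simp [h']

/-- The Hecke operator `T₁(p²)` on functions of weight `k`, level `L` and character `χ`. The sum is
over a set of representatives of the (finitely many) cosets; for forms `f` of this weight, level and
character the terms do not depend on the representatives. -/
def heckeT1 (p : ℕ) [Fact p.Prime] {N : ℕ} (k : ℕ) (χ : DirichletCharacter ℂ N) (L : ℕ)
    (f : Matrix (Fin 2) (Fin 2) ℂ → ℂ) (τ : Matrix (Fin 2) (Fin 2) ℂ) : ℂ :=
  (p : ℂ) ^ ((k : ℤ) - 3) * ∑ᶠ c : HeckeCosets p L,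
    charDetD χ (c.out : Sp2 ℤ) * slash k f ((delta1 p)⁻¹ * toQ (c.out : Sp2 ℤ)) τ

/-- For coprime `q` and `m`, the `q`-component `χ_q` of a Dirichlet character `χ` modulo `q m`:
the character `a ↦ χ(b)` modulo `q`, where `b ≡ a (mod q)` and `b ≡ 1 (mod m)`. -/
def localComponent {q m : ℕ} (h : Nat.Coprime q m) (χ : DirichletCharacter ℂ (q * m)) :
    DirichletCharacter ℂ q :=
  MulChar.ofUnitHom (χ.toUnitHom.comp
    ((Units.map (ZMod.chineseRemainder h).symm.toRingHom.toMonoidHom).comp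
      (MulEquiv.prodUnits.symm.toMonoidHom.comp (MonoidHom.inl (ZMod q)ˣ (ZMod m)ˣ))))

theorem localComponent_apply {q m : ℕ} (h : Nat.Coprime q m) (χ : DirichletCharacter ℂ (q * m))
    (b : (ZMod (q * m))ˣ) (hb : ((b : ZMod (q * m)).cast : ZMod m) = 1) :
    localComponent h χ ((b : ZMod (q * m)).cast : ZMod q) = χ b := by
  have e : ((ZMod.unitsMap (Dvd.intro m rfl : q ∣ q * m) b : (ZMod q)ˣ) : ZMod q)
      = (b : ZMod (q * m)).cast := rfl
  rw [← e, localComponent, MulChar.ofUnitHom_coe, ← MulChar.coe_toUnitHom]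
  simp only [MonoidHom.comp_apply]
  congr 2
  ext
  show (ZMod.chineseRemainder h).symm (_, 1) = _
  rw [RingEquiv.symm_apply_eq, Prod.ext_iff]
  have h2 : (ZMod.chineseRemainder h) (b : ZMod (q * m))
      = ((b : ZMod (q * m)).cast : ZMod q × ZMod m) := rfl
  rw [h2, Prod.fst_zmod_cast, Prod.snd_zmod_cast]
  exact ⟨rfl, hb.symm⟩

end SiegelEisenstein

end

/-!
The proof computes with right cosets of the Siegel parabolic subgroup `P`. A coset `P g` is
determined by the vector of `2 × 2` minors of the lower half `(C D)` of `g`, up to a scalar. Five of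
these minors suffice, `(a, b₁, b₂, b₃, d)` with `a = det C` and `d = det D`, and they satisfy
`a d = b₁ b₃ - b₂²`; the automorphy factor `det(Cτ + D)` is a linear form in them (`pluecker`,
`mem_parabolic_of_pluecker`, `autoFactor_eq`).

*Eisenstein series as sums over all cosets.* Write `N = q m`. Let `F` be the function on `Sp₂(ℤ)`
which at `P γ_M γ` (`P ∈ Γ_∞`, `γ ∈ Γ₀(L)`) is `det(D_P)^k χ(det D_γ)`, and which vanishes off
`Γ_∞ γ_M Γ₀(L)`. Because `χ` is real, `F` is the product of a function modulo `m` and one modulo `q`,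
each defined on a single double coset of the parabolic subgroup (`localFactor`,
`realChar_stabilizer`); conversely, the orbit is recovered from the local double cosets by the
Chinese remainder theorem and by lifting (`exists_orbit`). In terms of minors the function at `q` is
`χ_q(a)` for `M₂`; for `M₁` it is zero unless `q ∣ a`, and then it is `χ_q(b₁)` or `χ_q(b₃)`,
whichever is nonzero (the product `b₁ b₃` being a square modulo `q`); for `M₁₁` the condition `q ∣ a`
becomes `q² ∣ a`. Since `Sp₂(ℚ) = P(ℚ) Sp₂(ℤ)`, each `F` extends to `Sp₂(ℚ)`, and the Eisenstein
series is the sum of `F(g) det(Cτ + D)^{-k}` over `P(ℚ) \ Sp₂(ℚ)` (`eisenstein_eq`). The right action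
of `Sp₂(ℚ)` on such series merely translates `F`.

*The Hecke operator.* Explicit representatives for the Hecke cosets are products of a translation
`(y₁ y₂; y₂ 0)`, with `y₁` modulo `q²` and `y₂` modulo `q`, and a matrix that moves a base point to a
point of the projective line over `ℤ/q` (`bijective_heckeRep`). The assertion thus becomes an identity
between functions on `Sp₂(ℤ)`, with a finite sum over the representatives on one side
(`sum_ratExt_heckeRep`). Two kinds of terms occur: those in which the first minor is multiplied by
`q²` give `χ_q(b₃ - y₁ a)`, whose sum yields the term with `𝔼₁` and, through the sum of `χ_q` over
all residue classes, the one with `𝔼₂`; those in which all of the other minors are divisible by the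
maximal power of `q` give the term with `𝔼₁₁`.

*Convergence.* The automorphy factor does not vanish on nonzero real isotropic vectors, so that by
compactness it is bounded below by a multiple of the norm. It remains to sum `‖w‖⁻⁴` over the nonzero
integral vectors with `a d = b₁ b₃ - b₂²` (`summable_isotropic`): those with `a d = 0` are determined
by three coordinates, and for the others the divisor bound `d(n) = O(n^{1/3})` reduces the sum to
that of `‖b‖^{-10/3}` over `ℤ³`.
-/

namespace SiegelEisenstein

/-! ### Block entries and Plücker vectors -/

section Blocks

variable {R : Type*} [CommRing R]

/-- The entry `(i, j)` of the block `A` of `(A B; C D)`. -/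
def entA (g : Sp2 R) (i j : Fin 2) : R := (g : Mat4 R) (Sum.inl i) (Sum.inl j)

/-- The entry `(i, j)` of the block `B` of `(A B; C D)`. -/
def entB (g : Sp2 R) (i j : Fin 2) : R := (g : Mat4 R) (Sum.inl i) (Sum.inr j)

/-- The entry `(i, j)` of the block `C` of `(A B; C D)`. -/
def entC (g : Sp2 R) (i j : Fin 2) : R := (g : Mat4 R) (Sum.inr i) (Sum.inl j)

/-- The entry `(i, j)` of the block `D` of `(A B; C D)`. -/
def entD (g : Sp2 R) (i j : Fin 2) : R := (g : Mat4 R) (Sum.inr i) (Sum.inr j)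

theorem sp_ext {g h : Sp2 R} (hA : ∀ i j, entA g i j = entA h i j)
    (hB : ∀ i j, entB g i j = entB h i j) (hC : ∀ i j, entC g i j = entC h i j)
    (hD : ∀ i j, entD g i j = entD h i j) : g = h := by
  apply Subtype.ext
  ext i j
  rcases i with i | i <;> rcases j with j | j
  exacts [hA i j, hB i j, hC i j, hD i j]

theorem entA_mul (g h : Sp2 R) (i j : Fin 2) : entA (g * h) i j
    = entA g i 0 * entA h 0 j + entA g i 1 * entA h 1 j
      + (entB g i 0 * entC h 0 j + entB g i 1 * entC h 1 j) := by
  simp [entA, entB, entC, Matrix.mul_apply]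

theorem entB_mul (g h : Sp2 R) (i j : Fin 2) : entB (g * h) i j
    = entA g i 0 * entB h 0 j + entA g i 1 * entB h 1 j
      + (entB g i 0 * entD h 0 j + entB g i 1 * entD h 1 j) := by
  simp [entA, entB, entD, Matrix.mul_apply]

theorem entC_mul (g h : Sp2 R) (i j : Fin 2) : entC (g * h) i j
    = entC g i 0 * entA h 0 j + entC g i 1 * entA h 1 j
      + (entD g i 0 * entC h 0 j + entD g i 1 * entC h 1 j) := by
  simp [entA, entC, entD, Matrix.mul_apply]

theorem entD_mul (g h : Sp2 R) (i j : Fin 2) : entD (g * h) i j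
    = entC g i 0 * entB h 0 j + entC g i 1 * entB h 1 j
      + (entD g i 0 * entD h 0 j + entD g i 1 * entD h 1 j) := by
  simp [entB, entC, entD, Matrix.mul_apply]

theorem entA_one (i j : Fin 2) : entA (1 : Sp2 R) i j = if i = j then 1 else 0 := by
  simp [entA, Matrix.one_apply]

theorem entB_one (i j : Fin 2) : entB (1 : Sp2 R) i j = 0 := by
  simp [entB]

theorem entC_one (i j : Fin 2) : entC (1 : Sp2 R) i j = 0 := by
  simp [entC]

theorem entD_one (i j : Fin 2) : entD (1 : Sp2 R) i j = if i = j then 1 else 0 := by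
  simp [entD, Matrix.one_apply]

theorem entA_inv (g : Sp2 R) (i j : Fin 2) : entA g⁻¹ i j = entD g j i := by
  simp [entA, entD, SymplecticGroup.coe_inv, Matrix.J, Matrix.mul_apply, Matrix.one_apply]

theorem entB_inv (g : Sp2 R) (i j : Fin 2) : entB g⁻¹ i j = -entB g j i := by
  simp [entB, SymplecticGroup.coe_inv, Matrix.J, Matrix.mul_apply, Matrix.one_apply]

theorem entC_inv (g : Sp2 R) (i j : Fin 2) : entC g⁻¹ i j = -entC g j i := by
  simp [entC, SymplecticGroup.coe_inv, Matrix.J, Matrix.mul_apply, Matrix.one_apply]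

theorem entD_inv (g : Sp2 R) (i j : Fin 2) : entD g⁻¹ i j = entA g j i := by
  simp [entA, entD, SymplecticGroup.coe_inv, Matrix.J, Matrix.mul_apply, Matrix.one_apply]

section Map

variable {S : Type*} [CommRing S] (f : R →+* S) (g : Sp2 R) (i j : Fin 2)

@[simp] theorem entA_map : entA (mapSp f g) i j = f (entA g i j) := rfl
@[simp] theorem entB_map : entB (mapSp f g) i j = f (entB g i j) := rfl
@[simp] theorem entC_map : entC (mapSp f g) i j = f (entC g i j) := rfl
@[simp] theorem entD_map : entD (mapSp f g) i j = f (entD g i j) := rfl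

end Map

/-- The relation `C Dᵀ = D Cᵀ`. -/
theorem symm_CD (g : Sp2 R) :
    entC g 0 0 * entD g 1 0 + entC g 0 1 * entD g 1 1
      = entC g 1 0 * entD g 0 0 + entC g 1 1 * entD g 0 1 := by
  have h : entC (g * g⁻¹) 0 1 = 0 := by rw [mul_inv_cancel, entC_one]
  rw [entC_mul] at h
  simp only [entA_inv, entC_inv] at h
  linear_combination h

/-- The relation `A Bᵀ = B Aᵀ`. -/
theorem symm_AB (g : Sp2 R) :
    entA g 0 0 * entB g 1 0 + entA g 0 1 * entB g 1 1
      = entA g 1 0 * entB g 0 0 + entA g 1 1 * entB g 0 1 := by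
  have h : entB (g * g⁻¹) 0 1 = 0 := by rw [mul_inv_cancel, entB_one]
  rw [entB_mul] at h
  simp only [entB_inv, entD_inv] at h
  linear_combination -h

/-- The relation `A Dᵀ - B Cᵀ = 1`. -/
theorem dual_AD (g : Sp2 R) (i j : Fin 2) :
    entA g i 0 * entD g j 0 + entA g i 1 * entD g j 1
      - (entB g i 0 * entC g j 0 + entB g i 1 * entC g j 1) = if i = j then 1 else 0 := by
  have h : entA (g * g⁻¹) i j = if i = j then 1 else 0 := by rw [mul_inv_cancel, entA_one]
  rw [entA_mul] at h
  simp only [entA_inv, entC_inv] at h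
  rw [← h]; ring

/-- The relation `Aᵀ D - Cᵀ B = 1`. -/
theorem dual_AD' (g : Sp2 R) (i j : Fin 2) :
    entA g 0 i * entD g 0 j + entA g 1 i * entD g 1 j
      - (entC g 0 i * entB g 0 j + entC g 1 i * entB g 1 j) = if i = j then 1 else 0 := by
  have h : entD (g⁻¹ * g) i j = if i = j then 1 else 0 := by rw [inv_mul_cancel, entD_one]
  rw [entD_mul] at h
  simp only [entD_inv, entC_inv] at h
  rw [← h]; ring

theorem mem_parabolic {g : Sp2 R} : g ∈ siegelParabolic R ↔ ∀ i j, entC g i j = 0 := by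
  constructor
  · intro h i j
    exact congrFun (congrFun (show (g : Mat4 R).toBlocks₂₁ = 0 from h) i) j
  · intro h
    show (g : Mat4 R).toBlocks₂₁ = 0
    ext i j
    exact h i j

/-- The determinant of the block `D`. -/
def detD (g : Sp2 R) : R := entD g 0 0 * entD g 1 1 - entD g 0 1 * entD g 1 0

theorem det_toBlocks (g : Sp2 R) : (g : Mat4 R).toBlocks₂₂.det = detD g := by
  rw [Matrix.det_fin_two]; rfl

/-- The determinant of the block `A`. -/
def detA (g : Sp2 R) : R := entA g 0 0 * entA g 1 1 - entA g 0 1 * entA g 1 0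

theorem detA_mul_detD {g : Sp2 R} (hg : g ∈ siegelParabolic R) : detA g * detD g = 1 := by
  rw [mem_parabolic] at hg
  have h00 := dual_AD g 0 0
  have h01 := dual_AD g 0 1
  have h10 := dual_AD g 1 0
  have h11 := dual_AD g 1 1
  simp [hg] at h00 h01 h10 h11
  rw [detA, detD]
  linear_combination h00 * (entA g 1 0 * entD g 1 0 + entA g 1 1 * entD g 1 1) + h11
    - h01 * (entA g 1 0 * entD g 0 0 + entA g 1 1 * entD g 0 1)

theorem detD_mul {g : Sp2 R} (h : Sp2 R) (hg : g ∈ siegelParabolic R) :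
    detD (g * h) = detD g * detD h := by
  rw [mem_parabolic] at hg
  simp only [detD, entD_mul, hg]
  ring

theorem isUnit_detD {g : Sp2 R} (hg : g ∈ siegelParabolic R) : IsUnit (detD g) :=
  IsUnit.of_mul_eq_one (detA g) (by rw [mul_comm, detA_mul_detD hg])

theorem detD_one : detD (1 : Sp2 R) = 1 := by simp [detD, entD_one]

theorem detD_map {S : Type*} [CommRing S] (f : R →+* S) (g : Sp2 R) :
    detD (mapSp f g) = f (detD g) := by simp [detD]

theorem mapSp_mem_parabolic {S : Type*} [CommRing S] (f : R →+* S) {g : Sp2 R}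
    (hg : g ∈ siegelParabolic R) : mapSp f g ∈ siegelParabolic S := by
  rw [mem_parabolic] at hg ⊢
  intro i j
  rw [entC_map, hg, map_zero]

end Blocks

section Pluecker

variable {R : Type*} [CommRing R]

/-- The Plücker vector of `(C, D)`. If `c₁, c₂, d₁, d₂` denote the columns of `C` and `D`, and
`[x, y]` is the determinant with columns `x, y`, it is
`([c₁, c₂], [c₁, d₂], [c₂, d₂], [d₁, c₂], [d₁, d₂])`.
The sixth minor `[c₁, d₁]` is `-[c₂, d₂]`, as `C Dᵀ` is symmetric. -/
def pluecker (g : Sp2 R) : Fin 5 → R :=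
  ![entC g 0 0 * entC g 1 1 - entC g 0 1 * entC g 1 0,
    entC g 0 0 * entD g 1 1 - entD g 0 1 * entC g 1 0,
    entC g 0 1 * entD g 1 1 - entD g 0 1 * entC g 1 1,
    entD g 0 0 * entC g 1 1 - entC g 0 1 * entD g 1 0,
    detD g]

theorem pluecker_map {S : Type*} [CommRing S] (f : R →+* S) (g : Sp2 R) (i : Fin 5) :
    pluecker (mapSp f g) i = f (pluecker g i) := by
  fin_cases i <;> simp [pluecker, detD]

theorem pluecker_isotropic (g : Sp2 R) :
    pluecker g 0 * pluecker g 4 = pluecker g 1 * pluecker g 3 - pluecker g 2 ^ 2 := by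
  have h := symm_CD g
  simp [pluecker, detD]
  linear_combination h * (entC g 0 1 * entD g 1 1 - entD g 0 1 * entC g 1 1)

theorem pluecker_mul_left {g : Sp2 R} (p : Sp2 R) (hp : p ∈ siegelParabolic R) :
    pluecker (p * g) = detD p • pluecker g := by
  rw [mem_parabolic] at hp
  ext i
  fin_cases i <;> simp [pluecker, detD, entC_mul, entD_mul, hp] <;> ring

/-- Plücker vectors are unimodular: by the Laplace expansion along the lower rows, the determinant
one of a symplectic matrix is a combination of the minors of `(C, D)`. -/
theorem exists_pluecker_unimodular (g : Sp2 R) : ∃ x : Fin 5 → R, ∑ i, x i * pluecker g i = 1 := by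
  have h00 := dual_AD g 0 0
  have h01 := dual_AD g 0 1
  have h10 := dual_AD g 1 0
  have h11 := dual_AD g 1 1
  have h := symm_CD g
  simp at h00 h01 h10 h11
  refine ⟨![entB g 0 0 * entB g 1 1 - entB g 0 1 * entB g 1 0,
    -(entB g 0 0 * entA g 1 1 - entA g 0 1 * entB g 1 0),
    -(entB g 0 1 * entA g 1 1 - entA g 0 1 * entB g 1 1)
      + (entB g 0 0 * entA g 1 0 - entA g 0 0 * entB g 1 0),
    -(entA g 0 0 * entB g 1 1 - entB g 0 1 * entA g 1 0),
    entA g 0 0 * entA g 1 1 - entA g 0 1 * entA g 1 0], ?_⟩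
  simp [Fin.sum_univ_five, pluecker, detD]
  linear_combination h00 * (entA g 1 0 * entD g 1 0 + entA g 1 1 * entD g 1 1
      - (entB g 1 0 * entC g 1 0 + entB g 1 1 * entC g 1 1)) + h11
    - h01 * (entA g 1 0 * entD g 0 0 + entA g 1 1 * entD g 0 1
      - (entB g 1 0 * entC g 0 0 + entB g 1 1 * entC g 0 1))
    + h * (entB g 0 0 * entA g 1 0 - entA g 0 0 * entB g 1 0)

theorem pluecker_smul_injective (g : Sp2 R) {a b : R} (h : a • pluecker g = b • pluecker g) :
    a = b := by
  obtain ⟨x, hx⟩ := exists_pluecker_unimodular g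
  have h' : ∀ i, a * pluecker g i = b * pluecker g i := fun i => congrFun h i
  have hs : ∀ c : R, ∑ i, x i * (c * pluecker g i) = c := fun c => by
    calc _ = c * ∑ i, x i * pluecker g i := by
          rw [Finset.mul_sum]; exact Finset.sum_congr rfl fun i _ => by ring
      _ = c := by rw [hx, mul_one]
  rw [← hs a, ← hs b]
  simp only [h']

/-- The Plücker vector determines the coset of the Siegel parabolic subgroup. -/
theorem mem_parabolic_of_pluecker {g h : Sp2 R} {c : R} (hgh : pluecker g = c • pluecker h) :
    g * h⁻¹ ∈ siegelParabolic R ∧ detD (g * h⁻¹) = c := by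
  have key : h * g⁻¹ ∈ siegelParabolic R := by
    have e : ∀ i, pluecker g i = c * pluecker h i := fun i => congrFun hgh i
    have e0 := e 0
    have e1 := e 1
    have e2 := e 2
    have e3 := e 3
    have e4 := e 4
    simp [pluecker, detD] at e0 e1 e2 e3 e4
    have hg := symm_CD g
    have hh := symm_CD h
    have d00 := dual_AD g 0 0
    have d01 := dual_AD g 0 1
    have d10 := dual_AD g 1 0
    have d11 := dual_AD g 1 1
    simp at d00 d01 d10 d11
    rw [mem_parabolic]
    -- the contraction of `r' ∧ r₀ ∧ r₁ = 0` with the symplectic form, coordinate by coordinate;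
    -- here `r₀, r₁` are the lower rows of `g` and `r'` is a lower row of `h`
    intro i j
    obtain ⟨s, hs⟩ : ∃ s, entC (h * g⁻¹) i 0 = s := ⟨_, rfl⟩
    obtain ⟨t, ht⟩ : ∃ t, entC (h * g⁻¹) i 1 = t := ⟨_, rfl⟩
    have hs' := hs
    have ht' := ht
    simp only [entC_mul, entA_inv, entC_inv] at hs' ht'
    have k1 : s * entC g 1 0 = t * entC g 0 0 := by
      rw [← hs', ← ht']
      fin_cases i <;> simp
      · linear_combination entC h 0 0 * e2 - entC h 0 1 * e1 + entD h 0 1 * e0 - entC h 0 0 * hg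
      · linear_combination entC h 1 0 * e2 - entC h 1 1 * e1 + entD h 1 1 * e0 - entC h 1 0 * hg
    have k2 : s * entC g 1 1 = t * entC g 0 1 := by
      rw [← hs', ← ht']
      fin_cases i <;> simp
      · linear_combination entC h 0 0 * e3 - entC h 0 1 * e2 - entD h 0 0 * e0
          - c * entC h 0 1 * hh
      · linear_combination entC h 1 0 * e3 - entC h 1 1 * e2 - entD h 1 0 * e0
          - c * entC h 1 1 * hh
    have k3 : s * entD g 1 0 = t * entD g 0 0 := by
      rw [← hs', ← ht']
      fin_cases i <;> simp
      · linear_combination -entC h 0 1 * e4 + entD h 0 1 * e3 + entD h 0 0 * e2 - entD h 0 0 * hg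
      · linear_combination -entC h 1 1 * e4 + entD h 1 1 * e3 + entD h 1 0 * e2 - entD h 1 0 * hg
    have k4 : s * entD g 1 1 = t * entD g 0 1 := by
      rw [← hs', ← ht']
      fin_cases i <;> simp
      · linear_combination entC h 0 0 * e4 - entD h 0 0 * e1 - entD h 0 1 * e2
          - c * entD h 0 1 * hh
      · linear_combination entC h 1 0 * e4 - entD h 1 0 * e1 - entD h 1 1 * e2
          - c * entD h 1 1 * hh
    have hs0 : s = 0 := by
      linear_combination -s * d11 + t * d10 + entA g 1 0 * k3 + entA g 1 1 * k4
        - entB g 1 0 * k1 - entB g 1 1 * k2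
    have ht0 : t = 0 := by
      linear_combination -t * d00 + s * d01 - entA g 0 0 * k3 - entA g 0 1 * k4
        + entB g 0 0 * k1 + entB g 0 1 * k2
    fin_cases j
    · exact hs.trans hs0
    · exact ht.trans ht0
  have key' : g * h⁻¹ ∈ siegelParabolic R := by
    have := inv_mem key
    rwa [_root_.mul_inv_rev, inv_inv] at this
  refine ⟨key', ?_⟩
  have e := pluecker_mul_left (g := h) _ key'
  rw [inv_mul_cancel_right, hgh] at e
  exact (pluecker_smul_injective h e).symm

end Pluecker

/-! ### Elements of the Siegel parabolic subgroup -/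

section Elements

variable {R : Type*} [CommRing R]

/-- The matrix `(I T; 0 I)` with `T = (y₁ y₂; y₂ y₃)`. -/
def unip (y₁ y₂ y₃ : R) : Sp2 R :=
  ⟨Matrix.fromBlocks 1 !![y₁, y₂; y₂, y₃] 0 1, by
    rw [SymplecticGroup.fromBlocks_mem_iff]
    refine ⟨by simp, ?_, by simp⟩
    ext i j
    fin_cases i <;> fin_cases j <;> simp⟩

/-- The matrix `(A 0; 0 A⁻ᵀ)` with `A = (a b; c d)`, where `u` is the inverse of `det A`. -/
def levi (a b c d u : R) (h : (a * d - b * c) * u = 1) : Sp2 R :=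
  ⟨Matrix.fromBlocks !![a, b; c, d] 0 0 !![u * d, -(u * c); -(u * b), u * a], by
    rw [SymplecticGroup.fromBlocks_mem_iff]
    refine ⟨by simp, by simp, ?_⟩
    ext i j
    fin_cases i <;> fin_cases j <;> simp [Matrix.mul_apply]
    · linear_combination h
    · ring
    · ring
    · linear_combination h⟩

/-- The matrix `(I 0; M I)` with `M = diag(e₁, e₂)`. -/
def lowerUnip (e₁ e₂ : R) : Sp2 R :=
  ⟨Matrix.fromBlocks 1 0 (Matrix.diagonal ![e₁, e₂]) 1, by
    rw [SymplecticGroup.fromBlocks_mem_iff]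
    simp⟩

section Entries

variable (y₁ y₂ y₃ a b c d u e₁ e₂ : R) (h : (a * d - b * c) * u = 1) (i j : Fin 2)

theorem entA_unip : entA (unip y₁ y₂ y₃) i j = (1 : Matrix (Fin 2) (Fin 2) R) i j := rfl
theorem entB_unip : entB (unip y₁ y₂ y₃) i j = !![y₁, y₂; y₂, y₃] i j := rfl
theorem entC_unip : entC (unip y₁ y₂ y₃) i j = 0 := rfl
theorem entD_unip : entD (unip y₁ y₂ y₃) i j = (1 : Matrix (Fin 2) (Fin 2) R) i j := rfl
theorem entA_levi : entA (levi a b c d u h) i j = !![a, b; c, d] i j := rfl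
theorem entB_levi : entB (levi a b c d u h) i j = 0 := rfl
theorem entC_levi : entC (levi a b c d u h) i j = 0 := rfl
theorem entD_levi : entD (levi a b c d u h) i j = !![u * d, -(u * c); -(u * b), u * a] i j := rfl
theorem entA_lowerUnip : entA (lowerUnip e₁ e₂) i j = (1 : Matrix (Fin 2) (Fin 2) R) i j := rfl
theorem entB_lowerUnip : entB (lowerUnip e₁ e₂) i j = 0 := rfl
theorem entC_lowerUnip : entC (lowerUnip e₁ e₂) i j = Matrix.diagonal ![e₁, e₂] i j := rfl
theorem entD_lowerUnip : entD (lowerUnip e₁ e₂) i j = (1 : Matrix (Fin 2) (Fin 2) R) i j := rfl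

theorem unip_mem : unip y₁ y₂ y₃ ∈ siegelParabolic R := mem_parabolic.2 fun _ _ => rfl

theorem levi_mem : levi a b c d u h ∈ siegelParabolic R := mem_parabolic.2 fun _ _ => rfl

theorem detD_unip : detD (unip y₁ y₂ y₃) = 1 := by
  simp [detD, entD_unip]

theorem detD_levi : detD (levi a b c d u h) = u := by
  simp [detD, entD_levi]
  linear_combination u * h

theorem pluecker_lowerUnip : pluecker (lowerUnip e₁ e₂) = ![e₁ * e₂, e₁, 0, e₂, 1] := by
  simp [pluecker, entC_lowerUnip, entD_lowerUnip, detD]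

end Entries

theorem lowerDiag_eq (d : Fin 2 → ℤ) : lowerDiag d = lowerUnip (d 0) (d 1) := by
  apply Subtype.ext
  have : d = ![d 0, d 1] := by ext i; fin_cases i <;> rfl
  show Matrix.fromBlocks 1 0 (Matrix.diagonal d) 1 = Matrix.fromBlocks 1 0 _ 1
  rw [← this]

theorem mapSp_lowerUnip {S : Type*} [CommRing S] (f : R →+* S) (e₁ e₂ : R) :
    mapSp f (lowerUnip e₁ e₂) = lowerUnip (f e₁) (f e₂) := by
  apply sp_ext <;> intro i j <;> fin_cases i <;> fin_cases j <;>
    simp [entA_lowerUnip, entB_lowerUnip, entC_lowerUnip, entD_lowerUnip]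

theorem mapSp_unip {S : Type*} [CommRing S] (f : R →+* S) (y₁ y₂ y₃ : R) :
    mapSp f (unip y₁ y₂ y₃) = unip (f y₁) (f y₂) (f y₃) := by
  apply sp_ext <;> intro i j <;> fin_cases i <;> fin_cases j <;>
    simp [entA_unip, entB_unip, entC_unip, entD_unip]

theorem mapSp_levi {S : Type*} [CommRing S] (f : R →+* S) (a b c d u : R)
    (h : (a * d - b * c) * u = 1) :
    mapSp f (levi a b c d u h) = levi (f a) (f b) (f c) (f d) (f u)
      (by rw [← map_mul, ← map_mul, ← map_sub, ← map_mul, h, map_one]) := by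
  apply sp_ext <;> intro i j <;> fin_cases i <;> fin_cases j <;>
    simp [entA_levi, entB_levi, entC_levi, entD_levi]

theorem unip_inv (y₁ y₂ y₃ : R) : (unip y₁ y₂ y₃)⁻¹ = unip (-y₁) (-y₂) (-y₃) := by
  apply sp_ext <;> intro i j <;> fin_cases i <;> fin_cases j <;>
    simp [entA_inv, entB_inv, entC_inv, entD_inv, entA_unip, entB_unip, entC_unip, entD_unip]

theorem levi_inv (a b c d u : R) (h : (a * d - b * c) * u = 1) :
    (levi a b c d u h)⁻¹ = levi (u * d) (-(u * b)) (-(u * c)) (u * a) (a * d - b * c)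
      (by linear_combination ((a * d - b * c) * u + 1) * h) := by
  apply sp_ext <;> intro i j <;> fin_cases i <;> fin_cases j <;>
    simp [entA_inv, entB_inv, entC_inv, entD_inv, entA_levi, entB_levi, entC_levi, entD_levi]
  · linear_combination -a * h
  · linear_combination -c * h
  · linear_combination -b * h
  · linear_combination -d * h

/-- Every element of the Siegel parabolic subgroup is the product of a unipotent element and an
element of the Levi subgroup. -/
theorem exists_unip_mul_levi {g : Sp2 R} (hg : g ∈ siegelParabolic R) :
    ∃ y₁ y₂ y₃ a b c d u h, g = unip y₁ y₂ y₃ * levi a b c d u h ∧ u = detD g := by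
  have hdet := detA_mul_detD hg
  rw [mem_parabolic] at hg
  have h00 := dual_AD g 0 0
  have h01 := dual_AD g 0 1
  have h10 := dual_AD g 1 0
  have h11 := dual_AD g 1 1
  have k00 := dual_AD' g 0 0
  have k01 := dual_AD' g 0 1
  have k10 := dual_AD' g 1 0
  have k11 := dual_AD' g 1 1
  have hs := symm_AB g
  simp [hg] at h00 h01 h10 h11 k00 k01 k10 k11
  rw [detA] at hdet
  have n00 : entD g 0 0 = detD g * entA g 1 1 := by
    rw [detD]; linear_combination - entD g 0 0 * h11 + entD g 1 0 * h10
  have n01 : entD g 0 1 = -(detD g * entA g 1 0) := by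
    rw [detD]; linear_combination - entD g 0 1 * h11 + entD g 1 1 * h10
  have n10 : entD g 1 0 = -(detD g * entA g 0 1) := by
    rw [detD]; linear_combination - entD g 1 0 * h00 + entD g 0 0 * h01
  have n11 : entD g 1 1 = detD g * entA g 0 0 := by
    rw [detD]; linear_combination - entD g 1 1 * h00 + entD g 0 1 * h01
  refine ⟨entB g 0 0 * entA g 0 0 + entB g 0 1 * entA g 0 1,
    entB g 0 0 * entA g 1 0 + entB g 0 1 * entA g 1 1,
    entB g 1 0 * entA g 1 0 + entB g 1 1 * entA g 1 1,
    entA g 0 0, entA g 0 1, entA g 1 0, entA g 1 1, detD g, hdet, ?_, rfl⟩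
  apply sp_ext <;> intro i j
  · fin_cases i <;> fin_cases j <;>
      simp [entA_mul, entA_levi, entC_levi, entA_unip, entB_unip]
  · fin_cases i <;> fin_cases j <;>
      simp [entB_mul, entB_levi, entD_levi, entA_unip, entB_unip]
    · linear_combination -entB g 0 0 * k00 - entB g 0 1 * k10
        + (entB g 0 0 * entA g 0 0 + entB g 0 1 * entA g 0 1) * n00
        + (entB g 0 0 * entA g 1 0 + entB g 0 1 * entA g 1 1) * n10
    · linear_combination -entB g 0 0 * k01 - entB g 0 1 * k11
        + (entB g 0 0 * entA g 0 0 + entB g 0 1 * entA g 0 1) * n01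
        + (entB g 0 0 * entA g 1 0 + entB g 0 1 * entA g 1 1) * n11
    · linear_combination -entB g 1 0 * k00 - entB g 1 1 * k10 + entD g 0 0 * hs
        + (entB g 0 0 * entA g 1 0 + entB g 0 1 * entA g 1 1) * n00
        + (entB g 1 0 * entA g 1 0 + entB g 1 1 * entA g 1 1) * n10
    · linear_combination -entB g 1 0 * k01 - entB g 1 1 * k11 + entD g 0 1 * hs
        + (entB g 0 0 * entA g 1 0 + entB g 0 1 * entA g 1 1) * n01
        + (entB g 1 0 * entA g 1 0 + entB g 1 1 * entA g 1 1) * n11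
  · rw [hg]
    fin_cases i <;> fin_cases j <;>
      simp [entC_mul, entA_levi, entC_levi, entC_unip, entD_unip]
  · fin_cases i <;> fin_cases j <;>
      simp [entD_mul, entB_levi, entD_levi, entC_unip, entD_unip, n00, n01, n10, n11]

theorem pluecker_mul_unip (g : Sp2 R) (y₁ y₂ y₃ : R) :
    pluecker (g * unip y₁ y₂ y₃) = ![pluecker g 0, pluecker g 1 + y₃ * pluecker g 0,
      pluecker g 2 - y₂ * pluecker g 0, pluecker g 3 + y₁ * pluecker g 0,
      pluecker g 4 + y₁ * pluecker g 1 + 2 * y₂ * pluecker g 2 + y₃ * pluecker g 3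
        + (y₁ * y₃ - y₂ ^ 2) * pluecker g 0] := by
  have h := symm_CD g
  ext i
  fin_cases i <;> simp [pluecker, detD, entC_mul, entD_mul, entA_unip, entB_unip, entC_unip,
    entD_unip]
  · ring
  · ring
  · ring
  · linear_combination -y₂ * h

theorem pluecker_mul_levi (g : Sp2 R) (a b c d u : R) (h : (a * d - b * c) * u = 1) :
    pluecker (g * levi a b c d u h) = ![(a * d - b * c) * pluecker g 0,
      u * (a ^ 2 * pluecker g 1 + 2 * a * c * pluecker g 2 + c ^ 2 * pluecker g 3),
      u * (a * b * pluecker g 1 + (a * d + b * c) * pluecker g 2 + c * d * pluecker g 3),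
      u * (b ^ 2 * pluecker g 1 + 2 * b * d * pluecker g 2 + d ^ 2 * pluecker g 3),
      u * pluecker g 4] := by
  have hs := symm_CD g
  ext i
  fin_cases i <;> simp [pluecker, detD, entC_mul, entD_mul, entA_levi, entB_levi, entC_levi,
    entD_levi]
  · ring
  · linear_combination -a * c * u * hs
  · linear_combination -b * c * u * hs
  · linear_combination -b * d * u * hs
  · linear_combination u * (entD g 0 0 * entD g 1 1 - entD g 0 1 * entD g 1 0) * h

end Elements

/-! ### Local factors and normal forms -/

section LocalFactor

variable {R : Type*} [CommRing R]

theorem pluecker_zero_mul_right (g : Sp2 R) {Q : Sp2 R} (hQ : Q ∈ siegelParabolic R) :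
    pluecker (g * Q) 0 = detA Q * pluecker g 0 := by
  rw [mem_parabolic] at hQ
  simp [pluecker, detA, entC_mul, hQ]
  ring

theorem realChar_sq {ψ : MulChar R ℂ} (hψ : ψ ^ 2 = 1) {a : R} (ha : IsUnit a) :
    ψ a * ψ a = 1 := by
  have := congrArg (fun f : MulChar R ℂ => f a) hψ
  simp only [MulChar.pow_apply' ψ two_ne_zero, MulChar.one_apply ha] at this
  rw [← this, sq]

theorem realChar_of_mul_eq_one {ψ : MulChar R ℂ} (hψ : ψ ^ 2 = 1) {a b : R} (h : a * b = 1) :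
    ψ a = ψ b := by
  have ha : IsUnit a := IsUnit.of_mul_eq_one _ h
  have h1 : ψ a * ψ b = 1 := by rw [← map_mul, h, map_one]
  calc ψ a = ψ a * (ψ a * ψ b) := by rw [h1, mul_one]
    _ = ψ b := by rw [← mul_assoc, realChar_sq hψ ha, one_mul]

/-- The stabilizer of the coset of `(I 0; M I)` in the Siegel parabolic subgroup: if `M` is
idempotent, then the two determinants that occur differ by a square, so that a real character
does not distinguish them. -/
theorem realChar_stabilizer {ψ : MulChar R ℂ} (hψ : ψ ^ 2 = 1) {e₁ e₂ : R}
    (h₁ : e₁ * e₁ = e₁) (h₂ : e₂ * e₂ = e₂) (h₁₂ : e₁ * e₂ = e₂) {P Q : Sp2 R}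
    (hP : P ∈ siegelParabolic R) (hQ : Q ∈ siegelParabolic R)
    (h : lowerUnip e₁ e₂ * Q = P * lowerUnip e₁ e₂) : ψ (detD P) = ψ (detD Q) := by
  obtain ⟨y₁, y₂, y₃, a, b, c, d, u, hu, rfl, -⟩ := exists_unip_mul_levi hQ
  have e := congrArg pluecker h
  rw [pluecker_mul_left _ hP, ← mul_assoc, pluecker_mul_levi, pluecker_mul_unip,
    pluecker_lowerUnip] at e
  have e0 := congrFun e 0
  have e1 := congrFun e 1
  have e4 := congrFun e 4
  simp [h₁₂] at e0 e1 e4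
  rw [detD_mul _ (unip_mem _ _ _), detD_unip, detD_levi, one_mul]
  have hPu := isUnit_detD hP
  set μ := detD P
  -- `u μ` is the square of the following element, on each of the three idempotent components
  have key : u * μ = (e₂ + (1 - e₁) * u + (e₁ - e₂) * (u * a)) ^ 2 := by
    have f0 : u * μ * e₂ = e₂ := by linear_combination -u * e0 + e₂ * hu
    have f1 : μ * (1 - e₁) = u * (1 - e₁) := by
      linear_combination -(1 - e₁) * e4 - u * y₁ * h₁ - u * (y₃ + y₁ * y₃ - y₂ ^ 2) * h₁₂
    have f2 : μ * (e₁ - e₂) = u * a ^ 2 * (e₁ - e₂) := by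
      linear_combination -(e₁ - e₂) * e1 + (u * a ^ 2 - μ) * (h₁ - h₁₂)
        + u * (a ^ 2 * y₃ - 2 * a * c * y₂ + c ^ 2 * (1 + y₁)) * (h₁₂ - h₂)
    have g1 : (1 - e₁) * (1 - e₁) = 1 - e₁ := by linear_combination h₁
    have g2 : (e₁ - e₂) * (e₁ - e₂) = e₁ - e₂ := by linear_combination h₁ + h₂ - 2 * h₁₂
    have g3 : e₂ * (1 - e₁) = 0 := by linear_combination -h₁₂
    have g4 : e₂ * (e₁ - e₂) = 0 := by linear_combination h₁₂ - h₂
    have g5 : (1 - e₁) * (e₁ - e₂) = 0 := by linear_combination -h₁ + h₁₂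
    linear_combination f0 + u * f1 + u * f2 - h₂ - u ^ 2 * g1 - u ^ 2 * a ^ 2 * g2
      - 2 * u * g3 - 2 * u * a * g4 - 2 * u ^ 2 * a * g5
  have huu : IsUnit u := IsUnit.of_mul_eq_one (a * d - b * c) (by rw [mul_comm, hu])
  have hk : IsUnit (e₂ + (1 - e₁) * u + (e₁ - e₂) * (u * a)) := by
    have := huu.mul hPu
    rw [key] at this
    exact (isUnit_pow_iff two_ne_zero).1 this
  have h1 : ψ u * ψ μ = 1 := by rw [← map_mul, key, sq, map_mul, realChar_sq hψ hk]
  calc ψ μ = ψ u * ψ u * ψ μ := by rw [realChar_sq hψ huu, one_mul]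
    _ = ψ u := by rw [mul_assoc, h1, mul_one]

open Classical in
/-- The function on `Sp₂(R)` which is `ψ(det D_P) ψ(det D_Q)` at `P γ_M Q`, where `P` and `Q` are in
the Siegel parabolic subgroup and `γ_M = (I 0; M I)`, `M = diag(e₁, e₂)`, and zero outside of this
double coset. -/
noncomputable def localFactor (ψ : MulChar R ℂ) (e₁ e₂ : R) (g : Sp2 R) : ℂ :=
  if h : ∃ P Q : Sp2 R, P ∈ siegelParabolic R ∧ Q ∈ siegelParabolic R ∧
    g = P * lowerUnip e₁ e₂ * Q then ψ (detD h.choose) * ψ (detD h.choose_spec.choose) else 0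

theorem localFactor_eq_zero {ψ : MulChar R ℂ} {e₁ e₂ : R} {g : Sp2 R}
    (h : ¬ ∃ P Q : Sp2 R, P ∈ siegelParabolic R ∧ Q ∈ siegelParabolic R ∧
      g = P * lowerUnip e₁ e₂ * Q) : localFactor ψ e₁ e₂ g = 0 := dif_neg h

theorem exists_of_localFactor_ne_zero {ψ : MulChar R ℂ} {e₁ e₂ : R} {g : Sp2 R}
    (h : localFactor ψ e₁ e₂ g ≠ 0) : ∃ P Q : Sp2 R, P ∈ siegelParabolic R ∧
      Q ∈ siegelParabolic R ∧ g = P * lowerUnip e₁ e₂ * Q := by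
  by_contra hn
  exact h (localFactor_eq_zero hn)

/-- A real character and an idempotent matrix `diag(e₁, e₂)`, `e₁ ≥ e₂`: the data for which
`localFactor` is well defined. -/
structure LocalDatum (ψ : MulChar R ℂ) (e₁ e₂ : R) : Prop where
  real : ψ ^ 2 = 1
  idem₁ : e₁ * e₁ = e₁
  idem₂ : e₂ * e₂ = e₂
  le : e₁ * e₂ = e₂

variable {ψ : MulChar R ℂ} {e₁ e₂ : R}

theorem LocalDatum.apply (H : LocalDatum ψ e₁ e₂) {P Q : Sp2 R} (hP : P ∈ siegelParabolic R)
    (hQ : Q ∈ siegelParabolic R) :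
    localFactor ψ e₁ e₂ (P * lowerUnip e₁ e₂ * Q) = ψ (detD P) * ψ (detD Q) := by
  have h : ∃ P' Q' : Sp2 R, P' ∈ siegelParabolic R ∧ Q' ∈ siegelParabolic R ∧
    P * lowerUnip e₁ e₂ * Q = P' * lowerUnip e₁ e₂ * Q' := ⟨P, Q, hP, hQ, rfl⟩
  rw [localFactor, dif_pos h]
  obtain ⟨hP', hQ', e⟩ := h.choose_spec.choose_spec
  generalize h.choose_spec.choose = Q' at *
  generalize h.choose = P' at *
  have e' : lowerUnip e₁ e₂ * (Q * Q'⁻¹) = (P⁻¹ * P') * lowerUnip e₁ e₂ := by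
    have : lowerUnip e₁ e₂ * Q = P⁻¹ * (P' * lowerUnip e₁ e₂ * Q') := by
      rw [← e]; group
    rw [← mul_assoc, this]; group
  have hs := realChar_stabilizer H.real H.idem₁ H.idem₂ H.le (mul_mem (inv_mem hP) hP')
    (mul_mem hQ (inv_mem hQ')) e'
  have hPP : detD P' = detD P * detD (P⁻¹ * P') := by
    rw [← detD_mul _ hP, mul_inv_cancel_left]
  have hQQ : detD Q = detD (Q * Q'⁻¹) * detD Q' := by
    rw [← detD_mul _ (mul_mem hQ (inv_mem hQ')), inv_mul_cancel_right]
  rw [hPP, hQQ, map_mul, map_mul, hs]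
  ring

theorem LocalDatum.apply_mul_left (H : LocalDatum ψ e₁ e₂) {p : Sp2 R} (hp : p ∈ siegelParabolic R)
    (g : Sp2 R) : localFactor ψ e₁ e₂ (p * g) = ψ (detD p) * localFactor ψ e₁ e₂ g := by
  by_cases h : ∃ P Q : Sp2 R, P ∈ siegelParabolic R ∧ Q ∈ siegelParabolic R ∧
      g = P * lowerUnip e₁ e₂ * Q
  · obtain ⟨P, Q, hP, hQ, rfl⟩ := h
    rw [← mul_assoc, ← mul_assoc, H.apply (mul_mem hp hP) hQ, H.apply hP hQ, detD_mul _ hp,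
      map_mul, mul_assoc]
  · rw [localFactor_eq_zero h, localFactor_eq_zero, mul_zero]
    rintro ⟨P, Q, hP, hQ, e⟩
    refine h ⟨p⁻¹ * P, Q, mul_mem (inv_mem hp) hP, hQ, ?_⟩
    rw [mul_assoc, mul_assoc, ← mul_assoc P, ← e, inv_mul_cancel_left]

theorem LocalDatum.apply_mul_right (H : LocalDatum ψ e₁ e₂) {p : Sp2 R}
    (hp : p ∈ siegelParabolic R) (g : Sp2 R) :
    localFactor ψ e₁ e₂ (g * p) = ψ (detD p) * localFactor ψ e₁ e₂ g := by
  by_cases h : ∃ P Q : Sp2 R, P ∈ siegelParabolic R ∧ Q ∈ siegelParabolic R ∧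
      g = P * lowerUnip e₁ e₂ * Q
  · obtain ⟨P, Q, hP, hQ, rfl⟩ := h
    rw [mul_assoc, H.apply hP (mul_mem hQ hp), H.apply hP hQ, detD_mul _ hQ,
      map_mul]
    ring
  · rw [localFactor_eq_zero h, localFactor_eq_zero, mul_zero]
    rintro ⟨P, Q, hP, hQ, e⟩
    refine h ⟨P, Q * p⁻¹, hP, mul_mem hQ (inv_mem hp), ?_⟩
    rw [← mul_assoc, ← e, mul_inv_cancel_right]

/-- The local factor only depends on the Plücker vector, up to the obvious scalar. -/
theorem LocalDatum.apply_of_pluecker (H : LocalDatum ψ e₁ e₂) {g h : Sp2 R} {c : R}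
    (hgh : pluecker g = c • pluecker h) :
    localFactor ψ e₁ e₂ g = ψ c * localFactor ψ e₁ e₂ h := by
  obtain ⟨h1, h2⟩ := mem_parabolic_of_pluecker hgh
  rw [← h2, ← H.apply_mul_left h1, inv_mul_cancel_right]

theorem norm_realChar_le (hψ : ψ ^ 2 = 1) (a : R) : ‖ψ a‖ ≤ 1 := by
  by_cases ha : IsUnit a
  · have := congrArg norm (realChar_sq hψ ha)
    rw [norm_mul, norm_one] at this
    nlinarith [norm_nonneg (ψ a)]
  · rw [MulChar.map_nonunit _ ha]; simp

theorem norm_localFactor_le (hψ : ψ ^ 2 = 1) (g : Sp2 R) : ‖localFactor ψ e₁ e₂ g‖ ≤ 1 := by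
  rw [localFactor]
  split_ifs
  · rw [norm_mul]
    exact mul_le_one₀ (norm_realChar_le hψ _) (norm_nonneg _) (norm_realChar_le hψ _)
  · simp

/-- In a double coset `P γ_M Q` the factor `P` can be chosen with `det D_P = 1`. -/
theorem exists_normalized {e₁ e₂ : R} (h₁ : e₁ * e₁ = e₁) (h₁₂ : e₁ * e₂ = e₂)
    {P Q : Sp2 R} (hP : P ∈ siegelParabolic R) (hQ : Q ∈ siegelParabolic R) :
    ∃ P' Q' : Sp2 R, P' ∈ siegelParabolic R ∧ Q' ∈ siegelParabolic R ∧ detD P' = 1 ∧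
      P * lowerUnip e₁ e₂ * Q = P' * lowerUnip e₁ e₂ * Q' := by
  obtain ⟨⟨u, v, huv, hvu⟩, hu'⟩ := isUnit_detD hP
  have hu : detD P = u := hu'.symm
  have hα : ((u * e₁ + v * (1 - e₁)) * 1 - 0 * 0) * (v * e₁ + u * (1 - e₁)) = 1 := by
    linear_combination (1 - 2 * e₁ + 2 * e₁ ^ 2) * huv + (2 - u ^ 2 - v ^ 2) * h₁
  let S := levi (u * e₁ + v * (1 - e₁)) 0 0 1 _ hα * unip (1 - v ^ 2) 0 0
  have hS : S ∈ siegelParabolic R := mul_mem (levi_mem ..) (unip_mem ..)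
  have e : pluecker (P * lowerUnip e₁ e₂ * Q) = (1 : R) • pluecker (lowerUnip e₁ e₂ * (S * Q)) := by
    have hPS : pluecker (P * lowerUnip e₁ e₂) = (1 : R) • pluecker (lowerUnip e₁ e₂ * S) := by
      rw [pluecker_mul_left _ hP, hu, ← mul_assoc, pluecker_mul_unip, pluecker_mul_levi,
        pluecker_lowerUnip]
      ext i
      fin_cases i <;> simp [h₁₂]
      · linear_combination (v - u) * h₁₂
      · linear_combination -((u * e₁ + v * (1 - e₁)) * e₁) * hα - (u - v) * h₁
      · linear_combination v * e₂ * huv + (u - v) * v ^ 2 * h₁₂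
      · linear_combination v * e₁ * huv - (1 - v ^ 2) * ((u - v) * h₁ + (u * e₁ + v * (1 - e₁)) * e₁ * hα)
    obtain ⟨k1, k2⟩ := mem_parabolic_of_pluecker hPS
    rw [← mul_assoc, ← k2, ← pluecker_mul_left _ k1]
    congr 1
    group
  obtain ⟨k1, k2⟩ := mem_parabolic_of_pluecker e
  refine ⟨_, S * Q, k1, mul_mem hS hQ, k2, ?_⟩
  group

end LocalFactor

section NormalForms

variable {R : Type*} [CommRing R]

/-- A normal form for lower halves of rank one: over a field these have `pluecker g 0 = 0` and one of
`pluecker g 1`, `pluecker g 3` nonzero, which gives the value of the character as well. -/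
theorem exists_rank_one_fst {g : Sp2 R} (h0 : pluecker g 0 = 0) (h1 : IsUnit (pluecker g 1)) :
    ∃ Q ∈ siegelParabolic R, pluecker g = pluecker (lowerUnip 1 0 * Q) ∧
      detD Q = pluecker g 1 := by
  obtain ⟨⟨u, v, huv, hvu⟩, hu'⟩ := h1
  have hu : pluecker g 1 = u := hu'.symm
  have hiso := pluecker_isotropic g
  rw [h0, zero_mul, hu] at hiso
  refine ⟨levi 1 (v * pluecker g 2) 0 v u (by linear_combination hvu) *
    unip (v * pluecker g 4 - 1) 0 0, mul_mem (levi_mem ..) (unip_mem ..), ?_, ?_⟩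
  · rw [← mul_assoc, pluecker_mul_unip, pluecker_mul_levi, pluecker_lowerUnip]
    ext i
    fin_cases i <;> simp [h0, hu]
    · linear_combination -pluecker g 2 * huv
    · linear_combination -pluecker g 3 * (u * v + 1) * huv - u * v ^ 2 * hiso
    · linear_combination -pluecker g 4 * huv
  · rw [detD_mul _ (levi_mem ..), detD_levi, detD_unip, mul_one, hu]

theorem exists_rank_one_snd {g : Sp2 R} (h0 : pluecker g 0 = 0) (h1 : IsUnit (pluecker g 3)) :
    ∃ Q ∈ siegelParabolic R, pluecker g = pluecker (lowerUnip 1 0 * Q) ∧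
      detD Q = pluecker g 3 := by
  obtain ⟨⟨u, v, huv, hvu⟩, hu'⟩ := h1
  have hu : pluecker g 3 = u := hu'.symm
  have hiso := pluecker_isotropic g
  rw [h0, zero_mul, hu] at hiso
  refine ⟨levi (v * pluecker g 2) 1 (-v) 0 u (by linear_combination hvu) *
    unip 0 0 (v * pluecker g 4 - 1), mul_mem (levi_mem ..) (unip_mem ..), ?_, ?_⟩
  · rw [← mul_assoc, pluecker_mul_unip, pluecker_mul_levi, pluecker_lowerUnip]
    ext i
    fin_cases i <;> simp [h0, hu]
    · linear_combination -pluecker g 1 * (u * v + 1) * huv - u * v ^ 2 * hiso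
    · linear_combination -pluecker g 2 * huv
    · linear_combination -pluecker g 4 * huv
  · rw [detD_mul _ (levi_mem ..), detD_levi, detD_unip, mul_one, hu]

/-- A normal form for lower halves in which `C` is invertible. -/
theorem exists_rank_two {g : Sp2 R} {v : R} (h : pluecker g 0 * v = 1) :
    ∃ Q ∈ siegelParabolic R, pluecker g = pluecker (lowerUnip 1 1 * Q) ∧ detD Q = v := by
  obtain ⟨u, hu⟩ : ∃ u, pluecker g 0 = u := ⟨_, rfl⟩
  rw [hu] at h
  have hiso := pluecker_isotropic g
  rw [hu] at hiso
  refine ⟨levi u 0 0 1 v (by linear_combination h) *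
    unip (v * (pluecker g 3 - v)) (-(v * pluecker g 2)) (v * (pluecker g 1 - u)),
    mul_mem (levi_mem ..) (unip_mem ..), ?_, ?_⟩
  · rw [← mul_assoc, pluecker_mul_unip, pluecker_mul_levi, pluecker_lowerUnip]
    ext i
    fin_cases i <;> simp [hu]
    · linear_combination -pluecker g 1 * h
    · linear_combination -pluecker g 2 * h
    · linear_combination -(pluecker g 3 - v) * h
    · linear_combination (v + v ^ 2 * pluecker g 1 - pluecker g 4 * (1 + u * v)) * h
        + v ^ 2 * u * hiso
  · rw [detD_mul _ (levi_mem ..), detD_levi, detD_unip, mul_one]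

end NormalForms

/-! ### Values over a field, and lifting -/

section FieldValues

variable {K : Type*} [Field K] {ψ : MulChar K ℂ}

theorem localDatum_one_zero {R : Type*} [CommRing R] {ψ : MulChar R ℂ} (hψ : ψ ^ 2 = 1) :
    LocalDatum ψ 1 0 := ⟨hψ, by simp, by simp, by simp⟩

theorem localDatum_one_one {R : Type*} [CommRing R] {ψ : MulChar R ℂ} (hψ : ψ ^ 2 = 1) :
    LocalDatum ψ 1 1 := ⟨hψ, by simp, by simp, by simp⟩

theorem localFactor_of_pluecker {R : Type*} [CommRing R] {ψ : MulChar R ℂ} {e₁ e₂ : R}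
    (H : LocalDatum ψ e₁ e₂) {g Q : Sp2 R} (hQ : Q ∈ siegelParabolic R)
    (h : pluecker g = pluecker (lowerUnip e₁ e₂ * Q)) :
    localFactor ψ e₁ e₂ g = ψ (detD Q) := by
  have h' : pluecker g = (1 : R) • pluecker (lowerUnip e₁ e₂ * Q) := by rw [h, one_smul]
  have := H.apply (one_mem _) hQ
  rw [H.apply_of_pluecker h', map_one, one_mul, ← one_mul (lowerUnip e₁ e₂), this, detD_one,
    map_one, one_mul]

/-- The local factor for `M = diag(1, 0)` over a field lives on matrices with `C` of rank one. There
`(pluecker g 1, pluecker g 2, pluecker g 3)` is a degenerate nonzero quadratic form, and the local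
factor is the class of its values under the quadratic character. -/
theorem localFactor_rank_one (hψ : ψ ^ 2 = 1) (g : Sp2 K) :
    localFactor ψ 1 0 g = open Classical in if pluecker g 0 = 0 then
      (if pluecker g 1 = 0 then ψ (pluecker g 3) else ψ (pluecker g 1)) else 0 := by
  have H := localDatum_one_zero hψ
  have hzero : (pluecker g 0 ≠ 0 ∨ (pluecker g 1 = 0 ∧ pluecker g 3 = 0)) →
      localFactor ψ 1 0 g = 0 := by
    intro h
    apply localFactor_eq_zero
    rintro ⟨P, Q, hP, hQ, e⟩
    have hPu := (isUnit_detD hP).ne_zero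
    obtain ⟨y₁, y₂, y₃, a, b, c, d, u, hu, rfl, -⟩ := exists_unip_mul_levi hQ
    rw [e, mul_assoc, pluecker_mul_left _ hP, ← mul_assoc, pluecker_mul_levi, pluecker_mul_unip,
      pluecker_lowerUnip] at h
    simp [hPu] at h
    have hu0 : u ≠ 0 := by rintro rfl; simp at hu
    simp [hu0] at h
    simp [h] at hu
  split_ifs with h0 h1
  · by_cases h3 : pluecker g 3 = 0
    · rw [hzero (Or.inr ⟨h1, h3⟩), h3, MulChar.map_zero]
    · obtain ⟨Q, hQ, e, hd⟩ := exists_rank_one_snd h0 (isUnit_iff_ne_zero.2 h3)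
      rw [localFactor_of_pluecker H hQ e, hd]
  · obtain ⟨Q, hQ, e, hd⟩ := exists_rank_one_fst h0 (isUnit_iff_ne_zero.2 h1)
    rw [localFactor_of_pluecker H hQ e, hd]
  · exact hzero (Or.inl h0)

/-- Over a field, the double coset of `(1 0; 1 1)` consists of the elements with `det C ≠ 0`. -/
theorem localFactor_rank_two (hψ : ψ ^ 2 = 1) (g : Sp2 K) :
    localFactor ψ 1 1 g = ψ (pluecker g 0) := by
  by_cases h0 : pluecker g 0 = 0
  · rw [h0, MulChar.map_zero]
    apply localFactor_eq_zero
    rintro ⟨P, Q, hP, hQ, e⟩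
    have hA : detA Q ≠ 0 := left_ne_zero_of_mul_eq_one (detA_mul_detD hQ)
    rw [e, pluecker_zero_mul_right _ hQ, pluecker_mul_left _ hP, pluecker_lowerUnip] at h0
    simp [hA, (isUnit_detD hP).ne_zero] at h0
  · have hv : pluecker g 0 * (pluecker g 0)⁻¹ = 1 := mul_inv_cancel₀ h0
    obtain ⟨Q, hQ, e, hd⟩ := exists_rank_two hv
    rw [localFactor_of_pluecker (localDatum_one_one hψ) hQ e, hd, realChar_of_mul_eq_one hψ hv]

end FieldValues

section Lifting

/-- If `c`, `d` and `L` have no common factor, the class of `c` modulo `L` contains an integer prime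
to `d`. Indeed `c` is a unit modulo `gcd(d, L)`, and this unit lifts to one modulo `d`. -/
theorem exists_isCoprime_add_mul {c d L : ℤ} (hd : d ≠ 0)
    (h : ∃ x y z : ℤ, x * c + y * d + z * L = 1) : ∃ n : ℤ, IsCoprime (c + L * n) d := by
  have hm : NeZero d.natAbs := ⟨Int.natAbs_ne_zero.2 hd⟩
  have hn : Int.gcd d L ∣ d.natAbs := Int.gcd_dvd_natAbs_left _ _
  have hc : IsUnit (c : ZMod (Int.gcd d L)) := by
    obtain ⟨x, y, z, e⟩ := h
    refine IsUnit.of_mul_eq_one (x : ZMod (Int.gcd d L)) ?_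
    have h1 : ((x * c + y * d + z * L : ℤ) : ZMod (Int.gcd d L)) = 1 := by rw [e]; simp
    have h2 : ((d : ℤ) : ZMod (Int.gcd d L)) = 0 :=
      (ZMod.intCast_zmod_eq_zero_iff_dvd _ _).2 (Int.gcd_dvd_left _ _)
    have h3 : ((L : ℤ) : ZMod (Int.gcd d L)) = 0 :=
      (ZMod.intCast_zmod_eq_zero_iff_dvd _ _).2 (Int.gcd_dvd_right _ _)
    push_cast at h1
    rw [h2, h3] at h1
    linear_combination h1
  obtain ⟨v, hv⟩ := ZMod.unitsMap_surjective hn hc.unit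
  obtain ⟨V, hV⟩ := ZMod.intCast_surjective (v : ZMod d.natAbs)
  have hVd : IsCoprime V d := by
    have : IsUnit (V : ZMod d.natAbs) := hV ▸ v.isUnit
    rw [ZMod.coe_int_isUnit_iff_isCoprime] at this
    rw [Int.isCoprime_iff_gcd_eq_one, Int.gcd_comm] at this ⊢
    simpa [Int.gcd, Int.natAbs_abs, Nat.gcd_comm] using this
  have hVc : (Int.gcd d L : ℤ) ∣ V - c := by
    rw [← ZMod.intCast_eq_intCast_iff_dvd_sub]
    have := congrArg Units.val hv
    rw [ZMod.unitsMap_val, ← hV] at this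
    rw [ZMod.cast_intCast hn] at this
    exact this.symm
  obtain ⟨k, hk⟩ := hVc
  have hg := Int.gcd_eq_gcd_ab d L
  refine ⟨Int.gcdB d L * k, ?_⟩
  have e : c + L * (Int.gcdB d L * k) = V + d * (-(Int.gcdA d L * k)) := by
    rw [hg] at hk
    linear_combination -hk
  rw [e]
  exact IsCoprime.add_mul_left_left hVd _

/-- Surjectivity of `SL₂(ℤ) → SL₂(ℤ/L)`. -/
theorem exists_lift_SL2 {L : ℕ} [NeZero L] {a b c d : ZMod L} (h : a * d - b * c = 1) :
    ∃ a' b' c' d' : ℤ, (a' : ZMod L) = a ∧ (b' : ZMod L) = b ∧ (c' : ZMod L) = c ∧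
      (d' : ZMod L) = d ∧ a' * d' - b' * c' = 1 := by
  obtain ⟨a, rfl⟩ := ZMod.intCast_surjective a
  obtain ⟨b, rfl⟩ := ZMod.intCast_surjective b
  obtain ⟨c, rfl⟩ := ZMod.intCast_surjective c
  obtain ⟨d, hd0, rfl⟩ : ∃ d' : ℤ, d' ≠ 0 ∧ (d' : ZMod L) = d := by
    obtain ⟨d, rfl⟩ := ZMod.intCast_surjective d
    by_cases h0 : d = 0
    · exact ⟨L, by exact_mod_cast NeZero.ne L, by simp [h0]⟩
    · exact ⟨d, h0, rfl⟩
  obtain ⟨t, ht⟩ : (L : ℤ) ∣ a * d - b * c - 1 := by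
    rw [← ZMod.intCast_zmod_eq_zero_iff_dvd]
    push_cast
    rw [h, sub_self]
  obtain ⟨n, x, y, hxy⟩ := exists_isCoprime_add_mul (c := c) (L := L) hd0
    ⟨-b, a, -t, by linear_combination ht⟩
  refine ⟨a + L * ((b * n - t) * y), b - L * ((b * n - t) * x), c + L * n, d, by simp, by simp,
    by simp, rfl, ?_⟩
  linear_combination ht + L * (b * n - t) * hxy

/-- Parabolic elements with `det D = 1` lift to `Sp₂(ℤ)`, since both factors of the Levi
decomposition do. -/
theorem exists_lift_parabolic {L : ℕ} [NeZero L] {P : Sp2 (ZMod L)}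
    (hP : P ∈ siegelParabolic (ZMod L)) (h1 : detD P = 1) :
    ∃ P' ∈ siegelParabolic ℤ, mapSp (Int.castRingHom (ZMod L)) P' = P ∧ detD P' = 1 := by
  obtain ⟨y₁, y₂, y₃, a, b, c, d, u, hu, rfl, hd⟩ := exists_unip_mul_levi hP
  obtain rfl : u = 1 := hd.trans h1
  clear hd h1 hP
  obtain ⟨y₁, rfl⟩ := ZMod.intCast_surjective y₁
  obtain ⟨y₂, rfl⟩ := ZMod.intCast_surjective y₂
  obtain ⟨y₃, rfl⟩ := ZMod.intCast_surjective y₃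
  obtain ⟨a, b, c, d, rfl, rfl, rfl, rfl, h⟩ := exists_lift_SL2 (by rwa [mul_one] at hu)
  refine ⟨unip y₁ y₂ y₃ * levi a b c d 1 (by rw [mul_one, h]),
    mul_mem (unip_mem ..) (levi_mem ..), ?_, ?_⟩
  · rw [map_mul, mapSp_unip, mapSp_levi]
    simp
  · rw [detD_mul _ (unip_mem ..), detD_unip, detD_levi, one_mul]

/-- The element of `Sp₂(R × S)` with given components. -/
def prodSp {R S : Type*} [CommRing R] [CommRing S] (g : Sp2 R) (h : Sp2 S) : Sp2 (R × S) :=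
  ⟨Matrix.of fun i j => ((g : Mat4 R) i j, (h : Mat4 S) i j), by
    rw [SymplecticGroup.mem_iff]
    have hg := SymplecticGroup.mem_iff.1 g.2
    have hh := SymplecticGroup.mem_iff.1 h.2
    ext i j
    · refine Eq.trans ?_ (congrFun (congrFun (hg.trans
        (Matrix.map_J (Fin 2) (RingHom.fst R S)).symm) i) j)
      simp [Matrix.mul_apply, Matrix.J, Matrix.one_apply]
    · refine Eq.trans ?_ (congrFun (congrFun (hh.trans
        (Matrix.map_J (Fin 2) (RingHom.snd R S)).symm) i) j)
      simp [Matrix.mul_apply, Matrix.J, Matrix.one_apply]⟩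

theorem sp_prod_ext {R S : Type*} [CommRing R] [CommRing S] {g h : Sp2 (R × S)}
    (h₁ : mapSp (RingHom.fst R S) g = mapSp (RingHom.fst R S) h)
    (h₂ : mapSp (RingHom.snd R S) g = mapSp (RingHom.snd R S) h) : g = h := by
  apply Subtype.ext
  ext i j
  · exact congrFun (congrFun (congrArg Subtype.val h₁) i) j
  · exact congrFun (congrFun (congrArg Subtype.val h₂) i) j

theorem mapSp_comp {R S T : Type*} [CommRing R] [CommRing S] [CommRing T] (f : S →+* T)
    (f' : R →+* S) (g : Sp2 R) : mapSp f (mapSp f' g) = mapSp (f.comp f') g := rfl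

/-- If `g` lies in the double coset of `γ_M` modulo two coprime integers, then it does so modulo
their product. -/
theorem exists_double_coset_mul {m n : ℕ} (h : m.Coprime n) {e₁ e₂ : ℤ} {g : Sp2 ℤ}
    (hm : ∃ P Q : Sp2 (ZMod m), P ∈ siegelParabolic _ ∧ Q ∈ siegelParabolic _ ∧
      mapSp (Int.castRingHom (ZMod m)) g = P * lowerUnip (e₁ : ZMod m) (e₂ : ZMod m) * Q)
    (hn : ∃ P Q : Sp2 (ZMod n), P ∈ siegelParabolic _ ∧ Q ∈ siegelParabolic _ ∧
      mapSp (Int.castRingHom (ZMod n)) g = P * lowerUnip (e₁ : ZMod n) (e₂ : ZMod n) * Q) :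
    ∃ P Q : Sp2 (ZMod (m * n)), P ∈ siegelParabolic _ ∧ Q ∈ siegelParabolic _ ∧
      mapSp (Int.castRingHom (ZMod (m * n))) g
        = P * lowerUnip (e₁ : ZMod (m * n)) (e₂ : ZMod (m * n)) * Q := by
  obtain ⟨P, Q, hP, hQ, e⟩ := hm
  obtain ⟨P', Q', hP', hQ', e'⟩ := hn
  let f := (ZMod.chineseRemainder h).symm.toRingHom
  let f' := (ZMod.chineseRemainder h).toRingHom
  have hprod : ∀ {A : Sp2 (ZMod m)} {B : Sp2 (ZMod n)}, A ∈ siegelParabolic _ →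
      B ∈ siegelParabolic _ → mapSp f (prodSp A B) ∈ siegelParabolic _ := fun hA hB =>
    mapSp_mem_parabolic f (mem_parabolic.2 fun i j =>
      Prod.ext (mem_parabolic.1 hA i j) (mem_parabolic.1 hB i j))
  refine ⟨mapSp f (prodSp P P'), mapSp f (prodSp Q Q'), hprod hP hP', hprod hQ hQ', ?_⟩
  have hff : ∀ x : Sp2 (ZMod (m * n)), mapSp f (mapSp f' x) = x := fun x => by
    apply Subtype.ext
    ext i j
    exact (ZMod.chineseRemainder h).symm_apply_apply _
  rw [← hff (lowerUnip _ _), ← map_mul, ← map_mul, ← hff (mapSp _ g)]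
  congr 1
  have hfst : ∀ A B, mapSp (RingHom.fst (ZMod m) (ZMod n)) (prodSp A B) = A := fun _ _ => rfl
  have hsnd : ∀ A B, mapSp (RingHom.snd (ZMod m) (ZMod n)) (prodSp A B) = B := fun _ _ => rfl
  apply sp_prod_ext
  · rw [map_mul, map_mul, hfst, hfst, mapSp_lowerUnip, mapSp_lowerUnip, mapSp_comp, mapSp_comp,
      RingHom.ext_int (((RingHom.fst _ _).comp f').comp _) (Int.castRingHom (ZMod m)), e]
    simp
  · rw [map_mul, map_mul, hsnd, hsnd, mapSp_lowerUnip, mapSp_lowerUnip, mapSp_comp, mapSp_comp,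
      RingHom.ext_int (((RingHom.snd _ _).comp f').comp _) (Int.castRingHom (ZMod n)), e']
    simp

end Lifting

/-! ### Iwasawa decomposition and the Hecke subgroup -/

section Iwasawa

/-- The embedding of `SL₂` in the rows and columns one and three. -/
def embFst {R : Type*} [CommRing R] (a b c d : R) (h : a * d - b * c = 1) : Sp2 R :=
  ⟨Matrix.fromBlocks !![a, 0; 0, 1] !![b, 0; 0, 0] !![c, 0; 0, 0] !![d, 0; 0, 1], by
    rw [SymplecticGroup.fromBlocks_mem_iff]
    refine ⟨?_, ?_, ?_⟩ <;> ext i j <;> fin_cases i <;> fin_cases j <;>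
      simp [Matrix.mul_apply, mul_comm]
    linear_combination h⟩

/-- The embedding of `SL₂` in the rows and columns two and four. -/
def embSnd {R : Type*} [CommRing R] (a b c d : R) (h : a * d - b * c = 1) : Sp2 R :=
  ⟨Matrix.fromBlocks !![1, 0; 0, a] !![0, 0; 0, b] !![0, 0; 0, c] !![1, 0; 0, d], by
    rw [SymplecticGroup.fromBlocks_mem_iff]
    refine ⟨?_, ?_, ?_⟩ <;> ext i j <;> fin_cases i <;> fin_cases j <;>
      simp [Matrix.mul_apply, mul_comm]
    linear_combination h⟩

theorem entA_embFst {R : Type*} [CommRing R] (a b c d : R) (h : a * d - b * c = 1) (i j : Fin 2) :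
    entA (embFst a b c d h) i j = !![a, 0; 0, 1] i j := rfl

theorem entC_embFst {R : Type*} [CommRing R] (a b c d : R) (h : a * d - b * c = 1) (i j : Fin 2) :
    entC (embFst a b c d h) i j = !![c, 0; 0, 0] i j := rfl

/-- Any rational row vector `(x y)` is moved by an element of `SL₂(ℤ)` to one with first entry zero. -/
theorem exists_SL2_annihilating (x y : ℚ) :
    ∃ a b c d : ℤ, a * d - b * c = 1 ∧ x * a + y * c = 0 := by
  -- clear the denominators
  obtain ⟨m, n, s, hs, hx, hy⟩ : ∃ m n : ℤ, ∃ s : ℚ, s ≠ 0 ∧ x = s * m ∧ y = s * n := by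
    refine ⟨x.num * y.den, y.num * x.den, ((x.den : ℚ) * y.den)⁻¹, ?_, ?_, ?_⟩
    · simp
    · conv_lhs => rw [← Rat.num_div_den x]
      push_cast; field_simp
    · conv_lhs => rw [← Rat.num_div_den y]
      push_cast; field_simp
  rcases eq_or_ne (Int.gcd m n) 0 with h0 | h0
  · rw [Int.gcd_eq_zero_iff] at h0
    exact ⟨1, 0, 0, 1, by simp, by simp [hx, hy, h0]⟩
  · obtain ⟨m', hm⟩ := Int.gcd_dvd_left m n
    obtain ⟨n', hn⟩ := Int.gcd_dvd_right m n
    have hb := Int.gcd_eq_gcd_ab m n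
    have hg : (Int.gcd m n : ℤ) ≠ 0 := by exact_mod_cast h0
    generalize ((Int.gcd m n : ℕ) : ℤ) = g at hm hn hb hg
    refine ⟨n', Int.gcdA m n, -m', Int.gcdB m n, ?_, ?_⟩
    · apply mul_left_cancel₀ hg
      linear_combination -hb + (-Int.gcdA m n) * hm - Int.gcdB m n * hn
    · rw [hx, hy, hm, hn]
      push_cast; ring

/-- The Iwasawa decomposition `Sp₂(ℚ) = P(ℚ) Sp₂(ℤ)`. The entries of the second row of `C` and
`D_{10}`, and then the first row of `C`, are cleared one after the other by elements of embedded
copies of `SL₂(ℤ)`. -/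
theorem exists_iwasawa (g : Sp2 ℚ) :
    ∃ p ∈ siegelParabolic ℚ, ∃ g₀ : Sp2 ℤ, g = p * toQ g₀ ∧ 0 < detD p := by
  have hC₁₀ : ∃ γ : Sp2 ℤ, entC (g * toQ γ) 1 0 = 0 := by
    obtain ⟨a, b, c, d, h, e⟩ := exists_SL2_annihilating (entC g 1 0) (entD g 1 0)
    refine ⟨embFst a b c d h, ?_⟩
    rw [entC_mul]
    simpa [entA, entC, embFst, toQ, mapSp] using e
  have hC₁ : ∃ γ : Sp2 ℤ, entC (g * toQ γ) 1 0 = 0 ∧ entC (g * toQ γ) 1 1 = 0 := by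
    obtain ⟨γ, h0⟩ := hC₁₀
    obtain ⟨a, b, c, d, h, e⟩ :=
      exists_SL2_annihilating (entC (g * toQ γ) 1 1) (entD (g * toQ γ) 1 1)
    refine ⟨γ * embSnd a b c d h, ?_⟩
    rw [map_mul, ← mul_assoc, entC_mul (g * toQ γ), entC_mul (g * toQ γ), h0]
    simpa [entA, entC, embSnd, toQ, mapSp] using e
  have hD₁₀ : ∃ γ : Sp2 ℤ, entC (g * toQ γ) 1 0 = 0 ∧ entC (g * toQ γ) 1 1 = 0 ∧
      entD (g * toQ γ) 1 0 = 0 := by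
    obtain ⟨γ, h0, h1⟩ := hC₁
    obtain ⟨a, b, c, d, h, e⟩ :=
      exists_SL2_annihilating (entD (g * toQ γ) 1 0) (entD (g * toQ γ) 1 1)
    refine ⟨γ * levi d (-c) (-b) a 1 (by linear_combination h), ?_⟩
    rw [map_mul, ← mul_assoc, entC_mul (g * toQ γ), entC_mul (g * toQ γ),
      entD_mul (g * toQ γ), h0, h1]
    simpa [entA, entB, entC, entD, levi, toQ, mapSp] using e
  have hC : ∃ γ : Sp2 ℤ, ∀ i j, entC (g * toQ γ) i j = 0 := by
    obtain ⟨γ, h0, h1, h2⟩ := hD₁₀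
    -- the lower row is now `(0 0 0 d)`, so that the symplectic relations give `C_{01} = 0`
    have hs := symm_CD (g * toQ γ)
    have hd := dual_AD (g * toQ γ) 1 1
    rw [h0, h1, h2] at hs hd
    simp at hs hd
    have h3 : entC (g * toQ γ) 0 1 = 0 := by
      rcases hs with hs | hs
      · exact hs
      · rw [hs] at hd; simp at hd
    obtain ⟨a, b, c, d, h, e⟩ :=
      exists_SL2_annihilating (entC (g * toQ γ) 0 0) (entD (g * toQ γ) 0 0)
    refine ⟨γ * embFst a b c d h, ?_⟩
    rw [map_mul, ← mul_assoc]
    intro i j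
    rw [entC_mul (g * toQ γ)]
    simp only [entA_map, entC_map, entA_embFst, entC_embFst]
    fin_cases i <;> fin_cases j <;> simp [h0, h1, h2, h3]
    exact e
  obtain ⟨γ, hγ⟩ := hC
  have hp : g * toQ γ ∈ siegelParabolic ℚ := mem_parabolic.2 hγ
  rcases lt_or_gt_of_ne (isUnit_detD hp).ne_zero with hneg | hpos
  · -- correct the sign by `diag(1, -1, 1, -1)`
    have hℓ : ((1 : ℤ) * (-1) - 0 * 0) * (-1) = 1 := by norm_num
    refine ⟨g * toQ γ * toQ (levi 1 0 0 (-1) (-1) hℓ), mul_mem hp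
      (mapSp_mem_parabolic _ (levi_mem ..)), (levi 1 0 0 (-1) (-1) hℓ)⁻¹ * γ⁻¹, ?_, ?_⟩
    · rw [map_mul, map_inv, map_inv]; group
    · rw [detD_mul _ hp, detD_map, detD_levi]
      simpa using hneg
  · exact ⟨g * toQ γ, hp, γ⁻¹, by rw [map_inv]; group, hpos⟩

end Iwasawa

section HeckeCosetRepresentatives

variable {q : ℕ} [hq : Fact q.Prime] {L : ℕ}

theorem exists_toQ_eq {g : Sp2 ℚ} (h : ∀ i j, ∃ z : ℤ, (z : ℚ) = (g : Mat4 ℚ) i j) :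
    ∃ g₀ : Sp2 ℤ, toQ g₀ = g := by
  choose K hK using h
  have hK' : (Matrix.of K).map (Int.castRingHom ℚ) = (g : Mat4 ℚ) := by
    ext i j; exact hK i j
  refine ⟨⟨Matrix.of K, ?_⟩, Subtype.ext hK'⟩
  rw [SymplecticGroup.mem_iff]
  have hinj : Function.Injective fun M : Mat4 ℤ => M.map (Int.castRingHom ℚ) :=
    Matrix.map_injective Int.cast_injective
  apply hinj
  have := SymplecticGroup.mem_iff.1 g.2
  rw [← hK'] at this
  simp only [Matrix.map_mul, Matrix.transpose_map, Matrix.map_J]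
  simpa only [Matrix.transpose_map] using this

/-- The diagonal entries of `δ₁`. -/
def deltaDiag (q : ℕ) : Fin 2 ⊕ Fin 2 → ℚ := Sum.elim ![(q : ℚ), 1] ![(q : ℚ)⁻¹, 1]

theorem coe_delta1 : (delta1 q : Mat4 ℚ) = Matrix.diagonal (deltaDiag q) := by
  simp [delta1, deltaDiag, Matrix.fromBlocks_diagonal]

theorem mem_heckeSubgroup_iff {γ : Gamma0 L} :
    γ ∈ heckeSubgroup q L ↔ ∃ x ∈ Gamma0 L, toQ (γ : Sp2 ℤ) * delta1 q = delta1 q * toQ x := by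
  constructor
  · rintro ⟨_, ⟨x, hx, rfl⟩, e⟩
    refine ⟨x, hx, ?_⟩
    have e' : delta1 q * toQ x * (delta1 q)⁻¹ = toQ (γ : Sp2 ℤ) := e
    rw [← e']; group
  · rintro ⟨x, hx, e⟩
    refine ⟨toQ x, ⟨x, hx, rfl⟩, ?_⟩
    show delta1 q * toQ x * (delta1 q)⁻¹ = toQ (γ : Sp2 ℤ)
    rw [← e]; group

theorem mul_delta1_apply {γ x : Sp2 ℤ} (e : toQ γ * delta1 q = delta1 q * toQ x)
    (i j : Fin 2 ⊕ Fin 2) :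
    (((γ : Mat4 ℤ) i j : ℤ) : ℚ) * deltaDiag q j = deltaDiag q i * (((x : Mat4 ℤ) i j : ℤ) : ℚ) := by
  have := congrFun (congrFun (congrArg Subtype.val e) i) j
  change ((toQ γ : Mat4 ℚ) * (delta1 q : Mat4 ℚ)) i j
    = ((delta1 q : Mat4 ℚ) * (toQ x : Mat4 ℚ)) i j at this
  rwa [coe_delta1, Matrix.mul_diagonal, Matrix.diagonal_mul] at this

/-- The group `δ₁ Γ₀(L) δ₁⁻¹ ∩ Γ₀(L)` in terms of congruences. Conjugation by `δ₁` requires further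
ones, on `B_{10}` and `D_{10}`; because `C ≡ 0` modulo `q`, these follow from the symplectic
relations. -/
theorem mem_heckeSubgroup (hqL : q ∣ L) {g : Sp2 ℤ} (hg : g ∈ Gamma0 L) :
    (⟨g, hg⟩ : Gamma0 L) ∈ heckeSubgroup q L ↔ (q : ℤ) ∣ entA g 0 1 ∧ (q : ℤ) ∣ entB g 0 1 ∧
      (q : ℤ) ^ 2 ∣ entB g 0 0 := by
  have hq0 : (q : ℚ) ≠ 0 := by exact_mod_cast hq.out.ne_zero
  rw [mem_heckeSubgroup_iff]
  constructor
  · rintro ⟨x, -, e⟩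
    have h1 := mul_delta1_apply e (Sum.inl 0) (Sum.inl 1)
    have h2 := mul_delta1_apply e (Sum.inl 0) (Sum.inr 1)
    have h3 := mul_delta1_apply e (Sum.inl 0) (Sum.inr 0)
    simp [deltaDiag] at h1 h2 h3
    refine ⟨⟨_, by exact_mod_cast h1⟩, ⟨_, by exact_mod_cast h2⟩, ⟨entB x 0 0, ?_⟩⟩
    field_simp at h3
    exact_mod_cast h3
  · rintro ⟨h1, h2, h3⟩
    have hC : ∀ i j, (q : ℤ) ∣ entC g i j := fun i j =>
      (Int.natCast_dvd_natCast.2 hqL).trans (mem_Gamma0.1 hg i j)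
    have e1 := dual_AD' g 1 0
    have e2 := dual_AD' g 1 1
    have e3 := dual_AD g 0 0
    have e4 := symm_AB g
    have h3' : (q : ℤ) ∣ entB g 0 0 := (dvd_pow_self _ two_ne_zero).trans h3
    simp at e1 e2 e3
    have h4 : (q : ℤ) ∣ entD g 1 0 := by
      have : entD g 1 0 = entA g 0 1 * (entD g 1 0 * entD g 0 1 - entD g 1 1 * entD g 0 0)
          + entC g 0 1 * (entD g 1 1 * entB g 0 0 - entD g 1 0 * entB g 0 1)
          + entC g 1 1 * (entD g 1 1 * entB g 1 0 - entD g 1 0 * entB g 1 1) := by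
        linear_combination -entD g 1 0 * e2 + entD g 1 1 * e1
      rw [this]
      exact dvd_add (dvd_add (h1.mul_right _) ((hC 0 1).mul_right _)) ((hC 1 1).mul_right _)
    have h5 : (q : ℤ) ∣ entB g 1 0 := by
      have : entB g 1 0 = entB g 0 0 * (entD g 0 0 * entA g 1 0 - entC g 0 0 * entB g 1 0)
          + entB g 0 1 * (entD g 0 0 * entA g 1 1 - entC g 0 1 * entB g 1 0)
          + entA g 0 1 * (entD g 0 1 * entB g 1 0 - entD g 0 0 * entB g 1 1) := by
        linear_combination -entB g 1 0 * e3 + entD g 0 0 * e4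
      rw [this]
      exact dvd_add (dvd_add (h3'.mul_right _) (h2.mul_right _)) (h1.mul_right _)
    obtain ⟨a, ha⟩ := h1
    obtain ⟨b, hb⟩ := h2
    obtain ⟨b', hb'⟩ := h3
    obtain ⟨c, hc⟩ := h5
    obtain ⟨d, hd⟩ := h4
    have key : ∀ i j, ∃ z : ℤ, (z : ℚ)
        = ((delta1 q)⁻¹ * toQ g * delta1 q : Sp2 ℚ).1 i j := by
      intro i j
      refine ⟨Matrix.fromBlocks !![entA g 0 0, a; q * entA g 1 0, entA g 1 1]
        !![b', b; c, entB g 1 1]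
        !![q ^ 2 * entC g 0 0, q * entC g 0 1; q * entC g 1 0, entC g 1 1]
        !![entD g 0 0, q * entD g 0 1; d, entD g 1 1] i j, ?_⟩
      have hX : deltaDiag q i * ((delta1 q)⁻¹ * toQ g * delta1 q : Sp2 ℚ).1 i j
          = (((g : Mat4 ℤ) i j : ℤ) : ℚ) * deltaDiag q j := by
        have h6 : delta1 q * ((delta1 q)⁻¹ * toQ g * delta1 q) = toQ g * delta1 q := by group
        have h7 := congrFun (congrFun (congrArg Subtype.val h6) i) j
        change ((delta1 q : Mat4 ℚ) * ((delta1 q)⁻¹ * toQ g * delta1 q : Sp2 ℚ).1) i j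
          = ((toQ g : Mat4 ℚ) * (delta1 q : Mat4 ℚ)) i j at h7
        rwa [coe_delta1, Matrix.mul_diagonal, Matrix.diagonal_mul] at h7
      have hw : deltaDiag q i ≠ 0 := by
        rcases i with i | i <;> fin_cases i <;> simp [deltaDiag, hq0]
      apply mul_left_cancel₀ hw
      rw [hX]
      simp only [entA, entB, entD] at ha hb hb' hc hd
      rcases i with i | i <;> rcases j with j | j <;> fin_cases i <;> fin_cases j <;>
        simp [deltaDiag, ha, hb, hb', hc, hd, entA, entB, entC, entD] <;> field_simp
    obtain ⟨x, hx⟩ := exists_toQ_eq key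
    have hx' : toQ g * delta1 q = delta1 q * toQ x := by rw [hx]; group
    refine ⟨x, ?_, hx'⟩
    rw [mem_Gamma0]
    intro i j
    have h6 := mul_delta1_apply hx' (Sum.inr i) (Sum.inl j)
    have h7 := mem_Gamma0.1 hg i j
    have h8 : ∃ n : ℤ, (x : Mat4 ℤ) (Sum.inr i) (Sum.inl j)
        = (g : Mat4 ℤ) (Sum.inr i) (Sum.inl j) * n := by
      fin_cases i <;> fin_cases j <;> simp [deltaDiag] at h6 ⊢
      · refine ⟨q ^ 2, ?_⟩
        field_simp at h6
        exact_mod_cast h6.symm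
      · refine ⟨q, ?_⟩
        field_simp at h6
        exact_mod_cast h6.symm
      · exact ⟨q, by exact_mod_cast h6.symm⟩
      · exact ⟨1, by rw [mul_one, h6]⟩
    obtain ⟨n, hn⟩ := h8
    rw [hn]
    exact h7.mul_right n

/-- Conjugation by `δ₁` does not change `det D`, so that the character is constant along the cosets
in the Hecke operator. -/
theorem detD_of_mul_delta1 {γ x : Sp2 ℤ} (e : toQ γ * delta1 q = delta1 q * toQ x) :
    detD x = detD γ := by
  have hq0 : (q : ℚ) ≠ 0 := by exact_mod_cast hq.out.ne_zero
  have h00 := mul_delta1_apply e (Sum.inr 0) (Sum.inr 0)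
  have h01 := mul_delta1_apply e (Sum.inr 0) (Sum.inr 1)
  have h10 := mul_delta1_apply e (Sum.inr 1) (Sum.inr 0)
  have h11 := mul_delta1_apply e (Sum.inr 1) (Sum.inr 1)
  simp [deltaDiag] at h00 h01 h10 h11
  field_simp at h00 h01 h10
  have : ((detD x : ℤ) : ℚ) = (detD γ : ℤ) := by
    simp only [detD, entD]
    push_cast
    rw [← h00, ← h01, h10, h11]
    ring
  exact_mod_cast this

end HeckeCosetRepresentatives

/-! ### Representatives of the Hecke cosets -/

section HeckeCosetRepresentatives

variable {q : ℕ} {L : ℕ}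

/-- Representatives in `SL₂(ℤ)` of the projective line over `ℤ/q`: a residue class `t` gives
`(1 t; 0 1)`, and the point at infinity gives `(0 1; -1 0)`. -/
def projLevi : Option (ZMod q) → Sp2 ℤ
  | some t => levi 1 (t.val : ℤ) 0 1 1 (by ring)
  | none => levi 0 1 (-1) 0 1 (by ring)

/-- Representatives of the cosets of `δ₁ Γ₀(L) δ₁⁻¹ ∩ Γ₀(L)` in `Γ₀(L)`, for `q ∣ L`. -/
def heckeRep (x : Option (ZMod q) × ZMod (q ^ 2) × ZMod q) : Sp2 ℤ :=
  unip (x.2.1.val : ℤ) (x.2.2.val : ℤ) 0 * projLevi x.1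

theorem projLevi_mem (x : Option (ZMod q)) : projLevi x ∈ siegelParabolic ℤ := by
  cases x <;> exact mem_parabolic.2 fun _ _ => rfl

theorem heckeRep_mem_parabolic (x : Option (ZMod q) × ZMod (q ^ 2) × ZMod q) :
    heckeRep x ∈ siegelParabolic ℤ := mul_mem (unip_mem ..) (projLevi_mem _)

theorem parabolic_le_Gamma0 {g : Sp2 ℤ} (hg : g ∈ siegelParabolic ℤ) : g ∈ Gamma0 L :=
  mem_Gamma0.2 fun i j => by
    have : (g : Mat4 ℤ) (Sum.inr i) (Sum.inl j) = 0 := mem_parabolic.1 hg i j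
    rw [this]; exact dvd_zero _

theorem detD_heckeRep (x : Option (ZMod q) × ZMod (q ^ 2) × ZMod q) : detD (heckeRep x) = 1 := by
  rw [heckeRep, detD_mul _ (unip_mem ..), detD_unip, one_mul]
  cases x.1 <;> rw [projLevi, detD_levi]

variable [hq : Fact q.Prime]

/-- Distinct points of the projective line over `ℤ/q` have inequivalent representatives. -/
theorem projLevi_injective {x y : Option (ZMod q)}
    (h : (q : ℤ) ∣ entA (projLevi x * (projLevi y)⁻¹) 0 1) : x = y := by
  have h1 : ¬ (q : ℤ) ∣ 1 := by
    intro h; exact hq.out.one_lt.ne' (by exact_mod_cast Int.eq_one_of_dvd_one (by positivity) h)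
  rw [entA_mul] at h
  simp only [entA_inv, entC_inv] at h
  rcases x with _ | t <;> rcases y with _ | s
  · rfl
  · exfalso
    simp [projLevi, entA_levi, entB_levi, entC_levi, entD_levi, -ZMod.natCast_val] at h
    exact hq.out.ne_one (by simpa [Int.natCast_dvd] using h)
  · exfalso
    simp [projLevi, entA_levi, entB_levi, entC_levi, entD_levi, -ZMod.natCast_val] at h
    exact hq.out.ne_one (by simpa [Int.natCast_dvd] using h)
  · simp [projLevi, entA_levi, entB_levi, entC_levi, entD_levi, -ZMod.natCast_val] at h
    rw [← ZMod.natCast_zmod_val t, ← ZMod.natCast_zmod_val s]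
    have := (ZMod.intCast_eq_intCast_iff_dvd_sub (s.val : ℤ) (t.val : ℤ) q).2 (by
      convert h using 1; ring)
    exact_mod_cast congrArg some this.symm

theorem heckeRep_injective (hqL : q ∣ L) {x y : Option (ZMod q) × ZMod (q ^ 2) × ZMod q}
    (h : (⟨heckeRep x * (heckeRep y)⁻¹, parabolic_le_Gamma0 (mul_mem (heckeRep_mem_parabolic x)
      (inv_mem (heckeRep_mem_parabolic y)))⟩ : Gamma0 L) ∈ heckeSubgroup q L) : x = y := by
  rw [mem_heckeSubgroup hqL] at h
  obtain ⟨h1, h2, h3⟩ := h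
  obtain ⟨t, y₁, y₂⟩ := x
  obtain ⟨s, z₁, z₂⟩ := y
  have e : heckeRep (t, y₁, y₂) * (heckeRep (s, z₁, z₂))⁻¹
      = unip (y₁.val : ℤ) (y₂.val : ℤ) 0 * (projLevi t * (projLevi s)⁻¹)
        * unip (-(z₁.val : ℤ)) (-(z₂.val : ℤ)) 0 := by
    rw [heckeRep, heckeRep, _root_.mul_inv_rev, unip_inv, neg_zero]
    simp only [mul_assoc]
  have hL : projLevi t * (projLevi s)⁻¹ ∈ siegelParabolic ℤ :=
    mul_mem (projLevi_mem t) (inv_mem (projLevi_mem s))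
  rw [e] at h1 h2 h3
  have ht : t = s := by
    apply projLevi_injective
    have hC := mem_parabolic.1 hL
    rw [entA_mul, entA_mul (unip _ _ _), entA_mul (unip _ _ _)] at h1
    simpa [entA_unip, entB_unip, entC_unip, hC, -ZMod.natCast_val] using h1
  subst ht
  rw [mul_inv_cancel, mul_one] at h2 h3
  rw [entB_mul] at h2 h3
  simp [entA_unip, entB_unip, entD_unip, -ZMod.natCast_val] at h2 h3
  have : NeZero (q ^ 2) := ⟨pow_ne_zero 2 hq.out.ne_zero⟩
  have e1 : y₁ = z₁ := by
    rw [← ZMod.natCast_zmod_val y₁, ← ZMod.natCast_zmod_val z₁]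
    have := (ZMod.intCast_eq_intCast_iff_dvd_sub (z₁.val : ℤ) (y₁.val : ℤ) (q ^ 2)).2 (by
      push_cast; convert h3 using 1; ring)
    exact_mod_cast this.symm
  have e2 : y₂ = z₂ := by
    rw [← ZMod.natCast_zmod_val y₂, ← ZMod.natCast_zmod_val z₂]
    have := (ZMod.intCast_eq_intCast_iff_dvd_sub (z₂.val : ℤ) (y₂.val : ℤ) q).2 (by
      convert h2 using 1; ring)
    exact_mod_cast this.symm
  rw [e1, e2]

/-- Every coset has a representative: the point of the projective line is the first row of `A`
modulo `q`, after which `A₀₀` is a unit modulo `q` and the translation is found by division. -/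
theorem heckeRep_surjective (hqL : q ∣ L) {g : Sp2 ℤ} (hg : g ∈ Gamma0 L) :
    ∃ x : Option (ZMod q) × ZMod (q ^ 2) × ZMod q,
      (⟨g * (heckeRep x)⁻¹, mul_mem hg (inv_mem (parabolic_le_Gamma0
        (heckeRep_mem_parabolic x)))⟩ : Gamma0 L) ∈ heckeSubgroup q L := by
  have hC : ∀ i j, (q : ℤ) ∣ entC g i j := fun i j =>
    (Int.natCast_dvd_natCast.2 hqL).trans (mem_Gamma0.1 hg i j)
  obtain ⟨t, ht⟩ : ∃ t : Option (ZMod q), (q : ℤ) ∣ entA (g * (projLevi t)⁻¹) 0 1 := by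
    by_cases h0 : (q : ℤ) ∣ entA g 0 0
    · refine ⟨none, ?_⟩
      rw [entA_mul]
      simp [projLevi, entA_inv, entC_inv, entC_levi, entD_levi, -ZMod.natCast_val]
      exact h0
    · refine ⟨some (((entA g 0 1 : ℤ) : ZMod q) / ((entA g 0 0 : ℤ) : ZMod q)), ?_⟩
      rw [entA_mul]
      simp [projLevi, entA_inv, entC_inv, entC_levi, entD_levi, -ZMod.natCast_val]
      have h0' : ((entA g 0 0 : ℤ) : ZMod q) ≠ 0 := fun h =>
        h0 ((ZMod.intCast_zmod_eq_zero_iff_dvd _ _).1 h)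
      rw [← ZMod.intCast_zmod_eq_zero_iff_dvd]
      push_cast
      rw [ZMod.natCast_zmod_val]
      field_simp
      ring
  set g₁ := g * (projLevi t)⁻¹ with hg₁
  have hg₁L : g₁ ∈ Gamma0 L := mul_mem hg (inv_mem (parabolic_le_Gamma0 (projLevi_mem t)))
  have hC₁ : ∀ i j, (q : ℤ) ∣ entC g₁ i j := fun i j =>
    (Int.natCast_dvd_natCast.2 hqL).trans (mem_Gamma0.1 hg₁L i j)
  have hcop : IsCoprime (entA g₁ 0 0) (q : ℤ) := by
    have e := dual_AD g₁ 0 0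
    simp at e
    obtain ⟨a, ha⟩ := ht
    obtain ⟨c, hc⟩ := hC₁ 0 0
    obtain ⟨d, hd⟩ := hC₁ 0 1
    exact ⟨entD g₁ 0 0, a * entD g₁ 0 1 - entB g₁ 0 0 * c - entB g₁ 0 1 * d, by
      rw [ha, hc, hd] at e; linear_combination e⟩
  have hu : IsUnit ((entA g₁ 0 0 : ℤ) : ZMod q) := by
    rw [ZMod.coe_int_isUnit_iff_isCoprime]; exact hcop.symm
  have hu2 : IsUnit ((entA g₁ 0 0 : ℤ) : ZMod (q ^ 2)) := by
    rw [ZMod.coe_int_isUnit_iff_isCoprime]; push_cast; exact (hcop.pow_right (n := 2)).symm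
  have : NeZero (q ^ 2) := ⟨pow_ne_zero 2 hq.out.ne_zero⟩
  obtain ⟨y₂, hy₂⟩ : ∃ y : ZMod q, ((entA g₁ 0 0 : ℤ) : ZMod q) * y = (entB g₁ 0 1 : ℤ) := by
    obtain ⟨v, hv⟩ := hu.exists_right_inv
    exact ⟨v * (entB g₁ 0 1 : ℤ), by rw [← mul_assoc, hv, one_mul]⟩
  obtain ⟨y₁, hy₁⟩ : ∃ y : ZMod (q ^ 2), ((entA g₁ 0 0 : ℤ) : ZMod (q ^ 2)) * y
      = ((entB g₁ 0 0 - entA g₁ 0 1 * y₂.val : ℤ) : ZMod (q ^ 2)) := by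
    obtain ⟨v, hv⟩ := hu2.exists_right_inv
    exact ⟨v * ((entB g₁ 0 0 - entA g₁ 0 1 * y₂.val : ℤ) : ZMod (q ^ 2)),
      by rw [← mul_assoc, hv, one_mul]⟩
  refine ⟨(t, y₁, y₂), ?_⟩
  rw [mem_heckeSubgroup hqL]
  have e : g * (heckeRep (t, y₁, y₂))⁻¹ = g₁ * unip (-(y₁.val : ℤ)) (-(y₂.val : ℤ)) 0 := by
    rw [heckeRep, _root_.mul_inv_rev, unip_inv, neg_zero, hg₁, mul_assoc]
  simp only [e, entA_mul g₁, entB_mul g₁]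
  refine ⟨?_, ?_, ?_⟩
  · simpa [entA_unip, entC_unip, -ZMod.natCast_val] using ht
  · rw [← ZMod.intCast_zmod_eq_zero_iff_dvd]
    simp [entB_unip, entD_unip, -ZMod.natCast_val]
    rw [ZMod.natCast_zmod_val]
    linear_combination -hy₂
  · rw [show (q : ℤ) ^ 2 = ((q ^ 2 : ℕ) : ℤ) by push_cast; rfl,
      ← ZMod.intCast_zmod_eq_zero_iff_dvd]
    simp [entB_unip, entD_unip, -ZMod.natCast_val]
    push_cast at hy₁
    rw [ZMod.natCast_zmod_val y₁]
    linear_combination -hy₁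

/-- The matrices `heckeRep x` represent each coset of the Hecke operator exactly once. -/
theorem bijective_heckeRep (hqL : q ∣ L) : Function.Bijective
    (fun x : Option (ZMod q) × ZMod (q ^ 2) × ZMod q =>
      (Quotient.mk _ (⟨heckeRep x, parabolic_le_Gamma0 (heckeRep_mem_parabolic x)⟩ : Gamma0 L) :
        HeckeCosets q L)) := by
  constructor
  · intro x y h
    have h' := Quotient.exact h
    have h'' := (QuotientGroup.rightRel_apply (s := heckeSubgroup q L)).1 h'
    exact (heckeRep_injective hqL h'').symm
  · intro c
    induction c using Quotient.inductionOn with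
    | h g =>
      obtain ⟨x, hx⟩ := heckeRep_surjective hqL g.2
      exact ⟨x, Quotient.sound ((QuotientGroup.rightRel_apply (s := heckeSubgroup q L)).2 hx)⟩

end HeckeCosetRepresentatives

/-! ### Components of the character, degenerate forms, extension to rational matrices -/

section Components

variable {q m : ℕ} (h : Nat.Coprime q m) (χ : DirichletCharacter ℂ (q * m))

/-- The component modulo `m` of a Dirichlet character modulo `q m`, for coprime `q` and `m`. -/
noncomputable def coComponent : DirichletCharacter ℂ m :=
  MulChar.ofUnitHom (χ.toUnitHom.comp
    ((Units.map (ZMod.chineseRemainder h).symm.toRingHom.toMonoidHom).comp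
      (MulEquiv.prodUnits.symm.toMonoidHom.comp (MonoidHom.inr (ZMod q)ˣ (ZMod m)ˣ))))

theorem localComponent_unit (u : (ZMod q)ˣ) :
    localComponent h χ u = χ ((ZMod.chineseRemainder h).symm (u, 1)) := by
  rw [localComponent, MulChar.ofUnitHom_coe]
  rfl

theorem coComponent_unit (u : (ZMod m)ˣ) :
    coComponent h χ u = χ ((ZMod.chineseRemainder h).symm (1, u)) := by
  rw [coComponent, MulChar.ofUnitHom_coe]
  rfl

/-- A character modulo `q m` is the product of its components, also at non-units. -/
theorem components_mul (a : ℤ) :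
    χ (a : ZMod (q * m)) = localComponent h χ (a : ZMod q) * coComponent h χ (a : ZMod m) := by
  have ha : (a : ZMod (q * m))
      = (ZMod.chineseRemainder h).symm ((a : ZMod q), (a : ZMod m)) := by
    rw [RingEquiv.eq_symm_apply, map_intCast]; rfl
  have hu : IsUnit (a : ZMod (q * m)) ↔ IsUnit (a : ZMod q) ∧ IsUnit (a : ZMod m) := by
    rw [ha, MulEquiv.isUnit_map, Prod.isUnit_iff]
  by_cases hq : IsUnit (a : ZMod q)
  · by_cases hm : IsUnit (a : ZMod m)
    · obtain ⟨u, hu⟩ := hq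
      obtain ⟨v, hv⟩ := hm
      rw [ha, ← hu, ← hv, localComponent_unit, coComponent_unit, ← map_mul, ← map_mul]
      simp
    · rw [MulChar.map_nonunit _ hm, mul_zero, MulChar.map_nonunit]
      exact fun h' => hm (hu.1 h').2
  · rw [MulChar.map_nonunit _ hq, zero_mul, MulChar.map_nonunit]
    exact fun h' => hq (hu.1 h').1

theorem localComponent_sq (hχ : χ ^ 2 = 1) : localComponent h χ ^ 2 = 1 := by
  ext u
  rw [MulChar.pow_apply_coe, MulChar.one_apply_coe, localComponent_unit, ← MulChar.pow_apply' _ two_ne_zero,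
    hχ, MulChar.one_apply]
  exact (MulEquiv.isUnit_map _).2 (Prod.isUnit_iff.2 ⟨u.isUnit, isUnit_one⟩)

theorem coComponent_sq (hχ : χ ^ 2 = 1) : coComponent h χ ^ 2 = 1 := by
  ext u
  rw [MulChar.pow_apply_coe, MulChar.one_apply_coe, coComponent_unit, ← MulChar.pow_apply' _ two_ne_zero,
    hχ, MulChar.one_apply]
  exact (MulEquiv.isUnit_map _).2 (Prod.isUnit_iff.2 ⟨isUnit_one, u.isUnit⟩)

end Components

section DegenerateForms

variable {q : ℕ} [hq : Fact q.Prime] {ψ : MulChar (ZMod q) ℂ}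

open Classical in
/-- The class under a quadratic character of the nonzero values of a degenerate binary quadratic
form with outer coefficients `b₁` and `b₃`. -/
noncomputable def formClass (ψ : MulChar (ZMod q) ℂ) (b₁ b₃ : ZMod q) : ℂ :=
  if b₁ = 0 then ψ b₃ else ψ b₁

/-- The values of a degenerate quadratic form over `ℤ/q` at the points of the projective line: all
but one are nonzero, and these are in the same class. -/
theorem sum_form_values (hψ : ψ ^ 2 = 1) {b₁ b₂ b₃ : ZMod q} (h : b₁ * b₃ = b₂ ^ 2) :
    ψ b₁ + ∑ t : ZMod q, ψ (b₃ - 2 * t * b₂ + t ^ 2 * b₁) = q * formClass ψ b₁ b₃ := by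
  unfold formClass
  split_ifs with h1
  · subst h1
    have h2 : b₂ = 0 := by simpa using h.symm
    subst h2
    simp [MulChar.map_zero]
  · have hval : ∀ t : ZMod q, ψ (b₃ - 2 * t * b₂ + t ^ 2 * b₁)
        = if t = b₂ / b₁ then 0 else ψ b₁ := by
      intro t
      have e : b₃ - 2 * t * b₂ + t ^ 2 * b₁ = b₁ * ((t - b₂ / b₁) * (t - b₂ / b₁)) := by
        field_simp
        linear_combination h
      rw [e, map_mul, map_mul]
      split_ifs with ht
      · rw [ht, sub_self, MulChar.map_zero]; ring
      · rw [realChar_sq hψ (isUnit_iff_ne_zero.2 (sub_ne_zero.2 ht)), mul_one]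
    simp_rw [hval]
    rw [Finset.sum_ite, Finset.sum_const_zero, Finset.sum_const, Finset.filter_ne',
      Finset.card_erase_of_mem (Finset.mem_univ _), Finset.card_univ, ZMod.card, nsmul_eq_mul,
      Nat.cast_sub hq.out.one_le]
    push_cast; ring

open Classical in
/-- A degenerate quadratic form over `ℤ/q` vanishes at one point of the projective line. -/
theorem sum_form_zeros {b₁ b₂ b₃ : ZMod q} (h : b₁ * b₃ = b₂ ^ 2) :
    (if b₁ = 0 then ψ b₃ else 0)
      + ∑ t : ZMod q, (if b₃ - 2 * t * b₂ + t ^ 2 * b₁ = 0 then ψ b₁ else 0)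
        = formClass ψ b₁ b₃ := by
  unfold formClass
  split_ifs with h1
  · subst h1
    have h2 : b₂ = 0 := by simpa using h.symm
    subst h2
    simp [MulChar.map_zero]
  · have hval : ∀ t : ZMod q, (b₃ - 2 * t * b₂ + t ^ 2 * b₁ = 0) ↔ t = b₂ / b₁ := by
      intro t
      have e : b₃ - 2 * t * b₂ + t ^ 2 * b₁ = b₁ * (t - b₂ / b₁) ^ 2 := by
        field_simp
        linear_combination h
      rw [e]
      simp [h1, sub_eq_zero]
    simp_rw [hval]
    simp

/-- A sum over residue classes modulo `q²` of a function that only depends on the class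
modulo `q`. -/
theorem sum_zmod_sq {M : Type*} [AddCommMonoid M] (f : ZMod q → M) :
    ∑ y : ZMod (q ^ 2), f ((y.val : ℕ) : ZMod q) = q • ∑ x : ZMod q, f x := by
  have : NeZero (q ^ 2) := ⟨pow_ne_zero 2 hq.out.ne_zero⟩
  have h1 : ∀ (n : ℕ) [NeZero n] (F : ℕ → M), ∑ y : ZMod n, F y.val = ∑ i ∈ Finset.range n, F i := by
    intro n hn F
    rw [← Fin.sum_univ_eq_sum_range]
    cases n with
    | zero => exact absurd rfl hn.ne
    | succ n => rfl
  rw [h1 (q ^ 2) fun i => f i]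
  have h2 : ∑ x : ZMod q, f x = ∑ i ∈ Finset.range q, f i := by
    rw [← h1 q fun i => f i]
    exact Finset.sum_congr rfl fun x _ => by rw [ZMod.natCast_zmod_val]
  rw [h2, sq, ← Fin.sum_univ_eq_sum_range, ← finProdFinEquiv.sum_comp, Fintype.sum_prod_type,
    ← Fin.sum_univ_eq_sum_range]
  simp [finProdFinEquiv]

theorem sum_char_affine {c a : ZMod q} (ha : a ≠ 0) :
    ∑ x : ZMod q, ψ (c - x * a) = ∑ x : ZMod q, ψ x := by
  refine Fintype.sum_equiv ((Equiv.mulRight₀ a ha).trans (Equiv.subLeft c)) _ _ fun x => ?_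
  rfl

end DegenerateForms

section Extension

/-- Functions on `Sp₂(ℤ)` which transform under `Γ_∞` by the `k`-th power of `det D`. -/
def IsEquivariant (k : ℕ) (F : Sp2 ℤ → ℂ) : Prop :=
  ∀ P ∈ siegelParabolic ℤ, ∀ g, F (P * g) = ((detD P : ℤ) : ℂ) ^ k * F g

/-- The extension of an equivariant function from `Sp₂(ℤ)` to `Sp₂(ℚ) = P(ℚ) Sp₂(ℤ)`, so that it
transforms under `P(ℚ)` by the `k`-th power of `det D`. -/
noncomputable def ratExt (k : ℕ) (F : Sp2 ℤ → ℂ) (g : Sp2 ℚ) : ℂ :=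
  ((detD (exists_iwasawa g).choose : ℚ) : ℂ) ^ k * F (exists_iwasawa g).choose_spec.2.choose

variable {k : ℕ} {F : Sp2 ℤ → ℂ}

theorem mem_parabolic_of_toQ {g : Sp2 ℤ} (h : toQ g ∈ siegelParabolic ℚ) :
    g ∈ siegelParabolic ℤ := by
  rw [mem_parabolic] at h ⊢
  intro i j
  have := h i j
  simpa using this

theorem IsEquivariant.ratExt_apply (hF : IsEquivariant k F) {p : Sp2 ℚ}
    (hp : p ∈ siegelParabolic ℚ) (g : Sp2 ℤ) :
    ratExt k F (p * toQ g) = ((detD p : ℚ) : ℂ) ^ k * F g := by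
  have hc := (exists_iwasawa (p * toQ g)).choose_spec
  have hc' := hc.2.choose_spec
  rw [ratExt]
  generalize hc.2.choose = g' at *
  generalize (exists_iwasawa (p * toQ g)).choose = p' at *
  obtain ⟨hp', -⟩ := hc
  obtain ⟨e, -⟩ := hc'
  have hP : toQ (g' * g⁻¹) = p'⁻¹ * p := by
    rw [map_mul, map_inv, mul_inv_eq_iff_eq_mul, mul_assoc, e, inv_mul_cancel_left]
  have hPm : g' * g⁻¹ ∈ siegelParabolic ℤ :=
    mem_parabolic_of_toQ (hP ▸ mul_mem (inv_mem hp') hp)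
  have hg' : g' = g' * g⁻¹ * g := by group
  have hdet : ((detD p : ℚ) : ℂ) = ((detD p' : ℚ) : ℂ) * ((detD (g' * g⁻¹) : ℤ) : ℂ) := by
    have : p = p' * toQ (g' * g⁻¹) := by rw [hP, mul_inv_cancel_left]
    conv_lhs => rw [this, detD_mul _ hp', detD_map]
    simp
  rw [hg', hF _ hPm, hdet]
  ring

theorem IsEquivariant.ratExt_toQ (hF : IsEquivariant k F) (g : Sp2 ℤ) :
    ratExt k F (toQ g) = F g := by
  have := hF.ratExt_apply (one_mem _) g
  rwa [one_mul, detD_one, Rat.cast_one, one_pow, one_mul] at this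

theorem IsEquivariant.ratExt_mul_left (hF : IsEquivariant k F) {p : Sp2 ℚ}
    (hp : p ∈ siegelParabolic ℚ) (g : Sp2 ℚ) :
    ratExt k F (p * g) = ((detD p : ℚ) : ℂ) ^ k * ratExt k F g := by
  obtain ⟨p', hp', g₀, rfl, -⟩ := exists_iwasawa g
  rw [← mul_assoc, hF.ratExt_apply (mul_mem hp hp'), hF.ratExt_apply hp', detD_mul _ hp]
  push_cast; ring

theorem IsEquivariant.ratExt_mul_right (hF : IsEquivariant k F) {γ : Sp2 ℤ} {c : ℂ}
    (h : ∀ g, F (g * γ) = c * F g) (g : Sp2 ℚ) :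
    ratExt k F (g * toQ γ) = c * ratExt k F g := by
  obtain ⟨p', hp', g₀, rfl, -⟩ := exists_iwasawa g
  rw [mul_assoc, ← map_mul, hF.ratExt_apply hp', hF.ratExt_apply hp', h]
  ring

end Extension

/-! ### The coefficient functions at the Hecke matrix -/

section Factors

variable {q m k : ℕ} {φ : MulChar (ZMod m) ℂ} {ψ : MulChar (ZMod q) ℂ}
  {e₁ e₂ : ZMod m} {f₁ f₂ : ZMod q}

/-- The product of the local factors of an integral symplectic matrix modulo `m` and modulo `q`. -/
noncomputable def prodFactor (φ : MulChar (ZMod m) ℂ) (e₁ e₂ : ZMod m) (ψ : MulChar (ZMod q) ℂ)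
    (f₁ f₂ : ZMod q) (g : Sp2 ℤ) : ℂ :=
  localFactor φ e₁ e₂ (mapSp (Int.castRingHom (ZMod m)) g)
    * localFactor ψ f₁ f₂ (mapSp (Int.castRingHom (ZMod q)) g)

open Classical in
/-- The rank one factor at `q`, restricted to the matrices with `det C` divisible by `q²`. -/
noncomputable def deepFactor (φ : MulChar (ZMod m) ℂ) (e₁ e₂ : ZMod m) (ψ : MulChar (ZMod q) ℂ)
    (g : Sp2 ℤ) : ℂ :=
  if (q : ℤ) ^ 2 ∣ pluecker g 0 then prodFactor φ e₁ e₂ ψ 1 0 g else 0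

theorem detD_eq_one_or {P : Sp2 ℤ} (hP : P ∈ siegelParabolic ℤ) : detD P = 1 ∨ detD P = -1 :=
  Int.isUnit_iff.1 (isUnit_detD hP)

theorem isEquivariant_prodFactor (H : LocalDatum φ e₁ e₂) (H' : LocalDatum ψ f₁ f₂)
    (hpar : ψ (-1) * φ (-1) = (-1) ^ k) : IsEquivariant k (prodFactor φ e₁ e₂ ψ f₁ f₂) := by
  intro P hP g
  rw [prodFactor, map_mul, map_mul, H.apply_mul_left (mapSp_mem_parabolic _ hP),
    H'.apply_mul_left (mapSp_mem_parabolic _ hP), detD_map, detD_map, prodFactor]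
  rcases detD_eq_one_or hP with h | h <;> rw [h]
  · simp
  · simp only [eq_intCast, Int.cast_neg, Int.cast_one]
    rw [← hpar]; ring

theorem pluecker_zero_mul_left_dvd {P : Sp2 ℤ} (hP : P ∈ siegelParabolic ℤ) (g : Sp2 ℤ) (n : ℤ) :
    n ∣ pluecker (P * g) 0 ↔ n ∣ pluecker g 0 := by
  rw [pluecker_mul_left _ hP, Pi.smul_apply, smul_eq_mul, (isUnit_detD hP).dvd_mul_left]

theorem isEquivariant_deepFactor (H : LocalDatum φ e₁ e₂) (hψ : ψ ^ 2 = 1)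
    (hpar : ψ (-1) * φ (-1) = (-1) ^ k) : IsEquivariant k (deepFactor φ e₁ e₂ ψ) := by
  intro P hP g
  simp only [deepFactor, pluecker_zero_mul_left_dvd hP]
  split_ifs
  · exact isEquivariant_prodFactor H (localDatum_one_zero hψ) hpar P hP g
  · rw [mul_zero]

theorem mapSp_mem_of_dvd {L n : ℕ} (h : n ∣ L) {γ : Sp2 ℤ} (hγ : γ ∈ Gamma0 L) :
    mapSp (Int.castRingHom (ZMod n)) γ ∈ siegelParabolic (ZMod n) :=
  mem_parabolic.2 fun i j => (ZMod.intCast_zmod_eq_zero_iff_dvd _ _).2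
    ((Int.natCast_dvd_natCast.2 h).trans (mem_Gamma0.1 hγ i j))

theorem prodFactor_mul_right {L : ℕ} (hL : q * m ∣ L) (H : LocalDatum φ e₁ e₂)
    (H' : LocalDatum ψ f₁ f₂) {γ : Sp2 ℤ} (hγ : γ ∈ Gamma0 L) (g : Sp2 ℤ) :
    prodFactor φ e₁ e₂ ψ f₁ f₂ (g * γ)
      = ψ (detD γ : ℤ) * φ (detD γ : ℤ) * prodFactor φ e₁ e₂ ψ f₁ f₂ g := by
  rw [prodFactor, map_mul, map_mul,
    H.apply_mul_right (mapSp_mem_of_dvd ((dvd_mul_left m q).trans hL) hγ),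
    H'.apply_mul_right (mapSp_mem_of_dvd ((dvd_mul_right q m).trans hL) hγ), detD_map, detD_map,
    prodFactor]
  simp only [eq_intCast]
  ring

/-- Divisibility of `det C` by `n` is invariant under `Γ₀(L)`, if `n ∣ L`. -/
theorem pluecker_zero_mul_right_dvd {L n : ℕ} (h : n ∣ L) {γ : Sp2 ℤ} (hγ : γ ∈ Gamma0 L)
    (g : Sp2 ℤ) : (n : ℤ) ∣ pluecker (g * γ) 0 ↔ (n : ℤ) ∣ pluecker g 0 := by
  have hp := mapSp_mem_of_dvd h hγ
  rw [← ZMod.intCast_zmod_eq_zero_iff_dvd, ← ZMod.intCast_zmod_eq_zero_iff_dvd]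
  have e := pluecker_zero_mul_right (mapSp (Int.castRingHom (ZMod n)) g) hp
  rw [← map_mul, pluecker_map, pluecker_map, eq_intCast, eq_intCast] at e
  rw [e, (IsUnit.of_mul_eq_one _ (detA_mul_detD hp)).mul_right_eq_zero]

theorem deepFactor_mul_right {L : ℕ} (hL : q * (q * m) ∣ L) (H : LocalDatum φ e₁ e₂)
    (hψ : ψ ^ 2 = 1) {γ : Sp2 ℤ} (hγ : γ ∈ Gamma0 L) (g : Sp2 ℤ) :
    deepFactor φ e₁ e₂ ψ (g * γ)
      = ψ (detD γ : ℤ) * φ (detD γ : ℤ) * deepFactor φ e₁ e₂ ψ g := by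
  have h1 : q ^ 2 ∣ L := by
    refine Dvd.dvd.trans ⟨m, by ring⟩ hL
  have h2 := pluecker_zero_mul_right_dvd h1 hγ g
  push_cast at h2
  simp only [deepFactor, h2]
  split_ifs
  · exact prodFactor_mul_right ((dvd_mul_left _ _).trans hL) H (localDatum_one_zero hψ) hγ g
  · rw [mul_zero]

theorem norm_prodFactor_le (hφ : φ ^ 2 = 1) (hψ : ψ ^ 2 = 1) (g : Sp2 ℤ) :
    ‖prodFactor φ e₁ e₂ ψ f₁ f₂ g‖ ≤ 1 := by
  rw [prodFactor, norm_mul]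
  exact mul_le_one₀ (norm_localFactor_le hφ _) (norm_nonneg _) (norm_localFactor_le hψ _)

theorem norm_deepFactor_le (hφ : φ ^ 2 = 1) (hψ : ψ ^ 2 = 1) (g : Sp2 ℤ) :
    ‖deepFactor φ e₁ e₂ ψ g‖ ≤ 1 := by
  rw [deepFactor]
  split_ifs
  · exact norm_prodFactor_le hφ hψ g
  · simp

end Factors

section HeckeTerm

variable {q m k : ℕ} {φ : MulChar (ZMod m) ℂ} {ψ : MulChar (ZMod q) ℂ}
  {e₁ e₂ : ZMod m}

/-- The factor away from `q` under right multiplication by `δ₁`. -/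
theorem localFactor_of_mul_delta1 (hqm : q.Coprime m) (D : LocalDatum φ e₁ e₂) {H g : Sp2 ℤ} {n : ℕ}
    (hn : n ∣ q ^ 2) (h : ∀ i, (n : ℤ) * pluecker g i = ![(q : ℤ) ^ 2 * pluecker H 0,
        (q : ℤ) ^ 2 * pluecker H 1, (q : ℤ) * pluecker H 2, pluecker H 3, pluecker H 4] i) :
    localFactor φ e₁ e₂ (mapSp (Int.castRingHom (ZMod m)) g)
      = φ n * localFactor φ e₁ e₂ (mapSp (Int.castRingHom (ZMod m)) H) := by
  have hqu : IsUnit (q : ZMod m) := (ZMod.isUnit_iff_coprime _ _).2 hqm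
  have hnu : IsUnit (n : ZMod m) :=
    (ZMod.isUnit_iff_coprime _ _).2 (Nat.Coprime.coprime_dvd_left hn (hqm.pow_left 2))
  obtain ⟨v, hv⟩ := hqu.exists_right_inv
  obtain ⟨w, hw⟩ := hnu.exists_right_inv
  have hl : ((q : ZMod m) * 1 - 0 * 0) * v = 1 := by linear_combination hv
  have e : pluecker (mapSp (Int.castRingHom (ZMod m)) g)
      = (w * q) • pluecker (mapSp (Int.castRingHom (ZMod m)) H * levi (q : ZMod m) 0 0 1 v hl) := by
    rw [pluecker_mul_levi]
    ext i
    have hi := congrArg (Int.cast : ℤ → ZMod m) (h i)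
    push_cast at hi
    rw [pluecker_map, eq_intCast, Pi.smul_apply, smul_eq_mul]
    fin_cases i <;> simp [pluecker_map] at hi ⊢
    · linear_combination w * hi - ((pluecker g 0 : ℤ) : ZMod m) * hw
    · linear_combination w * hi - ((pluecker g 1 : ℤ) : ZMod m) * hw
        - w * q ^ 2 * ((pluecker H 1 : ℤ) : ZMod m) * hv
    · linear_combination w * hi - ((pluecker g 2 : ℤ) : ZMod m) * hw
        - w * q * ((pluecker H 2 : ℤ) : ZMod m) * hv
    · linear_combination w * hi - ((pluecker g 3 : ℤ) : ZMod m) * hw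
        - w * ((pluecker H 3 : ℤ) : ZMod m) * hv
    · linear_combination w * hi - ((pluecker g 4 : ℤ) : ZMod m) * hw
        - w * ((pluecker H 4 : ℤ) : ZMod m) * hv
  rw [D.apply_of_pluecker e, D.apply_mul_right (levi_mem ..), detD_levi, map_mul,
    ← realChar_of_mul_eq_one D.real hw, ← realChar_of_mul_eq_one D.real hv]
  linear_combination φ n * localFactor φ e₁ e₂ (mapSp (Int.castRingHom (ZMod m)) H)
    * realChar_sq D.real hqu

variable [hq : Fact q.Prime]

theorem delta1_eq_levi : delta1 q = levi (q : ℚ) 0 0 1 (q : ℚ)⁻¹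
    (by have : (q : ℚ) ≠ 0 := by exact_mod_cast hq.out.ne_zero
        field_simp; ring) := by
  have : (q : ℚ) ≠ 0 := by exact_mod_cast hq.out.ne_zero
  apply Subtype.ext
  ext i j
  rcases i with i | i <;> rcases j with j | j <;> fin_cases i <;> fin_cases j <;>
    simp [delta1, levi, this]

/-- The Iwasawa decomposition of `H δ₁` for integral `H`: with `n = q det D_p`, the Plücker vector
of the integral factor is `n⁻¹ (q² a, q² b₁, q b₂, b₃, d)`, where `(a, b₁, b₂, b₃, d)` is that of
`H`; hence `n` divides `q²`. -/
theorem exists_iwasawa_mul_delta1 (H : Sp2 ℤ) :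
    ∃ p ∈ siegelParabolic ℚ, ∃ g : Sp2 ℤ, ∃ n : ℕ, toQ H * delta1 q = p * toQ g ∧
      detD p = n / q ∧ n ∣ q ^ 2 ∧ ∀ i, (n : ℤ) * pluecker g i = ![(q : ℤ) ^ 2 * pluecker H 0,
        (q : ℤ) ^ 2 * pluecker H 1, (q : ℤ) * pluecker H 2, pluecker H 3, pluecker H 4] i := by
  have hq0 : (q : ℚ) ≠ 0 := by exact_mod_cast hq.out.ne_zero
  obtain ⟨p, hp, g, e, hpos⟩ := exists_iwasawa (toQ H * delta1 q)
  have hv : ∀ i, (q * detD p) * ((pluecker g i : ℤ) : ℚ) = ((![(q : ℤ) ^ 2 * pluecker H 0,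
        (q : ℤ) ^ 2 * pluecker H 1, (q : ℤ) * pluecker H 2, pluecker H 3, pluecker H 4] i : ℤ) : ℚ) := by
    intro i
    have e' := congrFun (congrArg pluecker e) i
    rw [pluecker_mul_left _ hp, delta1_eq_levi, pluecker_mul_levi, Pi.smul_apply,
      smul_eq_mul] at e'
    have hg : pluecker (toQ g) i = ((pluecker g i : ℤ) : ℚ) := pluecker_map _ g i
    rw [mul_assoc, ← hg, ← e']
    fin_cases i <;> simp [pluecker_map, hq.out.ne_zero] <;> field_simp
  obtain ⟨x, hx⟩ := exists_pluecker_unimodular g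
  obtain ⟨y, hy⟩ := exists_pluecker_unimodular H
  have hint : ∃ z : ℤ, (z : ℚ) = q * detD p := by
    refine ⟨∑ i, x i * ![(q : ℤ) ^ 2 * pluecker H 0,
        (q : ℤ) ^ 2 * pluecker H 1, (q : ℤ) * pluecker H 2, pluecker H 3, pluecker H 4] i, ?_⟩
    have hx' : ∑ i, (x i : ℚ) * ((pluecker g i : ℤ) : ℚ) = 1 := by exact_mod_cast hx
    rw [Int.cast_sum, ← mul_one (q * detD p), ← hx', Finset.mul_sum]
    refine Finset.sum_congr rfl fun i _ => ?_
    rw [Int.cast_mul, ← hv]; ring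
  obtain ⟨z, hz⟩ := hint
  have hz0 : 0 < z := by
    have : (0 : ℚ) < z := by rw [hz]; exact mul_pos (by exact_mod_cast hq.out.pos) hpos
    exact_mod_cast this
  lift z to ℕ using hz0.le
  have hv' : ∀ i, (z : ℤ) * pluecker g i = ![(q : ℤ) ^ 2 * pluecker H 0,
        (q : ℤ) ^ 2 * pluecker H 1, (q : ℤ) * pluecker H 2, pluecker H 3, pluecker H 4] i := by
    intro i
    have := hv i
    rw [← hz] at this
    exact_mod_cast this
  refine ⟨p, hp, g, z, e, ?_, ?_, hv'⟩
  · rw [eq_div_iff hq0, mul_comm, ← hz]; simp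
  · have h0 := hv' 0
    have h1 := hv' 1
    have h2 := hv' 2
    have h3 := hv' 3
    have h4 := hv' 4
    simp at h0 h1 h2 h3 h4
    rw [Fin.sum_univ_five] at hy
    have : (z : ℤ) ∣ (q : ℤ) ^ 2 := by
      refine ⟨y 0 * pluecker g 0 + y 1 * pluecker g 1 + q * y 2 * pluecker g 2
        + q ^ 2 * y 3 * pluecker g 3 + q ^ 2 * y 4 * pluecker g 4, ?_⟩
      linear_combination -(q : ℤ) ^ 2 * hy - y 0 * h0 - y 1 * h1 - q * y 2 * h2
        - q ^ 2 * y 3 * h3 - q ^ 2 * y 4 * h4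
    exact_mod_cast this

theorem intCast_eq_zero_iff (a : ℤ) : (a : ZMod q) = 0 ↔ (q : ℤ) ∣ a :=
  ZMod.intCast_zmod_eq_zero_iff_dvd _ _

/-- A Plücker vector is nonzero modulo `q`. -/
theorem not_forall_dvd_pluecker (g : Sp2 ℤ) : ¬ ∀ i, (q : ℤ) ∣ pluecker g i := by
  intro h
  obtain ⟨x, hx⟩ := exists_pluecker_unimodular g
  have h1 : (q : ℤ) ∣ 1 := hx ▸ Finset.dvd_sum fun i _ => (h i).mul_left _
  exact hq.out.one_lt.ne' (by exact_mod_cast Int.eq_one_of_dvd_one (by positivity) h1)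

open Classical in
theorem localFactor_rank_one_int (hψ : ψ ^ 2 = 1) (g : Sp2 ℤ) :
    localFactor ψ 1 0 (mapSp (Int.castRingHom (ZMod q)) g) = if (q : ℤ) ∣ pluecker g 0 then
      formClass ψ (pluecker g 1 : ℤ) (pluecker g 3 : ℤ) else 0 := by
  rw [localFactor_rank_one hψ]
  simp only [pluecker_map, eq_intCast, intCast_eq_zero_iff, formClass]

theorem localFactor_rank_two_int (hψ : ψ ^ 2 = 1) (g : Sp2 ℤ) :
    localFactor ψ 1 1 (mapSp (Int.castRingHom (ZMod q)) g) = ψ (pluecker g 0 : ℤ) := by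
  rw [localFactor_rank_two hψ, pluecker_map, eq_intCast]

open Classical in
/-- The value at `H δ₁` of the extension of the deep factor. -/
theorem ratExt_mul_delta1 (hqm : q.Coprime m) (D : LocalDatum φ e₁ e₂) (hψ : ψ ^ 2 = 1)
    (hpar : ψ (-1) * φ (-1) = (-1) ^ k) (H : Sp2 ℤ) :
    ratExt k (deepFactor φ e₁ e₂ ψ) (toQ H * delta1 q)
      = localFactor φ e₁ e₂ (mapSp (Int.castRingHom (ZMod m)) H)
        * (((q : ℂ) ^ k)⁻¹ * ψ (pluecker H 3 : ℤ) + (q : ℂ) ^ k *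
          (if (q : ℤ) ^ 2 ∣ pluecker H 0 ∧ (q : ℤ) ^ 2 ∣ pluecker H 3 ∧ (q : ℤ) ∣ pluecker H 2 ∧
            (q : ℤ) ^ 2 ∣ pluecker H 4 then ψ (pluecker H 1 : ℤ) else 0)) := by
  have hqC : (q : ℂ) ≠ 0 := by exact_mod_cast hq.out.ne_zero
  have hqZ : (q : ℤ) ≠ 0 := by exact_mod_cast hq.out.ne_zero
  have hqp : Prime (q : ℤ) := Nat.prime_iff_prime_int.1 hq.out
  obtain ⟨p, hp, g, n, e, hdet, hn, hv⟩ := exists_iwasawa_mul_delta1 (q := q) H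
  rw [e, (isEquivariant_deepFactor D hψ hpar).ratExt_apply hp, hdet, deepFactor, prodFactor,
    localFactor_of_mul_delta1 hqm D hn hv, localFactor_rank_one_int hψ]
  set Φ := localFactor φ e₁ e₂ (mapSp (Int.castRingHom (ZMod m)) H)
  have hall : (q : ℤ) ^ 2 ∣ pluecker H 3 → (q : ℤ) ∣ pluecker H 2 → (q : ℤ) ^ 2 ∣ pluecker H 4 →
      q ^ 2 ∣ n := by
    intro h3 h2 h4
    obtain ⟨x, hx⟩ := exists_pluecker_unimodular g
    have hz : (n : ℤ) = ∑ i, x i * ((n : ℤ) * pluecker g i) := by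
      conv_lhs => rw [← mul_one (n : ℤ), ← hx, Finset.mul_sum]
      exact Finset.sum_congr rfl fun i _ => by ring
    have : (q : ℤ) ^ 2 ∣ n := by
      rw [hz]
      refine Finset.dvd_sum fun i _ => Dvd.dvd.mul_left ?_ _
      rw [hv]
      fin_cases i <;> simp [h3, h4]
      rw [sq]; exact mul_dvd_mul_left _ h2
    exact_mod_cast this
  have h0 := hv 0
  have h1 := hv 1
  have h2 := hv 2
  have h3 := hv 3
  have h4 := hv 4
  simp at h0 h1 h2 h3 h4
  obtain ⟨j, hj, rfl⟩ := (Nat.dvd_prime_pow hq.out).1 hn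
  have hiso := pluecker_isotropic H
  interval_cases j
  · -- here `g` has Plücker vector `(q² a, q² b₁, q b₂, b₃, d)`
    simp at h0 h1 h2 h3 h4
    rw [if_neg (c := _ ∧ _), h0, if_pos (dvd_mul_right _ _), if_pos, h1, h3, formClass, if_pos]
    · simp only [pow_zero, Nat.cast_one, map_one, Rat.cast_div, Rat.cast_one, Rat.cast_natCast]
      rw [one_div, inv_pow]
      ring
    · simp
    · exact (dvd_pow_self _ two_ne_zero).trans (dvd_mul_right _ _)
    · rintro ⟨-, k3, k2, k4⟩
      have := hall k3 k2 k4
      rw [pow_zero, Nat.dvd_one] at this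
      exact (one_lt_pow₀ hq.out.one_lt two_ne_zero).ne' this
  · -- here the Plücker vector of `g` is `(q a, q b₁, b₂, b₃ / q, d / q)`
    simp at h0 h1 h2 h3 h4
    have k0 : pluecker g 0 = q * pluecker H 0 :=
      mul_left_cancel₀ hqZ (by linear_combination h0)
    have k1 : pluecker g 1 = q * pluecker H 1 :=
      mul_left_cancel₀ hqZ (by linear_combination h1)
    have z : ((pluecker H 3 : ℤ) : ZMod q) = 0 := by rw [← h3]; simp
    rw [if_neg (c := _ ∧ _), z, MulChar.map_zero]
    · simp only [mul_zero, add_zero]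
      split_ifs with c1 c2
      · -- then `H` is `(0, b₁, 0, 0, 0)` modulo `q`, and `q²` divides `b₁ b₃`
        have a0 : (q : ℤ) ∣ pluecker H 0 := by
          rw [k0, sq] at c1
          exact (mul_dvd_mul_iff_left hqZ).1 c1
        have a3 : (q : ℤ) ∣ pluecker H 3 := ⟨_, h3.symm⟩
        have a4 : (q : ℤ) ∣ pluecker H 4 := ⟨_, h4.symm⟩
        have a2 : (q : ℤ) ∣ pluecker H 2 := by
          refine hqp.dvd_of_dvd_pow (n := 2) ?_
          have : pluecker H 2 ^ 2 = pluecker H 1 * pluecker H 3 - pluecker H 0 * pluecker H 4 := by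
            linear_combination hiso
          rw [this]
          exact dvd_sub (a3.mul_left _) (a4.mul_left _)
        have a1 : ¬ (q : ℤ) ∣ pluecker H 1 := fun a1 =>
          not_forall_dvd_pluecker (q := q) H fun i => by
            fin_cases i
            exacts [a0, a1, a2, a3, a4]
        have a3' : (q : ℤ) ^ 2 ∣ pluecker H 1 * pluecker H 3 := by
          have : pluecker H 1 * pluecker H 3 = pluecker H 0 * pluecker H 4 + pluecker H 2 ^ 2 := by
            linear_combination -hiso
          rw [this]
          refine dvd_add ?_ (pow_dvd_pow_of_dvd a2 2)
          rw [sq]; exact mul_dvd_mul a0 a4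
        have a3'' : (q : ℤ) ∣ pluecker g 3 := by
          rw [← h3, mul_left_comm, sq] at a3'
          exact (hqp.dvd_or_dvd ((mul_dvd_mul_iff_left hqZ).1 a3')).resolve_left a1
        rw [formClass, if_pos (by rw [k1]; simp), (intCast_eq_zero_iff _).2 a3'', MulChar.map_zero]
        simp
      · simp
      · simp
    · rintro ⟨-, k3, k2, k4⟩
      have := hall k3 k2 k4
      have := Nat.le_of_dvd (by simpa using hq.out.pos) this
      nlinarith [hq.out.one_lt]
  · -- here the Plücker vector of `g` is `(a, b₁, b₂ / q, b₃ / q², d / q²)`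
    simp at h0 h1 h2 h3 h4
    have k0 : pluecker g 0 = pluecker H 0 := h0.resolve_right hq.out.ne_zero
    have k1 : pluecker g 1 = pluecker H 1 := h1.resolve_right hq.out.ne_zero
    have a3 : (q : ℤ) ^ 2 ∣ pluecker H 3 := ⟨_, h3.symm⟩
    have a4 : (q : ℤ) ^ 2 ∣ pluecker H 4 := ⟨_, h4.symm⟩
    have a2 : (q : ℤ) ∣ pluecker H 2 :=
      ⟨pluecker g 2, mul_left_cancel₀ hqZ (by linear_combination -h2)⟩
    have hqq := dvd_pow_self (q : ℤ) two_ne_zero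
    have z : ((pluecker H 3 : ℤ) : ZMod q) = 0 := (intCast_eq_zero_iff _).2 (hqq.trans a3)
    have hφq : φ ((q ^ 2 : ℕ) : ZMod m) = 1 := by
      rw [Nat.cast_pow, map_pow, sq]
      exact realChar_sq D.real ((ZMod.isUnit_iff_coprime _ _).2 hqm)
    rw [z, MulChar.map_zero, hφq, k0, k1]
    by_cases a0 : (q : ℤ) ^ 2 ∣ pluecker H 0
    · rw [if_pos a0, if_pos (hqq.trans a0), if_pos ⟨a0, a3, a2, a4⟩, formClass, if_neg]
      · simp only [Nat.cast_pow, Rat.cast_div, Rat.cast_natCast, Rat.cast_pow]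
        field_simp
        ring
      · rw [intCast_eq_zero_iff]
        intro a1
        refine not_forall_dvd_pluecker (q := q) H fun i => ?_
        fin_cases i
        exacts [hqq.trans a0, a1, a2, hqq.trans a3, hqq.trans a4]
    · rw [if_neg a0, if_neg fun h => a0 h.1]
      simp

end HeckeTerm

/-! ### The local identity for the Hecke operator -/

section HeckeSum

variable {q m k : ℕ} {φ : MulChar (ZMod m) ℂ} {ψ : MulChar (ZMod q) ℂ}
  {e₁ e₂ : ZMod m}

/-- The Plücker vector of `h γ⁻¹`, where `γ` is a Hecke representative. -/
theorem pluecker_mul_heckeRep_inv_some (h : Sp2 ℤ) (t : ZMod q) (y₁ : ZMod (q ^ 2)) (y₂ : ZMod q) :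
    pluecker (h * (heckeRep (some t, y₁, y₂))⁻¹) = ![pluecker h 0, pluecker h 1,
      pluecker h 2 - t.val * pluecker h 1 + y₂.val * pluecker h 0,
      pluecker h 3 - 2 * t.val * pluecker h 2 + (t.val : ℤ) ^ 2 * pluecker h 1
        - y₁.val * pluecker h 0,
      pluecker h 4 - y₁.val * pluecker h 1
        - 2 * y₂.val * (pluecker h 2 - t.val * pluecker h 1) - (y₂.val : ℤ) ^ 2 * pluecker h 0] := by
  rw [heckeRep, _root_.mul_inv_rev, projLevi, levi_inv, unip_inv, ← mul_assoc, pluecker_mul_unip,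
    pluecker_mul_levi]
  ext i
  fin_cases i <;> simp [-ZMod.natCast_val] <;> ring

theorem pluecker_mul_heckeRep_inv_none (h : Sp2 ℤ) (y₁ : ZMod (q ^ 2)) (y₂ : ZMod q) :
    pluecker (h * (heckeRep (none, y₁, y₂))⁻¹) = ![pluecker h 0, pluecker h 3,
      -pluecker h 2 + y₂.val * pluecker h 0, pluecker h 1 - y₁.val * pluecker h 0,
      pluecker h 4 - y₁.val * pluecker h 3
        - 2 * y₂.val * (-pluecker h 2) - (y₂.val : ℤ) ^ 2 * pluecker h 0] := by
  rw [heckeRep, _root_.mul_inv_rev, projLevi, levi_inv, unip_inv, ← mul_assoc, pluecker_mul_unip,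
    pluecker_mul_levi]
  ext i
  fin_cases i <;> simp [-ZMod.natCast_val] <;> ring

variable [hq : Fact q.Prime]

/-- The sum over the unipotent representatives of the contributions of a vector in the first
position of the Hecke operator. -/
theorem sum_char_unip (a b : ℤ) :
    ∑ y₁ : ZMod (q ^ 2), ∑ _y₂ : ZMod q, ψ ((b - (y₁.val : ℤ) * a : ℤ) : ZMod q)
      = if (q : ℤ) ∣ a then (q : ℂ) ^ 3 * ψ (b : ZMod q) else (q : ℂ) ^ 2 * ∑ x : ZMod q, ψ x := by
  simp only [Finset.sum_const, Finset.card_univ, ZMod.card, nsmul_eq_mul]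
  rw [← Finset.mul_sum]
  have h := sum_zmod_sq (q := q) fun x => ψ ((b : ZMod q) - x * (a : ZMod q))
  push_cast
  rw [h, nsmul_eq_mul]
  split_ifs with ha
  · rw [(intCast_eq_zero_iff a).2 ha]
    simp
    ring
  · rw [sum_char_affine fun h' => ha ((intCast_eq_zero_iff a).1 h')]
    ring

open Classical in
/-- The sum over the unipotent representatives of the contributions of a vector in the last
position: for each `y₂` exactly one class `y₁` modulo `q²` contributes. -/
theorem sum_dvd_unip {a b₁ b₂ b₃ d : ℤ} (h : a * d = b₁ * b₃ - b₂ ^ 2) :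
    ∑ y₁ : ZMod (q ^ 2), ∑ y₂ : ZMod q, (if (q : ℤ) ^ 2 ∣ a ∧ (q : ℤ) ^ 2 ∣ b₃ - (y₁.val : ℤ) * a ∧
        (q : ℤ) ∣ b₂ + (y₂.val : ℤ) * a ∧ (q : ℤ) ^ 2 ∣ d - (y₁.val : ℤ) * b₁
          - 2 * (y₂.val : ℤ) * b₂ - (y₂.val : ℤ) ^ 2 * a then ψ (b₁ : ZMod q) else 0)
      = if (q : ℤ) ^ 2 ∣ a then (q : ℂ) * (if (b₃ : ZMod q) = 0 then ψ (b₁ : ZMod q) else 0) else 0 := by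
  have : NeZero (q ^ 2) := ⟨pow_ne_zero 2 hq.out.ne_zero⟩
  have hqp : Prime (q : ℤ) := Nat.prime_iff_prime_int.1 hq.out
  have hqq := dvd_pow_self (q : ℤ) two_ne_zero
  by_cases ha : (q : ℤ) ^ 2 ∣ a
  swap
  · simp [ha]
  rw [if_pos ha]
  simp only [intCast_eq_zero_iff]
  by_cases hb : (q : ℤ) ∣ b₁
  · simp [(intCast_eq_zero_iff b₁).2 hb, MulChar.map_zero]
  by_cases h3 : (q : ℤ) ∣ b₃
  swap
  · rw [if_neg h3, mul_zero]
    refine Finset.sum_eq_zero fun y₁ _ => Finset.sum_eq_zero fun y₂ _ => if_neg ?_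
    rintro ⟨-, k, -⟩
    exact h3 ((dvd_sub_left (hqq.trans (ha.mul_left _))).1 (hqq.trans k))
  have h2 : (q : ℤ) ∣ b₂ := by
    refine hqp.dvd_of_dvd_pow (n := 2) ?_
    have : b₂ ^ 2 = b₁ * b₃ - a * d := by linear_combination h
    rw [this]
    exact dvd_sub (h3.mul_left _) ((hqq.trans ha).mul_right _)
  have h3' : (q : ℤ) ^ 2 ∣ b₃ := by
    refine (IsCoprime.pow_left (hqp.coprime_iff_not_dvd.2 hb)).dvd_of_dvd_mul_left (y := b₁) ?_
    have : b₁ * b₃ = a * d + b₂ ^ 2 := by linear_combination -h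
    rw [this]
    exact dvd_add (ha.mul_right _) (pow_dvd_pow_of_dvd h2 2)
  have hbu : IsUnit (b₁ : ZMod (q ^ 2)) := by
    rw [ZMod.coe_int_isUnit_iff_isCoprime]
    push_cast
    exact IsCoprime.pow_left (hqp.coprime_iff_not_dvd.2 hb)
  obtain ⟨v, hv⟩ := hbu.exists_right_inv
  have hcond : ∀ (y₁ : ZMod (q ^ 2)) (y₂ : ZMod q),
      ((q : ℤ) ^ 2 ∣ a ∧ (q : ℤ) ^ 2 ∣ b₃ - (y₁.val : ℤ) * a ∧
        (q : ℤ) ∣ b₂ + (y₂.val : ℤ) * a ∧ (q : ℤ) ^ 2 ∣ d - (y₁.val : ℤ) * b₁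
          - 2 * (y₂.val : ℤ) * b₂ - (y₂.val : ℤ) ^ 2 * a) ↔
      y₁ = v * ((d - 2 * (y₂.val : ℤ) * b₂ : ℤ) : ZMod (q ^ 2)) := by
    intro y₁ y₂
    have hlast : (q : ℤ) ^ 2 ∣ d - (y₁.val : ℤ) * b₁ - 2 * (y₂.val : ℤ) * b₂
        - (y₂.val : ℤ) ^ 2 * a ↔ y₁ = v * ((d - 2 * (y₂.val : ℤ) * b₂ : ℤ) : ZMod (q ^ 2)) := by
      rw [dvd_sub_left (ha.mul_left _)]
      have hc : ((q ^ 2 : ℕ) : ℤ) = (q : ℤ) ^ 2 := by push_cast; rfl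
      rw [← hc, ← ZMod.intCast_zmod_eq_zero_iff_dvd]
      have hy : (((y₁.val : ℕ) : ℤ) : ZMod (q ^ 2)) = y₁ := by
        rw [Int.cast_natCast, ZMod.natCast_zmod_val]
      rw [Int.cast_sub, Int.cast_sub, Int.cast_mul (y₁.val : ℤ), hy, Int.cast_sub]
      constructor
      · intro e
        linear_combination (-v) * e - y₁ * hv
      · intro e
        rw [e]
        linear_combination (-((d : ℤ) : ZMod (q ^ 2))
          + ((2 * (y₂.val : ℤ) * b₂ : ℤ) : ZMod (q ^ 2))) * hv
    rw [hlast]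
    exact ⟨fun h => h.2.2.2, fun h => ⟨ha, dvd_sub h3' (ha.mul_left _),
      dvd_add h2 ((hqq.trans ha).mul_left _), h⟩⟩
  simp_rw [hcond]
  rw [Finset.sum_comm, if_pos h3]
  simp [Finset.card_univ, ZMod.card]

open Classical in
theorem prodFactor_rank_one (hψ : ψ ^ 2 = 1) (h : Sp2 ℤ) : prodFactor φ e₁ e₂ ψ 1 0 h
    = localFactor φ e₁ e₂ (mapSp (Int.castRingHom (ZMod m)) h) *
      (if (q : ℤ) ∣ pluecker h 0 then formClass ψ (pluecker h 1 : ℤ) (pluecker h 3 : ℤ) else 0) := by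
  rw [prodFactor, localFactor_rank_one_int hψ]

open Classical in
/-- The local identity behind the action of the Hecke operator, in terms of Plücker vectors. -/
theorem sum_ratExt_heckeRep (hqm : q.Coprime m) (D : LocalDatum φ e₁ e₂) (hψ : ψ ^ 2 = 1)
    (hpar : ψ (-1) * φ (-1) = (-1) ^ k) (h : Sp2 ℤ) :
    ∑ x : Option (ZMod q) × ZMod (q ^ 2) × ZMod q,
        ratExt k (deepFactor φ e₁ e₂ ψ) (toQ h * (toQ (heckeRep x))⁻¹ * delta1 q)
      = ((q : ℂ) ^ k)⁻¹ * ((q : ℂ) ^ 4 * prodFactor φ e₁ e₂ ψ 1 0 h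
          + (q : ℂ) ^ 2 * (q + 1) * (∑ x, ψ x) * prodFactor φ e₁ e₂ (1 : MulChar (ZMod q) ℂ) 1 1 h)
        + (q : ℂ) ^ (k + 1) * deepFactor φ e₁ e₂ ψ h := by
  have hqq := dvd_pow_self (q : ℤ) two_ne_zero
  set Φ := localFactor φ e₁ e₂ (mapSp (Int.castRingHom (ZMod m)) h) with hΦ
  have hiso := pluecker_isotropic h
  have hΦx : ∀ x, localFactor φ e₁ e₂ (mapSp (Int.castRingHom (ZMod m)) (h * (heckeRep (q := q) x)⁻¹))
      = Φ := by
    intro x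
    have hm := inv_mem (heckeRep_mem_parabolic (q := q) x)
    have hd : detD (heckeRep (q := q) x)⁻¹ = 1 := by
      have := detD_mul (heckeRep (q := q) x)⁻¹ (heckeRep_mem_parabolic x)
      rw [mul_inv_cancel, detD_one, detD_heckeRep, one_mul] at this
      exact this.symm
    rw [map_mul, D.apply_mul_right (mapSp_mem_parabolic _ hm), detD_map, hd, map_one, map_one,
      one_mul]
  have hterm : ∀ x : Option (ZMod q) × ZMod (q ^ 2) × ZMod q, ratExt k (deepFactor φ e₁ e₂ ψ) (toQ h * (toQ (heckeRep x))⁻¹ * delta1 q)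
      = Φ * (((q : ℂ) ^ k)⁻¹ * ψ (pluecker (h * (heckeRep x)⁻¹) 3 : ℤ) + (q : ℂ) ^ k *
          (if (q : ℤ) ^ 2 ∣ pluecker (h * (heckeRep x)⁻¹) 0 ∧
            (q : ℤ) ^ 2 ∣ pluecker (h * (heckeRep x)⁻¹) 3 ∧
            (q : ℤ) ∣ pluecker (h * (heckeRep x)⁻¹) 2 ∧ (q : ℤ) ^ 2 ∣ pluecker (h * (heckeRep x)⁻¹) 4
            then ψ (pluecker (h * (heckeRep x)⁻¹) 1 : ℤ) else 0)) := by
    intro x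
    rw [← map_inv, ← map_mul, ratExt_mul_delta1 hqm D hψ hpar, hΦx]
  simp_rw [hterm]
  rw [← Finset.mul_sum, Finset.sum_add_distrib, ← Finset.mul_sum, ← Finset.mul_sum]
  -- the values in the first position
  have hS1 : ∑ x : Option (ZMod q) × ZMod (q ^ 2) × ZMod q,
      ψ (pluecker (h * (heckeRep x)⁻¹) 3 : ℤ) = if (q : ℤ) ∣ pluecker h 0 then
        (q : ℂ) ^ 4 * formClass ψ (pluecker h 1 : ℤ) (pluecker h 3 : ℤ)
        else (q : ℂ) ^ 2 * (q + 1) * ∑ x, ψ x := by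
    rw [Fintype.sum_prod_type, Fintype.sum_option]
    simp_rw [Fintype.sum_prod_type, pluecker_mul_heckeRep_inv_none, pluecker_mul_heckeRep_inv_some]
    have hn := sum_char_unip (q := q) (ψ := ψ) (pluecker h 0) (pluecker h 1)
    have hs := fun t : ZMod q => sum_char_unip (q := q) (ψ := ψ) (pluecker h 0)
      (pluecker h 3 - 2 * t.val * pluecker h 2 + (t.val : ℤ) ^ 2 * pluecker h 1)
    simp only [Matrix.cons_val]
    rw [hn]
    simp_rw [hs]
    split_ifs with h0
    · have hi : ((pluecker h 1 : ℤ) : ZMod q) * ((pluecker h 3 : ℤ) : ZMod q)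
          = ((pluecker h 2 : ℤ) : ZMod q) ^ 2 := by
        have := congrArg (Int.cast : ℤ → ZMod q) hiso
        push_cast at this
        rw [(intCast_eq_zero_iff _).2 h0] at this
        linear_combination -this
      rw [← Finset.mul_sum, ← mul_add]
      have := sum_form_values hψ hi
      have hcast : ∀ t : ZMod q, (((pluecker h 3 - 2 * t.val * pluecker h 2
          + (t.val : ℤ) ^ 2 * pluecker h 1 : ℤ)) : ZMod q) = ((pluecker h 3 : ℤ) : ZMod q)
            - 2 * t * ((pluecker h 2 : ℤ) : ZMod q) + t ^ 2 * ((pluecker h 1 : ℤ) : ZMod q) := by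
        intro t
        push_cast
        rw [ZMod.natCast_zmod_val]
      simp_rw [hcast]
      rw [this]; ring
    · rw [Finset.sum_const, Finset.card_univ, ZMod.card, nsmul_eq_mul]
      ring
  have hS2 : ∑ x : Option (ZMod q) × ZMod (q ^ 2) × ZMod q,
      (if (q : ℤ) ^ 2 ∣ pluecker (h * (heckeRep x)⁻¹) 0 ∧
            (q : ℤ) ^ 2 ∣ pluecker (h * (heckeRep x)⁻¹) 3 ∧
            (q : ℤ) ∣ pluecker (h * (heckeRep x)⁻¹) 2 ∧ (q : ℤ) ^ 2 ∣ pluecker (h * (heckeRep x)⁻¹) 4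
            then ψ (pluecker (h * (heckeRep x)⁻¹) 1 : ℤ) else 0)
      = if (q : ℤ) ^ 2 ∣ pluecker h 0 then
        (q : ℂ) * formClass ψ (pluecker h 1 : ℤ) (pluecker h 3 : ℤ) else 0 := by
    rw [Fintype.sum_prod_type, Fintype.sum_option]
    simp_rw [Fintype.sum_prod_type]
    have hn := sum_dvd_unip (q := q) (ψ := ψ) (a := pluecker h 0) (b₁ := pluecker h 3)
      (b₂ := -pluecker h 2) (b₃ := pluecker h 1) (d := pluecker h 4) (by linear_combination hiso)
    have hs := fun t : ZMod q => sum_dvd_unip (q := q) (ψ := ψ) (a := pluecker h 0)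
      (b₁ := pluecker h 1) (b₂ := pluecker h 2 - t.val * pluecker h 1)
      (b₃ := pluecker h 3 - 2 * t.val * pluecker h 2 + (t.val : ℤ) ^ 2 * pluecker h 1)
      (d := pluecker h 4) (by linear_combination hiso)
    refine (congrArg₂ (· + ·)
      (Eq.trans (Finset.sum_congr rfl fun y₁ _ => Finset.sum_congr rfl fun y₂ _ => ?_) hn)
      (Finset.sum_congr rfl fun t _ => Eq.trans (Finset.sum_congr rfl fun y₁ _ =>
        Finset.sum_congr rfl fun y₂ _ => ?_) (hs t))).trans ?_
    · rw [pluecker_mul_heckeRep_inv_none]; rfl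
    · rw [pluecker_mul_heckeRep_inv_some]; rfl
    by_cases h0 : (q : ℤ) ^ 2 ∣ pluecker h 0
    · simp only [if_pos h0]
      have hi : ((pluecker h 1 : ℤ) : ZMod q) * ((pluecker h 3 : ℤ) : ZMod q)
          = ((pluecker h 2 : ℤ) : ZMod q) ^ 2 := by
        have := congrArg (Int.cast : ℤ → ZMod q) hiso
        push_cast at this
        rw [(intCast_eq_zero_iff _).2 (hqq.trans h0)] at this
        linear_combination -this
      rw [← Finset.mul_sum, ← mul_add]
      have := sum_form_zeros (ψ := ψ) hi
      have hcast : ∀ t : ZMod q, (((pluecker h 3 - 2 * t.val * pluecker h 2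
          + (t.val : ℤ) ^ 2 * pluecker h 1 : ℤ)) : ZMod q) = ((pluecker h 3 : ℤ) : ZMod q)
            - 2 * t * ((pluecker h 2 : ℤ) : ZMod q) + t ^ 2 * ((pluecker h 1 : ℤ) : ZMod q) := by
        intro t
        push_cast
        rw [ZMod.natCast_zmod_val]
      simp_rw [hcast]
      rw [this]
    · simp [h0]
  rw [hS1, hS2, deepFactor, prodFactor_rank_one hψ, prodFactor,
    localFactor_rank_two_int (one_pow 2), ← hΦ]
  by_cases h0 : (q : ℤ) ∣ pluecker h 0
  · rw [if_pos h0, if_pos h0, (intCast_eq_zero_iff _).2 h0, MulChar.map_zero]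
    split_ifs <;> ring
  · rw [if_neg h0, if_neg h0, if_neg fun h' => h0 (hqq.trans h'), if_neg fun h' => h0 (hqq.trans h'),
      MulChar.one_apply (isUnit_iff_ne_zero.2 fun h' => h0 ((intCast_eq_zero_iff _).1 h'))]
    ring

end HeckeSum

/-! ### Orbits of congruence subgroups -/

section Orbits

/-- If `M` is idempotent modulo `L`, an integral matrix in the double coset of `γ_M` modulo `L` lies
in the orbit of `Γ_∞ γ_M` under `Γ₀(L)`. -/
theorem exists_orbit {L : ℕ} [NeZero L] {e₁ e₂ : ℤ} (h₁ : (e₁ * e₁ : ZMod L) = e₁)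
    (h₁₂ : (e₁ * e₂ : ZMod L) = e₂) {g : Sp2 ℤ}
    (h : ∃ P Q : Sp2 (ZMod L), P ∈ siegelParabolic _ ∧ Q ∈ siegelParabolic _ ∧
      mapSp (Int.castRingHom (ZMod L)) g = P * lowerUnip (e₁ : ZMod L) (e₂ : ZMod L) * Q) :
    ∃ P ∈ siegelParabolic ℤ, ∃ γ ∈ Gamma0 L, g = P * (lowerUnip e₁ e₂ * γ) := by
  obtain ⟨P, Q, hP, hQ, e⟩ := h
  obtain ⟨P', Q', hP', hQ', hd, e'⟩ := exists_normalized h₁ h₁₂ hP hQ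
  obtain ⟨P₀, hP₀, rfl, -⟩ := exists_lift_parabolic hP' hd
  refine ⟨P₀, hP₀, (lowerUnip e₁ e₂)⁻¹ * P₀⁻¹ * g, ?_, by group⟩
  have hl : mapSp (Int.castRingHom (ZMod L)) (lowerUnip e₁ e₂)
      = lowerUnip (e₁ : ZMod L) (e₂ : ZMod L) := mapSp_lowerUnip _ _ _
  change mapSp (Int.castRingHom (ZMod L)) _ ∈ siegelParabolic (ZMod L)
  rw [map_mul, map_mul, map_inv, map_inv, e, e', hl]
  convert hQ' using 1
  group

theorem exists_double_coset_of_pluecker {R : Type*} [CommRing R] {e₁ e₂ : R} {g Q : Sp2 R}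
    (hQ : Q ∈ siegelParabolic R) (h : pluecker g = pluecker (lowerUnip e₁ e₂ * Q)) :
    ∃ P Q : Sp2 R, P ∈ siegelParabolic R ∧ Q ∈ siegelParabolic R ∧
      g = P * lowerUnip e₁ e₂ * Q := by
  rw [← one_smul R (pluecker (lowerUnip e₁ e₂ * Q))] at h
  exact ⟨_, Q, (mem_parabolic_of_pluecker h).1, hQ, by group⟩

variable {q m : ℕ} {φ : MulChar (ZMod m) ℂ} {ψ : MulChar (ZMod q) ℂ} {e₁ e₂ : ℤ}

theorem exists_orbit_of_prodFactor_ne_zero (hqm : q.Coprime m) [NeZero (q * m)]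
    (h₁ : (e₁ * e₁ : ZMod (q * m)) = e₁) (h₁₂ : (e₁ * e₂ : ZMod (q * m)) = e₂) {g : Sp2 ℤ}
    (h : prodFactor φ e₁ e₂ ψ e₁ e₂ g ≠ 0) :
    ∃ P ∈ siegelParabolic ℤ, ∃ γ ∈ Gamma0 (q * m), g = P * (lowerUnip e₁ e₂ * γ) :=
  exists_orbit h₁ h₁₂ (exists_double_coset_mul hqm
    (exists_of_localFactor_ne_zero (right_ne_zero_of_mul h))
    (exists_of_localFactor_ne_zero (left_ne_zero_of_mul h)))

/-- At `q` the double coset is taken modulo `q²`; the normal forms of rank one are applied over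
`ℤ/q²`, where `pluecker g 0` vanishes and a coordinate prime to `q` is a unit. -/
theorem exists_orbit_of_deepFactor_ne_zero [hq : Fact q.Prime] (hqm : q.Coprime m)
    [NeZero (q * (q * m))] (hψ : ψ ^ 2 = 1)
    (h₁ : (e₁ * e₁ : ZMod (q * (q * m))) = e₁) (h₁₂ : (e₁ * e₂ : ZMod (q * (q * m))) = e₂)
    (hq₁ : (e₁ : ZMod (q ^ 2)) = 1) (hq₂ : (e₂ : ZMod (q ^ 2)) = 0) {g : Sp2 ℤ}
    (h : deepFactor φ e₁ e₂ ψ g ≠ 0) :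
    ∃ P ∈ siegelParabolic ℤ, ∃ γ ∈ Gamma0 (q * (q * m)), g = P * (lowerUnip e₁ e₂ * γ) := by
  rw [deepFactor] at h
  split_ifs at h with h0
  swap
  · exact absurd rfl h
  have hL : q * (q * m) = q ^ 2 * m := by ring
  have hc : ((q ^ 2 : ℕ) : ℤ) = (q : ℤ) ^ 2 := by push_cast; rfl
  refine exists_orbit h₁ h₁₂ ?_
  rw [hL]
  refine exists_double_coset_mul (hqm.pow_left 2) ?_
    (exists_of_localFactor_ne_zero (left_ne_zero_of_mul h))
  rw [hq₁, hq₂]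
  have h' := right_ne_zero_of_mul h
  rw [localFactor_rank_one_int hψ] at h'
  have h0' : pluecker (mapSp (Int.castRingHom (ZMod (q ^ 2))) g) 0 = 0 := by
    rw [pluecker_map, eq_intCast, ZMod.intCast_zmod_eq_zero_iff_dvd, hc]
    exact h0
  have hunit : ∀ i, ((pluecker g i : ℤ) : ZMod q) ≠ 0 →
      IsUnit (pluecker (mapSp (Int.castRingHom (ZMod (q ^ 2))) g) i) := by
    intro i hi
    rw [pluecker_map, eq_intCast, ZMod.coe_int_isUnit_iff_isCoprime, hc]
    refine IsCoprime.pow_left ((Nat.prime_iff_prime_int.1 hq.out).coprime_iff_not_dvd.2 ?_)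
    rwa [← intCast_eq_zero_iff]
  rw [if_pos ((dvd_pow_self _ two_ne_zero).trans h0), formClass] at h'
  split_ifs at h' with h1
  · obtain ⟨Q, hQ, e, -⟩ := exists_rank_one_snd h0' (hunit 3 fun h3 => h' (by
      rw [h3, MulChar.map_zero]))
    exact exists_double_coset_of_pluecker hQ e
  · obtain ⟨Q, hQ, e, -⟩ := exists_rank_one_fst h0' (hunit 1 h1)
    exact exists_double_coset_of_pluecker hQ e

theorem prodFactor_lowerUnip (H : LocalDatum φ (e₁ : ZMod m) (e₂ : ZMod m))
    (H' : LocalDatum ψ (e₁ : ZMod q) (e₂ : ZMod q)) :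
    prodFactor φ e₁ e₂ ψ e₁ e₂ (lowerUnip e₁ e₂) = 1 := by
  have h1 := H.apply (one_mem _) (one_mem _)
  have h2 := H'.apply (one_mem _) (one_mem _)
  rw [one_mul, mul_one, detD_one, map_one, mul_one] at h1 h2
  rw [prodFactor, mapSp_lowerUnip, mapSp_lowerUnip]
  simp only [eq_intCast, h1, h2, mul_one]

end Orbits

section Congruences

theorem intCast_eq_zero_of_squarefree {n : ℕ} (hn : Squarefree n) {z : ℤ}
    (h : ∀ p : ℕ, p.Prime → p ∣ n → (p : ℤ) ∣ z) : (n : ℤ) ∣ z := by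
  rw [Int.natCast_dvd, ← Nat.prod_primeFactors_of_squarefree hn]
  refine Finset.prod_primes_dvd _ (fun p hp => (Nat.prime_of_mem_primeFactors hp).prime) fun p hp => ?_
  rw [← Int.natCast_dvd]
  exact h p (Nat.prime_of_mem_primeFactors hp) (Nat.dvd_of_mem_primeFactors hp)

variable {N₀ N₁ N₂ : ℕ} {d d' : Fin 2 → ℤ}

theorem Represents.cases (h : Represents N₀ N₁ N₂ d) {p : ℕ} (hp : p.Prime)
    (hdvd : p ∣ N₀ * N₁ * N₂) : ((d 0 : ZMod p) = 0 ∧ (d 1 : ZMod p) = 0) ∨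
      ((d 0 : ZMod p) = 1 ∧ (d 1 : ZMod p) = 0) ∨ ((d 0 : ZMod p) = 1 ∧ (d 1 : ZMod p) = 1) := by
  have key : ∀ x y : ℤ, x ≡ y [ZMOD p] → (x : ZMod p) = (y : ZMod p) := fun x y h =>
    (ZMod.intCast_eq_intCast_iff _ _ _).2 h
  rcases hp.dvd_mul.1 hdvd with h' | h'
  · rcases hp.dvd_mul.1 h' with h' | h'
    · left; exact_mod_cast (h.rank_zero p hp h').imp (key _ _) (key _ _)
    · right; left; exact_mod_cast (h.rank_one p hp h').imp (key _ _) (key _ _)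
  · right; right; exact_mod_cast (h.rank_two p hp h').imp (key _ _) (key _ _)

theorem Represents.idempotent (h : Represents N₀ N₁ N₂ d) (hsq : Squarefree (N₀ * N₁ * N₂)) :
    (d 0 * d 0 : ZMod (N₀ * N₁ * N₂)) = d 0 ∧ (d 1 * d 1 : ZMod (N₀ * N₁ * N₂)) = d 1 ∧
      (d 0 * d 1 : ZMod (N₀ * N₁ * N₂)) = d 1 := by
  have key : ∀ x y : ℤ, (∀ p : ℕ, p.Prime → p ∣ N₀ * N₁ * N₂ → (x : ZMod p) = y) →
      (x : ZMod (N₀ * N₁ * N₂)) = y := by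
    intro x y hxy
    rw [← sub_eq_zero, ← Int.cast_sub, ZMod.intCast_zmod_eq_zero_iff_dvd]
    refine intCast_eq_zero_of_squarefree hsq fun p hp hpn => ?_
    rw [← ZMod.intCast_zmod_eq_zero_iff_dvd, Int.cast_sub, sub_eq_zero, hxy p hp hpn]
  have h0 := key (d 0 * d 0) (d 0) fun p hp hpn => by
    rcases h.cases hp hpn with h | h | h <;> simp [h.1]
  have h1 := key (d 1 * d 1) (d 1) fun p hp hpn => by
    rcases h.cases hp hpn with h | h | h <;> simp [h.2]
  have h2 := key (d 0 * d 1) (d 1) fun p hp hpn => by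
    rcases h.cases hp hpn with h | h | h <;> simp [h.1, h.2]
  push_cast at h0 h1 h2
  exact ⟨h0, h1, h2⟩

/-- Two matrices representing the same partition are congruent. -/
theorem Represents.congr (h : Represents N₀ N₁ N₂ d) (h' : Represents N₀ N₁ N₂ d')
    (hsq : Squarefree (N₀ * N₁ * N₂)) (i : Fin 2) :
    (d i : ZMod (N₀ * N₁ * N₂)) = d' i := by
  rw [← sub_eq_zero, ← Int.cast_sub, ZMod.intCast_zmod_eq_zero_iff_dvd]
  refine intCast_eq_zero_of_squarefree hsq fun p hp hpn => ?_
  have key : ∀ {x y z : ℤ}, x ≡ z [ZMOD p] → y ≡ z [ZMOD p] → (p : ℤ) ∣ x - y := fun hx hy =>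
    (hy.trans hx.symm).dvd
  rcases hp.dvd_mul.1 hpn with hd | hd
  · rcases hp.dvd_mul.1 hd with hd | hd
    · have h1 := h.rank_zero p hp hd
      have h2 := h'.rank_zero p hp hd
      fin_cases i
      exacts [key h1.1 h2.1, key h1.2 h2.2]
    · have h1 := h.rank_one p hp hd
      have h2 := h'.rank_one p hp hd
      fin_cases i
      exacts [key h1.1 h2.1, key h1.2 h2.2]
  · have h1 := h.rank_two p hp hd
    have h2 := h'.rank_two p hp hd
    fin_cases i
    exacts [key h1.1 h2.1, key h1.2 h2.2]

theorem Represents.of_mul_rank_one {q : ℕ} (h : Represents N₀ (q * N₁) N₂ d) :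
    Represents N₀ N₁ N₂ d :=
  ⟨h.rank_zero, fun p hp hd => h.rank_one p hp (hd.mul_left q), h.rank_two⟩

theorem Represents.of_mul_rank_two {q : ℕ} (h : Represents N₀ N₁ (q * N₂) d) :
    Represents N₀ N₁ N₂ d :=
  ⟨h.rank_zero, h.rank_one, fun p hp hd => h.rank_two p hp (hd.mul_left q)⟩

theorem LocalDatum.of_represents {φ : MulChar (ZMod (N₀ * N₁ * N₂)) ℂ} (hφ : φ ^ 2 = 1)
    (h : Represents N₀ N₁ N₂ d) (hsq : Squarefree (N₀ * N₁ * N₂)) :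
    LocalDatum φ (d 0 : ZMod (N₀ * N₁ * N₂)) (d 1 : ZMod (N₀ * N₁ * N₂)) :=
  ⟨hφ, (h.idempotent hsq).1, (h.idempotent hsq).2.1, (h.idempotent hsq).2.2⟩

end Congruences

/-! ### Series over rational cosets -/

section AutomorphyFactor

/-- The automorphy factor `det(Cτ + D)`. -/
noncomputable def autoFactor (g : Sp2 ℚ) (τ : Matrix (Fin 2) (Fin 2) ℂ) : ℂ :=
  (((g : Mat4 ℚ).map (fun x : ℚ => (x : ℂ))).toBlocks₂₁ * τ
    + ((g : Mat4 ℚ).map (fun x : ℚ => (x : ℂ))).toBlocks₂₂).det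

/-- The action `(Aτ + B)(Cτ + D)⁻¹` by fractional linear transformations. -/
noncomputable def moebius (g : Sp2 ℚ) (τ : Matrix (Fin 2) (Fin 2) ℂ) : Matrix (Fin 2) (Fin 2) ℂ :=
  (((g : Mat4 ℚ).map (fun x : ℚ => (x : ℂ))).toBlocks₁₁ * τ
    + ((g : Mat4 ℚ).map (fun x : ℚ => (x : ℂ))).toBlocks₁₂) *
  (((g : Mat4 ℚ).map (fun x : ℚ => (x : ℂ))).toBlocks₂₁ * τ
    + ((g : Mat4 ℚ).map (fun x : ℚ => (x : ℂ))).toBlocks₂₂)⁻¹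

theorem slash_eq (k : ℕ) (f : Matrix (Fin 2) (Fin 2) ℂ → ℂ) (g : Sp2 ℚ)
    (τ : Matrix (Fin 2) (Fin 2) ℂ) :
    slash k f g τ = (autoFactor g τ ^ k)⁻¹ * f (moebius g τ) := rfl

theorem autoFactor_mul (g : Sp2 ℚ) {y : Sp2 ℚ} {τ : Matrix (Fin 2) (Fin 2) ℂ}
    (h : autoFactor y τ ≠ 0) :
    autoFactor (g * y) τ = autoFactor g (moebius y τ) * autoFactor y τ := by
  rw [autoFactor, autoFactor, autoFactor, ← det_mul]
  rw [autoFactor] at h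
  have e₁ : (((g * y : Sp2 ℚ) : Mat4 ℚ).map (fun x : ℚ => (x : ℂ))).toBlocks₂₁
      = ((g : Mat4 ℚ).map (fun x : ℚ => (x : ℂ))).toBlocks₂₁
          * ((y : Mat4 ℚ).map (fun x : ℚ => (x : ℂ))).toBlocks₁₁
        + ((g : Mat4 ℚ).map (fun x : ℚ => (x : ℂ))).toBlocks₂₂
          * ((y : Mat4 ℚ).map (fun x : ℚ => (x : ℂ))).toBlocks₂₁ := by
    ext i j
    simp [toBlocks₂₁, toBlocks₁₁, toBlocks₂₂, mul_apply]
  have e₂ : (((g * y : Sp2 ℚ) : Mat4 ℚ).map (fun x : ℚ => (x : ℂ))).toBlocks₂₂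
      = ((g : Mat4 ℚ).map (fun x : ℚ => (x : ℂ))).toBlocks₂₁
          * ((y : Mat4 ℚ).map (fun x : ℚ => (x : ℂ))).toBlocks₁₂
        + ((g : Mat4 ℚ).map (fun x : ℚ => (x : ℂ))).toBlocks₂₂
          * ((y : Mat4 ℚ).map (fun x : ℚ => (x : ℂ))).toBlocks₂₂ := by
    ext i j
    simp [toBlocks₂₁, toBlocks₁₂, toBlocks₂₂, mul_apply]
  have key : ∀ C D M X : Matrix (Fin 2) (Fin 2) ℂ, X.det ≠ 0 →
      (C * (M * X⁻¹) + D) * X = C * M + D * X := by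
    intro C D M X hX
    rw [Matrix.add_mul, Matrix.mul_assoc, Matrix.mul_assoc, nonsing_inv_mul _ hX.isUnit,
      Matrix.mul_one]
  rw [e₁, e₂, moebius, key _ _ _ _ h]
  congr 1
  noncomm_ring

/-- The automorphy factor as a linear form in the Plücker vector. -/
theorem autoFactor_eq (g : Sp2 ℚ) {τ : Matrix (Fin 2) (Fin 2) ℂ} (hτ : τ.IsSymm) :
    autoFactor g τ = (pluecker g 0 : ℚ) * τ.det + (pluecker g 1 : ℚ) * τ 0 0
      + 2 * (pluecker g 2 : ℚ) * τ 0 1 + (pluecker g 3 : ℚ) * τ 1 1 + (pluecker g 4 : ℚ) := by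
  have hs : τ 1 0 = τ 0 1 := hτ.apply 0 1
  have h := congrArg (fun x : ℚ => (x : ℂ)) (symm_CD g)
  simp only [Rat.cast_add, Rat.cast_mul] at h
  simp only [autoFactor, det_fin_two, pluecker, detD, Matrix.add_apply, mul_apply, Fin.sum_univ_two, hs,
    toBlocks₂₁, toBlocks₂₂, of_apply, map_apply, Matrix.cons_val, entC, entD, Rat.cast_sub,
    Rat.cast_mul] at h ⊢
  linear_combination (-τ 0 1) * h

theorem autoFactor_mul_left {p : Sp2 ℚ} (hp : p ∈ siegelParabolic ℚ) (g : Sp2 ℚ)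
    (τ : Matrix (Fin 2) (Fin 2) ℂ) :
    autoFactor (p * g) τ = ((detD p : ℚ) : ℂ) * autoFactor g τ := by
  have hp' := mem_parabolic.1 hp
  simp only [entC] at hp'
  simp only [autoFactor, det_fin_two, detD, Matrix.add_apply, mul_apply, Fin.sum_univ_two,
    toBlocks₂₁, toBlocks₂₂, of_apply, map_apply, entD, Rat.cast_add,
    Rat.cast_sub, Rat.cast_mul, Submonoid.coe_mul, Fintype.sum_sum_type, hp', zero_mul, zero_add]
  ring

end AutomorphyFactor

section Series

/-- The right cosets of the Siegel parabolic subgroup in `Sp₂(ℚ)`. -/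
abbrev RatCosets : Type := Quotient (QuotientGroup.rightRel (siegelParabolic ℚ))

/-- The class of an element of `Sp₂(ℚ)` modulo the Siegel parabolic subgroup. -/
def ratCoset (g : Sp2 ℚ) : RatCosets := Quotient.mk _ g

theorem ratCoset_eq {g h : Sp2 ℚ} : ratCoset g = ratCoset h ↔ h * g⁻¹ ∈ siegelParabolic ℚ := by
  rw [ratCoset, ratCoset, Quotient.eq, QuotientGroup.rightRel_apply]

theorem ratCoset_mul_left {p : Sp2 ℚ} (hp : p ∈ siegelParabolic ℚ) (g : Sp2 ℚ) :
    ratCoset (p * g) = ratCoset g := by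
  rw [ratCoset_eq]
  have : g * (p * g)⁻¹ = p⁻¹ := by group
  rw [this]; exact inv_mem hp

theorem exists_ratCoset_toQ (x : RatCosets) : ∃ h : Sp2 ℤ, ratCoset (toQ h) = x := by
  induction x using Quotient.inductionOn with
  | h g =>
    obtain ⟨p, hp, h, rfl, -⟩ := exists_iwasawa g
    exact ⟨h, (ratCoset_mul_left hp _).symm⟩

/-- Functions on `Sp₂(ℚ)` that transform under the Siegel parabolic subgroup by the `k`-th power of
`det D`. -/
def IsRatEquivariant (k : ℕ) (f : Sp2 ℚ → ℂ) : Prop :=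
  ∀ p ∈ siegelParabolic ℚ, ∀ g, f (p * g) = ((detD p : ℚ) : ℂ) ^ k * f g

/-- The term `f(g) det(Cτ + D)^{-k}` of the series attached to an equivariant function. It does not
depend on the representative `g`. -/
noncomputable def seriesTerm (k : ℕ) (f : Sp2 ℚ → ℂ) (τ : Matrix (Fin 2) (Fin 2) ℂ)
    (x : RatCosets) : ℂ := f x.out * (autoFactor x.out τ ^ k)⁻¹

variable {k : ℕ} {f : Sp2 ℚ → ℂ} {τ : Matrix (Fin 2) (Fin 2) ℂ}

theorem IsRatEquivariant.mul_right (hf : IsRatEquivariant k f) (y : Sp2 ℚ) :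
    IsRatEquivariant k fun g => f (g * y) := fun p hp g => by
  dsimp only
  rw [mul_assoc, hf p hp]

theorem IsEquivariant.isRatEquivariant {F : Sp2 ℤ → ℂ} (hF : IsEquivariant k F) :
    IsRatEquivariant k (ratExt k F) := fun _ hp g => hF.ratExt_mul_left hp g

theorem seriesTerm_ratCoset (hf : IsRatEquivariant k f) (g : Sp2 ℚ) :
    seriesTerm k f τ (ratCoset g) = f g * (autoFactor g τ ^ k)⁻¹ := by
  have h : g * ((ratCoset g).out)⁻¹ ∈ siegelParabolic ℚ := ratCoset_eq.1 (Quotient.out_eq _)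
  have hg : g = g * ((ratCoset g).out)⁻¹ * (ratCoset g).out := by group
  have h0 : ((detD (g * ((ratCoset g).out)⁻¹) : ℚ) : ℂ) ≠ 0 :=
    Rat.cast_ne_zero.2 (isUnit_detD h).ne_zero
  rw [seriesTerm]
  conv_rhs => rw [hg, hf _ h, autoFactor_mul_left h, mul_pow, mul_inv]
  field_simp

/-- The action of `y` on the series: translation of the coefficient function. -/
theorem tsum_seriesTerm_moebius (hf : IsRatEquivariant k f) {y : Sp2 ℚ} (hy : autoFactor y τ ≠ 0) :
    (autoFactor y τ ^ k)⁻¹ * ∑' x, seriesTerm k f (moebius y τ) x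
      = ∑' x, seriesTerm k (fun g => f (g * y⁻¹)) τ x := by
  let e : RatCosets ≃ RatCosets := Quotient.congr (Equiv.mulRight y) fun a b => by
    change (QuotientGroup.rightRel (siegelParabolic ℚ)) a b ↔
      (QuotientGroup.rightRel (siegelParabolic ℚ)) (a * y) (b * y)
    rw [QuotientGroup.rightRel_apply, QuotientGroup.rightRel_apply]
    have : b * y * (a * y)⁻¹ = b * a⁻¹ := by group
    rw [this]
  rw [← tsum_mul_left]
  refine (tsum_congr fun x => ?_).trans (e.tsum_eq _)
  induction x using Quotient.inductionOn with
  | h g =>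
    have h1 : e (Quotient.mk _ g) = ratCoset (g * y) := rfl
    rw [h1, seriesTerm_ratCoset (hf.mul_right _)]
    have h2 := seriesTerm_ratCoset (τ := moebius y τ) hf g
    rw [ratCoset] at h2
    rw [h2, mul_inv_cancel_right, autoFactor_mul g hy, mul_pow, mul_inv]
    ring

end Series

section EisensteinSeries

variable {N L k : ℕ} {χ : DirichletCharacter ℂ N} {γ₀ : Sp2 ℤ} {F : Sp2 ℤ → ℂ}
  {τ : Matrix (Fin 2) (Fin 2) ℂ}

/-- The coset in `Sp₂(ℚ)` of a member of the orbit. -/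
noncomputable def indexCoset (L : ℕ) (γ₀ : Sp2 ℤ) (c : EisensteinIndex L γ₀) : RatCosets :=
  ratCoset (toQ (γ₀ * (c.out : Sp2 ℤ)))

theorem mem_orbitStabilizer {γ : Gamma0 L} :
    γ ∈ orbitStabilizer L γ₀ ↔ γ₀ * (γ : Sp2 ℤ) * γ₀⁻¹ ∈ siegelParabolic ℤ := Iff.rfl

theorem indexCoset_injective : Function.Injective (indexCoset L γ₀) := by
  intro c c' h
  rw [indexCoset, indexCoset, ratCoset_eq, ← map_inv, ← map_mul] at h
  rw [← c.out_eq, ← c'.out_eq, Quotient.eq, QuotientGroup.rightRel_apply, mem_orbitStabilizer]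
  convert mem_parabolic_of_toQ h using 1
  push_cast
  group

theorem indexCoset_mk (γ : Gamma0 L) :
    indexCoset L γ₀ (Quotient.mk _ γ) = ratCoset (toQ (γ₀ * (γ : Sp2 ℤ))) := by
  have h : Quotient.mk (QuotientGroup.rightRel (orbitStabilizer L γ₀))
      (Quotient.mk (QuotientGroup.rightRel (orbitStabilizer L γ₀)) γ).out = Quotient.mk _ γ :=
    Quotient.out_eq _
  rw [Quotient.eq, QuotientGroup.rightRel_apply, mem_orbitStabilizer] at h
  rw [indexCoset, ratCoset_eq, ← map_inv, ← map_mul]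
  have := mapSp_mem_parabolic (Int.castRingHom ℚ) h
  convert this using 2
  push_cast
  group

theorem eisensteinTerm_eq (hF : IsEquivariant k F)
    (hval : ∀ γ ∈ Gamma0 L, F (γ₀ * γ) = charDetD χ γ) :
    eisensteinTerm k χ L γ₀ τ = seriesTerm k (ratExt k F) τ ∘ indexCoset L γ₀ := by
  funext c
  rw [Function.comp_apply, indexCoset, seriesTerm_ratCoset hF.isRatEquivariant, hF.ratExt_toQ,
    hval _ c.out.2, eisensteinTerm, slash_eq, mul_one]

/-- The Eisenstein series as a sum over all cosets of the Siegel parabolic subgroup of `Sp₂(ℚ)`. -/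
theorem eisenstein_eq (hF : IsEquivariant k F)
    (hval : ∀ γ ∈ Gamma0 L, F (γ₀ * γ) = charDetD χ γ)
    (hsupp : ∀ g, F g ≠ 0 → ∃ P ∈ siegelParabolic ℤ, ∃ γ ∈ Gamma0 L, g = P * (γ₀ * γ)) :
    eisenstein k χ L γ₀ τ = ∑' x, seriesTerm k (ratExt k F) τ x := by
  rw [eisenstein, eisensteinTerm_eq hF hval]
  refine indexCoset_injective.tsum_eq fun x hx => ?_
  obtain ⟨h, rfl⟩ := exists_ratCoset_toQ x
  rw [Function.mem_support, seriesTerm_ratCoset hF.isRatEquivariant, hF.ratExt_toQ] at hx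
  obtain ⟨P, hP, γ, hγ, rfl⟩ := hsupp h (left_ne_zero_of_mul hx)
  refine ⟨Quotient.mk _ ⟨γ, hγ⟩, ?_⟩
  rw [indexCoset_mk, map_mul toQ P, ratCoset_mul_left (mapSp_mem_parabolic _ hP)]

end EisensteinSeries

section HeckeOperator

variable {N L k q : ℕ} [hq : Fact q.Prime] {χ : DirichletCharacter ℂ N} {F : Sp2 ℤ → ℂ}
  {τ : Matrix (Fin 2) (Fin 2) ℂ}

theorem charDetD_eq (γ : Sp2 ℤ) : charDetD χ γ = (starRingEnd ℂ) (χ ((detD γ : ℤ) : ZMod N)) := by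
  rw [charDetD, det_toBlocks]

theorem charDetD_mul (hN : N ∣ L) {γ γ' : Sp2 ℤ} (h : γ ∈ Gamma0 L) :
    charDetD χ (γ * γ') = charDetD χ γ * charDetD χ γ' := by
  have e := detD_mul (mapSp (Int.castRingHom (ZMod N)) γ') (mapSp_mem_of_dvd hN h)
  rw [← map_mul, detD_map, detD_map, detD_map] at e
  simp only [eq_intCast] at e
  rw [charDetD_eq, e, map_mul, map_mul, charDetD_eq, charDetD_eq]

theorem charDetD_one : charDetD χ (1 : Sp2 ℤ) = 1 := by
  rw [charDetD_eq, detD_one]; simp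

theorem slash_series_eq {E : Matrix (Fin 2) (Fin 2) ℂ → ℂ} (hF : IsEquivariant k F)
    (hE : ∀ τ', E τ' = ∑' x, seriesTerm k (ratExt k F) τ' x)
    (hτ : ∀ y, autoFactor y τ ≠ 0) (γ : Sp2 ℤ) :
    slash k E ((delta1 q)⁻¹ * toQ γ) τ
      = ∑' x, seriesTerm k (fun g => ratExt k F (g * (toQ γ)⁻¹ * delta1 q)) τ x := by
  rw [slash_eq, hE, tsum_seriesTerm_moebius hF.isRatEquivariant (hτ _)]
  refine tsum_congr fun x => ?_
  congr 1
  funext g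
  congr 1
  group

/-- The Hecke operator on the series attached to an equivariant function, as a sum over the explicit
representatives. -/
theorem heckeT1_series {E : Matrix (Fin 2) (Fin 2) ℂ → ℂ} (hqL : q ∣ L) (hN : N ∣ L)
    (hF : IsEquivariant k F) (hχ : ∀ γ ∈ Gamma0 L, ∀ g, F (g * γ) = charDetD χ γ * F g)
    (hE : ∀ τ', E τ' = ∑' x, seriesTerm k (ratExt k F) τ' x)
    (hτ : ∀ y, autoFactor y τ ≠ 0) :
    heckeT1 q k χ L E τ = (q : ℂ) ^ ((k : ℤ) - 3)
      * ∑ x : Option (ZMod q) × ZMod (q ^ 2) × ZMod q, ∑' y, seriesTerm k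
          (fun g => ratExt k F (g * (toQ (heckeRep x))⁻¹ * delta1 q)) τ y := by
  have hG : ∀ σ γ : Gamma0 L, σ ∈ heckeSubgroup q L →
      charDetD χ (σ * γ : Sp2 ℤ) * slash k E ((delta1 q)⁻¹ * toQ (σ * γ : Sp2 ℤ)) τ
        = charDetD χ (γ : Sp2 ℤ) * slash k E ((delta1 q)⁻¹ * toQ (γ : Sp2 ℤ)) τ := by
    intro σ γ hσ
    obtain ⟨x, hx, e⟩ := mem_heckeSubgroup_iff.1 hσ
    rw [slash_series_eq hF hE hτ, slash_series_eq hF hE hτ, ← tsum_mul_left, ← tsum_mul_left]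
    refine tsum_congr fun y => ?_
    have hx' : charDetD χ (σ : Sp2 ℤ) * charDetD χ x⁻¹ = 1 := by
      have hd : charDetD χ (σ : Sp2 ℤ) = charDetD χ x := by
        rw [charDetD_eq, charDetD_eq, detD_of_mul_delta1 e]
      rw [hd, ← charDetD_mul hN hx, mul_inv_cancel, charDetD_one]
    have hfun : ∀ g, ratExt k F (g * (toQ (σ * γ : Sp2 ℤ))⁻¹ * delta1 q)
        = charDetD χ x⁻¹ * ratExt k F (g * (toQ (γ : Sp2 ℤ))⁻¹ * delta1 q) := by
      intro g
      have e' : g * (toQ (σ * γ : Sp2 ℤ))⁻¹ * delta1 q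
          = g * (toQ (γ : Sp2 ℤ))⁻¹ * delta1 q * toQ x⁻¹ := by
        have : (toQ (σ : Sp2 ℤ))⁻¹ * delta1 q = delta1 q * (toQ x)⁻¹ := by
          rw [inv_mul_eq_iff_eq_mul, ← mul_assoc, e, mul_inv_cancel_right]
        rw [map_mul, map_inv, _root_.mul_inv_rev, mul_assoc, mul_assoc, this]
        simp only [mul_assoc]
      rw [e', hF.ratExt_mul_right (hχ _ (inv_mem hx))]
    rw [seriesTerm, seriesTerm, hfun, charDetD_mul hN σ.2]
    linear_combination charDetD χ (γ : Sp2 ℤ) * ratExt k F (y.out * (toQ (γ : Sp2 ℤ))⁻¹ * delta1 q)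
      * (autoFactor y.out τ ^ k)⁻¹ * hx'
  rw [heckeT1]
  congr 1
  rw [← finsum_eq_of_bijective _ (bijective_heckeRep hqL) fun x => rfl, finsum_eq_sum_of_fintype]
  refine Finset.sum_congr rfl fun x _ => ?_
  set γ : Gamma0 L := ⟨heckeRep x, parabolic_le_Gamma0 (heckeRep_mem_parabolic x)⟩
  set c : HeckeCosets q L := Quotient.mk _ γ
  have hc : γ * c.out⁻¹ ∈ heckeSubgroup q L := by
    have : Quotient.mk (QuotientGroup.rightRel (heckeSubgroup q L)) c.out = Quotient.mk _ γ :=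
      Quotient.out_eq _
    rwa [Quotient.eq, QuotientGroup.rightRel_apply] at this
  have := hG _ c.out hc
  rw [← Subgroup.coe_mul, inv_mul_cancel_right] at this
  rw [← this]
  have h1 : charDetD χ (γ : Sp2 ℤ) = 1 := by
    rw [charDetD_eq]
    change (starRingEnd ℂ) (χ ((detD (heckeRep x) : ℤ) : ZMod N)) = 1
    rw [detD_heckeRep]; simp
  rw [h1, one_mul, slash_series_eq hF hE hτ]

end HeckeOperator

/-! ### Lattice sums over isotropic vectors -/

section DivisorBound

theorem succ_cube_le (f : ℕ) : (f + 1) ^ 3 ≤ 8 * 2 ^ f := by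
  have h : ∀ j, (j + 4 + 1) ^ 3 ≤ 8 * 2 ^ (j + 4) := by
    intro j
    induction j with
    | zero => norm_num
    | succ j ih =>
      rw [show j + 1 + 4 = j + 4 + 1 by ring, pow_succ 2]
      have h2 : (j + 4 + 1 + 1) ^ 3 ≤ 2 * (j + 4 + 1) ^ 3 := by
        ring_nf
        linarith [Nat.zero_le (j ^ 3), Nat.zero_le (j ^ 2)]
      linarith
  rcases lt_or_ge f 4 with hf | hf
  · interval_cases f <;> norm_num
  · obtain ⟨j, rfl⟩ := Nat.exists_eq_add_of_le hf
    rw [add_comm 4 j]; exact h j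

/-- A form of the divisor bound: the number of divisors of `n` is `O(n^{1/3})`. -/
theorem card_divisors_cube_le {n : ℕ} (hn : n ≠ 0) : n.divisors.card ^ 3 ≤ 8 ^ 8 * n := by
  have hp : ∀ p ∈ n.primeFactors, (n.factorization p + 1) ^ 3
      ≤ (if p < 8 then 8 else 1) * p ^ n.factorization p := by
    intro p hp
    split_ifs with h
    · exact (succ_cube_le _).trans (Nat.mul_le_mul_left _
        (Nat.pow_le_pow_left (Nat.prime_of_mem_primeFactors hp).two_le _))
    · have h2 : n.factorization p + 1 ≤ 2 ^ n.factorization p := Nat.lt_two_pow_self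
      calc (n.factorization p + 1) ^ 3 ≤ (2 ^ n.factorization p) ^ 3 := Nat.pow_le_pow_left h2 3
        _ = 8 ^ n.factorization p := by rw [← pow_mul, mul_comm, pow_mul]; norm_num
        _ ≤ p ^ n.factorization p := Nat.pow_le_pow_left (not_lt.1 h) _
        _ = _ := (one_mul _).symm
  have hsmall : ∏ p ∈ n.primeFactors, (if p < 8 then 8 else 1) ≤ 8 ^ 8 := by
    rw [← Finset.prod_filter, Finset.prod_const]
    refine Nat.pow_le_pow_right (by norm_num) ?_
    calc _ ≤ (Finset.range 8).card := Finset.card_le_card fun p hp => by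
          simpa using (Finset.mem_filter.1 hp).2
      _ = 8 := Finset.card_range 8
  calc n.divisors.card ^ 3 = ∏ p ∈ n.primeFactors, (n.factorization p + 1) ^ 3 := by
        rw [Nat.card_divisors hn, Finset.prod_pow]
    _ ≤ ∏ p ∈ n.primeFactors, (if p < 8 then 8 else 1) * p ^ n.factorization p :=
        Finset.prod_le_prod' hp
    _ = (∏ p ∈ n.primeFactors, (if p < 8 then 8 else 1))
          * ∏ p ∈ n.primeFactors, p ^ n.factorization p := Finset.prod_mul_distrib
    _ ≤ 8 ^ 8 * n := Nat.mul_le_mul hsmall (Nat.prod_factorization_pow_eq_self hn).le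

end DivisorBound

section LatticeSums

open Module in
/-- Convergence of the sum of `‖w‖ ^ r` over `ℤⁿ` for `r < -n`, the term at `w = 0` being `0 ^ r`. -/
theorem summable_norm_rpow_int {ι : Type*} [Fintype ι] {r : ℝ} (hr : r < -Fintype.card ι) :
    Summable fun w : ι → ℤ => ‖w‖ ^ r := by
  classical
  let b := Pi.basisFun ℝ ι
  let L := Submodule.span ℤ (Set.range b)
  have hL : finrank ℤ L = Fintype.card ι := by
    rw [ZLattice.rank ℝ L, finrank_fintype_fun_eq_card]
  have hs := ZLattice.summable_norm_rpow L r (by rwa [hL])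
  have hmem : ∀ w : ι → ℤ, (fun i => (w i : ℝ)) ∈ L := by
    intro w
    have : (fun i => (w i : ℝ)) = ∑ i, w i • b i := by
      ext j
      simp [b, Pi.single_apply]
    rw [this]
    exact Submodule.sum_mem _ fun i _ => Submodule.smul_mem _ _ (Submodule.subset_span ⟨i, rfl⟩)
  let f : (ι → ℤ) → L := fun w => ⟨_, hmem w⟩
  have hf : Function.Injective f := by
    intro w w' h
    funext i
    have : (w i : ℝ) = w' i := congrFun (congrArg Subtype.val h) i
    exact_mod_cast this
  have hn : ∀ w, ‖f w‖ = ‖w‖ := by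
    intro w
    change ‖fun i => (w i : ℝ)‖ = ‖w‖
    simp only [Pi.norm_def]
    rfl
  simpa only [Function.comp_def, hn] using hs.comp_injective hf

theorem norm_comp_le {ι κ : Type*} [Fintype ι] [Fintype κ] (w : ι → ℤ) (e : κ → ι) :
    ‖w ∘ e‖ ≤ ‖w‖ :=
  (pi_norm_le_iff_of_nonneg (norm_nonneg w)).2 fun i => norm_le_pi_norm w (e i)

/-- The sum of `‖w‖⁻⁴` over a set of integral vectors which are determined by three of their
coordinates. -/
theorem summable_indicator_of_coords {S : Set (Fin 5 → ℤ)} (e : Fin 3 → Fin 5)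
    (hinj : ∀ w ∈ S, ∀ w' ∈ S, w ∘ e = w' ∘ e → w = w') (hne : ∀ w ∈ S, w ∘ e ≠ 0) :
    Summable (S.indicator fun w => ‖w‖ ^ (-4 : ℝ)) := by
  rw [← summable_subtype_iff_indicator]
  have h3 := summable_norm_rpow_int (ι := Fin 3) (r := -4) (by simp; norm_num)
  have h3' := h3.comp_injective (i := fun w : S => (w : Fin 5 → ℤ) ∘ e)
    fun w w' h => Subtype.ext (hinj w w.2 w' w'.2 h)
  refine Summable.of_nonneg_of_le (fun w => Real.rpow_nonneg (norm_nonneg _) _) (fun w => ?_) h3'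
  exact Real.rpow_le_rpow_of_nonpos (norm_pos_iff.2 (hne w w.2)) (norm_comp_le _ _) (by norm_num)

/-- The determinant `b₀ b₂ - b₁²` of the binary quadratic form `b₀ x² + 2 b₁ x y + b₂ y²`. -/
def formDet (b : Fin 3 → ℤ) : ℤ := b 0 * b 2 - b 1 ^ 2

/-- The divisor bound for the determinant, which is quadratic in `b`. Divisors of either sign count,
and none if the determinant is zero. -/
theorem card_divisors_formDet_le {b : Fin 3 → ℤ} (hb : formDet b ≠ 0) :
    ((formDet b).divisors.card : ℝ) ≤ 2048 * ‖b‖ ^ (2 / 3 : ℝ) := by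
  have h1 : (formDet b).divisors.card = 2 * (formDet b).natAbs.divisors.card := by
    rw [Int.divisors, Finset.card_disjUnion, Finset.card_map, Finset.card_map, two_mul]
  have h2 := card_divisors_cube_le (Int.natAbs_ne_zero.2 hb)
  have h3 : ((formDet b).natAbs : ℝ) ≤ 2 * ‖b‖ ^ 2 := by
    rw [Nat.cast_natAbs, Int.cast_abs]
    have k : ∀ i, |(b i : ℝ)| ≤ ‖b‖ := fun i => norm_le_pi_norm b i
    have k0 : |(b 0 : ℝ) * b 2| ≤ ‖b‖ * ‖b‖ := by
      rw [abs_mul]; exact mul_le_mul (k 0) (k 2) (abs_nonneg _) (norm_nonneg _)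
    have k1 : |(b 1 : ℝ) ^ 2| ≤ ‖b‖ * ‖b‖ := by
      rw [abs_pow, sq]; exact mul_le_mul (k 1) (k 1) (abs_nonneg _) (norm_nonneg _)
    have := abs_sub ((b 0 : ℝ) * b 2) ((b 1 : ℝ) ^ 2)
    have e : ((formDet b : ℤ) : ℝ) = (b 0 : ℝ) * b 2 - (b 1 : ℝ) ^ 2 := by
      simp [formDet]
    rw [e]
    linarith [abs_sub ((b 0 : ℝ) * b 2) ((b 1 : ℝ) ^ 2)]
  have h4 : (((formDet b).natAbs.divisors.card : ℕ) : ℝ) ^ 3 ≤ (1024 * ‖b‖ ^ (2 / 3 : ℝ)) ^ 3 := by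
    have h2' : (((formDet b).natAbs.divisors.card : ℕ) : ℝ) ^ 3
        ≤ 8 ^ 8 * ((formDet b).natAbs : ℝ) := by exact_mod_cast h2
    have e : (‖b‖ ^ (2 / 3 : ℝ)) ^ 3 = ‖b‖ ^ 2 := by
      rw [← Real.rpow_natCast, ← Real.rpow_mul (norm_nonneg b)]
      norm_num
    rw [mul_pow, e]
    nlinarith [sq_nonneg ‖b‖]
  have h5 := le_of_pow_le_pow_left₀ (by norm_num) (by positivity) h4
  rw [h1]; push_cast; linarith

/-- The vectors in which both outer coordinates are nonzero: these are determined by the inner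
coordinates and a divisor of their determinant. -/
theorem summable_pairs : Summable fun x : (Fin 3 → ℤ) × ℤ =>
    if x.2 ∈ (formDet x.1).divisors then ‖x.1‖ ^ (-4 : ℝ) else 0 := by
  refine (summable_prod_of_nonneg fun x => by dsimp only; split_ifs <;> positivity).2 ⟨fun b => ?_, ?_⟩
  · exact summable_of_ne_finset_zero (s := (formDet b).divisors) fun a ha => if_neg ha
  · have hsum : ∀ b : Fin 3 → ℤ, (∑' a, if a ∈ (formDet b).divisors then ‖b‖ ^ (-4 : ℝ) else 0)
        = (formDet b).divisors.card * ‖b‖ ^ (-4 : ℝ) := by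
      intro b
      rw [tsum_eq_sum (s := (formDet b).divisors) fun a ha => if_neg ha,
        Finset.sum_congr rfl fun a ha => if_pos ha, Finset.sum_const, nsmul_eq_mul]
    simp_rw [hsum]
    have h3 := (summable_norm_rpow_int (ι := Fin 3) (r := -10 / 3) (by simp; norm_num)).mul_left 2048
    refine Summable.of_nonneg_of_le (fun b => by positivity) (fun b => ?_) h3
    by_cases hb : formDet b = 0
    · rw [hb]; simp; positivity
    · have hb0 : b ≠ 0 := by
        rintro rfl
        exact hb (by simp [formDet])
      calc _ ≤ 2048 * ‖b‖ ^ (2 / 3 : ℝ) * ‖b‖ ^ (-4 : ℝ) := by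
            gcongr; exact card_divisors_formDet_le hb
        _ = 2048 * ‖b‖ ^ (-10 / 3 : ℝ) := by
            rw [mul_assoc, ← Real.rpow_add (norm_pos_iff.2 hb0)]; norm_num

/-- The nonzero isotropic vectors of the quadratic form `w₀ w₄ - w₁ w₃ + w₂²`. -/
def isotropicVectors : Set (Fin 5 → ℤ) := {w | w 0 * w 4 = w 1 * w 3 - w 2 ^ 2 ∧ w ≠ 0}

theorem vec_ext {w w' : Fin 5 → ℤ} (h0 : w 0 = w' 0) (h1 : w 1 = w' 1) (h2 : w 2 = w' 2)
    (h3 : w 3 = w' 3) (h4 : w 4 = w' 4) : w = w' := by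
  funext i
  fin_cases i <;> assumption

theorem summable_isotropic_of_ne : Summable (({w : Fin 5 → ℤ | w 0 * w 4 = w 1 * w 3 - w 2 ^ 2 ∧
    w 0 * w 4 ≠ 0}).indicator fun w => ‖w‖ ^ (-4 : ℝ)) := by
  rw [← summable_subtype_iff_indicator]
  set S := {w : Fin 5 → ℤ | w 0 * w 4 = w 1 * w 3 - w 2 ^ 2 ∧ w 0 * w 4 ≠ 0}
  have hdet : ∀ w : S, formDet ((w : Fin 5 → ℤ) ∘ ![1, 2, 3])
      = (w : Fin 5 → ℤ) 0 * (w : Fin 5 → ℤ) 4 := by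
    intro w
    have := w.2.1
    simp [formDet]
    linarith
  have h := summable_pairs.comp_injective
    (i := fun w : S => ((w : Fin 5 → ℤ) ∘ ![1, 2, 3], (w : Fin 5 → ℤ) 0)) (by
      intro w w' h
      have h1 := congrArg Prod.fst h
      have h0 : (w : Fin 5 → ℤ) 0 = (w' : Fin 5 → ℤ) 0 := congrArg Prod.snd h
      have hd := hdet w
      have hd' := hdet w'
      change (w : Fin 5 → ℤ) ∘ ![1, 2, 3] = (w' : Fin 5 → ℤ) ∘ ![1, 2, 3] at h1
      rw [h1] at hd
      refine Subtype.ext (vec_ext h0 (congrFun h1 0) (congrFun h1 1) (congrFun h1 2) ?_)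
      rw [hd, h0] at hd'
      exact mul_left_cancel₀ (left_ne_zero_of_mul w'.2.2) hd')
  refine Summable.of_nonneg_of_le (fun w => Real.rpow_nonneg (norm_nonneg _) _) (fun w => ?_) h
  have hw := hdet w
  have hdiv : (w : Fin 5 → ℤ) 0 ∈ (formDet ((w : Fin 5 → ℤ) ∘ ![1, 2, 3])).divisors := by
    rw [Int.mem_divisors, hw]
    exact ⟨dvd_mul_right _ _, w.2.2⟩
  simp only [Function.comp_apply] at hdiv ⊢
  rw [if_pos hdiv]
  refine Real.rpow_le_rpow_of_nonpos (norm_pos_iff.2 ?_) (norm_comp_le _ _) (by norm_num)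
  intro h0
  rw [h0] at hw
  exact w.2.2 (hw.symm.trans (by simp [formDet]))

/-- The sum of `‖w‖⁻⁴` over the nonzero integral isotropic vectors in dimension five converges. -/
theorem summable_isotropic : Summable (isotropicVectors.indicator fun w => ‖w‖ ^ (-4 : ℝ)) := by
  -- the vectors with `w₀ = 0` or `w₄ = 0` are divided according to the vanishing of `w₁`; if both
  -- `w₁` and an outer coordinate vanish, so does `w₂`, and one of the listed coordinates is repeated
  have hA := summable_indicator_of_coords (S := {w | w ∈ isotropicVectors ∧ w 0 = 0 ∧ w 1 ≠ 0})
    ![1, 2, 4] (by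
      rintro w ⟨⟨hw, -⟩, h0, h1⟩ w' ⟨⟨hw', -⟩, h0', -⟩ h
      have e1 : w 1 = w' 1 := congrFun h 0
      have e2 : w 2 = w' 2 := congrFun h 1
      refine vec_ext (h0.trans h0'.symm) e1 e2 (mul_left_cancel₀ h1 ?_) (congrFun h 2)
      rw [h0] at hw; rw [h0', ← e1, ← e2] at hw'
      linarith) (by
      rintro w ⟨-, -, h1⟩ h
      exact h1 (congrFun h 0))
  have hB := summable_indicator_of_coords (S := {w | w ∈ isotropicVectors ∧ w 0 = 0 ∧ w 1 = 0})
    ![3, 4, 4] (by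
      rintro w ⟨⟨hw, -⟩, h0, h1⟩ w' ⟨⟨hw', -⟩, h0', h1'⟩ h
      rw [h0, h1] at hw; rw [h0', h1'] at hw'
      have e2 : w 2 = 0 := by simpa using hw.symm
      have e2' : w' 2 = 0 := by simpa using hw'.symm
      exact vec_ext (h0.trans h0'.symm) (h1.trans h1'.symm) (e2.trans e2'.symm) (congrFun h 0)
        (congrFun h 1)) (by
      rintro w ⟨⟨hw, hne⟩, h0, h1⟩ h
      rw [h0, h1] at hw
      exact hne (vec_ext h0 h1 (by simpa using hw.symm) (congrFun h 0) (congrFun h 1)))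
  have hC := summable_indicator_of_coords (S := {w | w ∈ isotropicVectors ∧ w 4 = 0 ∧ w 1 ≠ 0})
    ![1, 2, 0] (by
      rintro w ⟨⟨hw, -⟩, h0, h1⟩ w' ⟨⟨hw', -⟩, h0', -⟩ h
      have e1 : w 1 = w' 1 := congrFun h 0
      have e2 : w 2 = w' 2 := congrFun h 1
      refine vec_ext (congrFun h 2) e1 e2 (mul_left_cancel₀ h1 ?_) (h0.trans h0'.symm)
      rw [h0] at hw; rw [h0', ← e1, ← e2] at hw'
      linarith) (by
      rintro w ⟨-, -, h1⟩ h
      exact h1 (congrFun h 0))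
  have hD := summable_indicator_of_coords (S := {w | w ∈ isotropicVectors ∧ w 4 = 0 ∧ w 1 = 0})
    ![3, 0, 0] (by
      rintro w ⟨⟨hw, -⟩, h0, h1⟩ w' ⟨⟨hw', -⟩, h0', h1'⟩ h
      rw [h0, h1] at hw; rw [h0', h1'] at hw'
      have e2 : w 2 = 0 := by simpa using hw.symm
      have e2' : w' 2 = 0 := by simpa using hw'.symm
      exact vec_ext (congrFun h 1) (h1.trans h1'.symm) (e2.trans e2'.symm) (congrFun h 0)
        (h0.trans h0'.symm)) (by
      rintro w ⟨⟨hw, hne⟩, h0, h1⟩ h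
      rw [h0, h1] at hw
      exact hne (vec_ext (congrFun h 1) h1 (by simpa using hw.symm) (congrFun h 0) h0))
  refine Summable.of_nonneg_of_le (fun w => Set.indicator_nonneg (fun _ _ => by positivity) _)
    (fun w => ?_) ((((summable_isotropic_of_ne.add hA).add hB).add hC).add hD)
  have hpos : ∀ S : Set (Fin 5 → ℤ), 0 ≤ S.indicator (fun w => ‖w‖ ^ (-4 : ℝ)) w := fun S =>
    Set.indicator_nonneg (fun _ _ => by positivity) _
  have p0 := hpos {w | w 0 * w 4 = w 1 * w 3 - w 2 ^ 2 ∧ w 0 * w 4 ≠ 0}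
  have p1 := hpos {w | w ∈ isotropicVectors ∧ w 0 = 0 ∧ w 1 ≠ 0}
  have p2 := hpos {w | w ∈ isotropicVectors ∧ w 0 = 0 ∧ w 1 = 0}
  have p3 := hpos {w | w ∈ isotropicVectors ∧ w 4 = 0 ∧ w 1 ≠ 0}
  have p4 := hpos {w | w ∈ isotropicVectors ∧ w 4 = 0 ∧ w 1 = 0}
  have key : ∀ S : Set (Fin 5 → ℤ), w ∈ S →
      S.indicator (fun w => ‖w‖ ^ (-4 : ℝ)) w = ‖w‖ ^ (-4 : ℝ) := fun S h =>
    Set.indicator_of_mem h _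
  by_cases hw : w ∈ isotropicVectors
  swap
  · rw [Set.indicator_of_notMem hw]
    linarith
  rw [Set.indicator_of_mem hw]
  by_cases h0 : w 0 = 0
  · by_cases h1 : w 1 = 0
    · linarith [key {w | w ∈ isotropicVectors ∧ w 0 = 0 ∧ w 1 = 0} ⟨hw, h0, h1⟩]
    · linarith [key {w | w ∈ isotropicVectors ∧ w 0 = 0 ∧ w 1 ≠ 0} ⟨hw, h0, h1⟩]
  · by_cases h4 : w 4 = 0
    · by_cases h1 : w 1 = 0
      · linarith [key {w | w ∈ isotropicVectors ∧ w 4 = 0 ∧ w 1 = 0} ⟨hw, h4, h1⟩]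
      · linarith [key {w | w ∈ isotropicVectors ∧ w 4 = 0 ∧ w 1 ≠ 0} ⟨hw, h4, h1⟩]
    · linarith [key {w | w 0 * w 4 = w 1 * w 3 - w 2 ^ 2 ∧ w 0 * w 4 ≠ 0}
        ⟨hw.1, mul_ne_zero h0 h4⟩]

end LatticeSums

/-! ### Bounds for the automorphy factor and convergence -/

section Positivity

variable {τ : Matrix (Fin 2) (Fin 2) ℂ}

/-- The linear form on Plücker vectors that gives the automorphy factor at `τ`. -/
noncomputable def autoForm (τ : Matrix (Fin 2) (Fin 2) ℂ) (w : Fin 5 → ℝ) : ℂ :=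
  w 0 * τ.det + w 1 * τ 0 0 + 2 * w 2 * τ 0 1 + w 3 * τ 1 1 + w 4

theorem im_pos_of_mem (hτ : τ ∈ siegelUpperHalfSpace) :
    0 < (τ 0 0).im ∧ 0 < (τ 0 0).im * (τ 1 1).im - (τ 0 1).im ^ 2 ∧ τ 1 0 = τ 0 1 := by
  have hs : τ 1 0 = τ 0 1 := hτ.1.apply 0 1
  refine ⟨hτ.2.diag_pos, ?_, hs⟩
  have := hτ.2.det_pos
  rw [det_fin_two] at this
  simp only [map_apply, hs] at this
  rw [sq]; exact this

/-- A complex symmetric matrix of size two with definite imaginary part is invertible. -/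
theorem mul_ne_sq_of_im_definite {p r s : ℂ} (h : 0 < p.im * r.im - s.im ^ 2) : p * r ≠ s ^ 2 := by
  intro e
  have hre := congrArg Complex.re e
  have him := congrArg Complex.im e
  simp only [sq, Complex.mul_re, Complex.mul_im] at hre him
  have key : (p.im * r.im - s.im ^ 2) * (p.re ^ 2 + p.im ^ 2) = -(p.im * s.re - p.re * s.im) ^ 2 := by
    linear_combination p.re * p.im * him - p.im ^ 2 * hre
  have hp : p.im ≠ 0 := by
    intro h0
    rw [h0] at h
    nlinarith [sq_nonneg s.im]
  have : 0 < p.re ^ 2 + p.im ^ 2 := by positivity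
  nlinarith [mul_pos h this, sq_nonneg (p.im * s.re - p.re * s.im)]

/-- The automorphy factor does not vanish on nonzero real isotropic vectors. -/
theorem autoForm_ne_zero (hτ : τ ∈ siegelUpperHalfSpace) {w : Fin 5 → ℝ}
    (hw : w 0 * w 4 = w 1 * w 3 - w 2 ^ 2) (h0 : w ≠ 0) : autoForm τ w ≠ 0 := by
  obtain ⟨hy, hd, hs⟩ := im_pos_of_mem hτ
  intro h
  by_cases ha : w 0 = 0
  · have him := congrArg Complex.im h
    simp [autoForm, ha, Complex.mul_im] at him
    rw [ha, zero_mul] at hw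
    -- `w₁` times the imaginary part is the value of the definite form `Im τ` at `(w₁, w₂)`
    have key : (τ 0 0).im * w 1 ^ 2 + 2 * (τ 0 1).im * (w 1 * w 2) + (τ 1 1).im * w 2 ^ 2 = 0 := by
      linear_combination w 1 * him + (τ 1 1).im * hw
    have key' : ((τ 0 0).im * w 1 + (τ 0 1).im * w 2) ^ 2
        + ((τ 0 0).im * (τ 1 1).im - (τ 0 1).im ^ 2) * w 2 ^ 2 = 0 := by
      linear_combination (τ 0 0).im * key
    have h2 : w 2 = 0 := by
      by_contra h2
      have : 0 < w 2 ^ 2 := by positivity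
      nlinarith [mul_pos hd this, sq_nonneg ((τ 0 0).im * w 1 + (τ 0 1).im * w 2)]
    have h1 : w 1 = 0 := by
      rw [h2] at key'
      simpa [hy.ne'] using key'
    have hy1 : 0 < (τ 1 1).im := by
      by_contra hn
      nlinarith [sq_nonneg (τ 0 1).im]
    have h3 : w 3 = 0 := by
      rw [h1, h2] at him
      simpa [hy1.ne'] using him
    have h4 : w 4 = 0 := by
      simpa [autoForm, ha, h1, h2, h3] using h
    apply h0
    funext i
    fin_cases i <;> assumption
  · refine mul_ne_sq_of_im_definite (p := w 0 * τ 0 0 + w 3) (r := w 0 * τ 1 1 + w 1)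
      (s := w 0 * τ 0 1 - w 2) ?_ ?_
    · simp [Complex.mul_im]
      have : 0 < w 0 ^ 2 := by positivity
      nlinarith [mul_pos this hd]
    · have hw' := congrArg (fun x : ℝ => (x : ℂ)) hw
      push_cast at hw'
      rw [autoForm, det_fin_two, hs] at h
      linear_combination (w 0 : ℂ) * h - hw'

/-- The form is bounded below by the norm on the cone of isotropic vectors: by homogeneity this is a
statement about the unit sphere, where it follows from compactness. -/
theorem exists_autoForm_bound (hτ : τ ∈ siegelUpperHalfSpace) :
    ∃ c : ℝ, 0 < c ∧ ∀ w : Fin 5 → ℝ, w 0 * w 4 = w 1 * w 3 - w 2 ^ 2 →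
      c * ‖w‖ ≤ ‖autoForm τ w‖ := by
  let K : Set (Fin 5 → ℝ) := Metric.sphere 0 1 ∩ {w | w 0 * w 4 = w 1 * w 3 - w 2 ^ 2}
  have hK : IsCompact K := (isCompact_sphere _ _).inter_right
    (isClosed_eq (by fun_prop) (by fun_prop))
  have hcont : Continuous fun w => ‖autoForm τ w‖ := by unfold autoForm; fun_prop
  obtain ⟨c, hc, hcK⟩ : ∃ c : ℝ, 0 < c ∧ ∀ w ∈ K, c ≤ ‖autoForm τ w‖ := by
    rcases K.eq_empty_or_nonempty with h | h
    · exact ⟨1, one_pos, by simp [h]⟩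
    · obtain ⟨w₀, hw₀, hmin⟩ := hK.exists_isMinOn h hcont.continuousOn
      refine ⟨_, norm_pos_iff.2 (autoForm_ne_zero hτ hw₀.2 ?_), fun w hw => hmin hw⟩
      rintro rfl
      simpa using hw₀.1
  refine ⟨c, hc, fun w hw => ?_⟩
  by_cases h0 : w = 0
  · simp [h0]
  have hn := norm_pos_iff.2 h0
  have hmem : ‖w‖⁻¹ • w ∈ K := by
    refine ⟨by simp [norm_smul, hn.ne'], ?_⟩
    simp only [Set.mem_ofPred_eq, Pi.smul_apply, smul_eq_mul]
    linear_combination (‖w‖⁻¹) ^ 2 * hw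
  have hlin : autoForm τ (‖w‖⁻¹ • w) = ((‖w‖⁻¹ : ℝ) : ℂ) * autoForm τ w := by
    simp only [autoForm, Pi.smul_apply, smul_eq_mul]
    push_cast; ring
  have := hcK _ hmem
  rw [hlin, norm_mul, Complex.norm_real, Real.norm_of_nonneg (by positivity)] at this
  calc c * ‖w‖ ≤ (‖w‖⁻¹ * ‖autoForm τ w‖) * ‖w‖ := by gcongr
    _ = ‖autoForm τ w‖ := by field_simp

theorem autoFactor_eq_autoForm (hτ : τ ∈ siegelUpperHalfSpace) (g : Sp2 ℚ) :
    autoFactor g τ = autoForm τ fun i => ((pluecker g i : ℚ) : ℝ) := by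
  rw [autoFactor_eq g hτ.1, autoForm]
  push_cast
  rfl

theorem autoFactor_ne_zero (hτ : τ ∈ siegelUpperHalfSpace) (g : Sp2 ℚ) : autoFactor g τ ≠ 0 := by
  rw [autoFactor_eq_autoForm hτ]
  refine autoForm_ne_zero hτ (by exact_mod_cast pluecker_isotropic g) fun h => ?_
  obtain ⟨x, hx⟩ := exists_pluecker_unimodular g
  refine zero_ne_one (hx ▸ (Finset.sum_eq_zero fun i _ => ?_).symm)
  have : ((pluecker g i : ℚ) : ℝ) = 0 := congrFun h i
  rw [Rat.cast_eq_zero.1 this, mul_zero]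

theorem exists_autoFactor_bound (hτ : τ ∈ siegelUpperHalfSpace) :
    ∃ c : ℝ, 0 < c ∧ ∀ h : Sp2 ℤ, c * ‖pluecker h‖ ≤ ‖autoFactor (toQ h) τ‖ := by
  obtain ⟨c, hc, hb⟩ := exists_autoForm_bound hτ
  refine ⟨c, hc, fun h => ?_⟩
  have e : (fun i => ((pluecker (toQ h) i : ℚ) : ℝ)) = fun i => ((pluecker h i : ℤ) : ℝ) := by
    funext i
    have : pluecker (toQ h) i = ((pluecker h i : ℤ) : ℚ) := pluecker_map _ h i
    rw [this]; simp
  have hn : ‖fun i => ((pluecker h i : ℤ) : ℝ)‖ = ‖pluecker h‖ := by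
    simp only [Pi.norm_def]; rfl
  rw [autoFactor_eq_autoForm hτ, e, ← hn]
  exact hb _ (by exact_mod_cast pluecker_isotropic h)

end Positivity

section Convergence

variable {τ : Matrix (Fin 2) (Fin 2) ℂ} {k : ℕ} {f : Sp2 ℚ → ℂ}

theorem pluecker_mem_isotropicVectors (h : Sp2 ℤ) : pluecker h ∈ isotropicVectors := by
  refine ⟨pluecker_isotropic h, fun h0 => ?_⟩
  obtain ⟨x, hx⟩ := exists_pluecker_unimodular h
  rw [h0] at hx
  simp at hx

/-- Absolute convergence, in weights `k ≥ 4`, of the series attached to an equivariant function which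
is bounded on `Sp₂(ℤ)`. -/
theorem summable_seriesTerm (hk : 4 ≤ k) (hτ : τ ∈ siegelUpperHalfSpace) (hf : IsRatEquivariant k f)
    {B : ℝ} (hB : ∀ h : Sp2 ℤ, ‖f (toQ h)‖ ≤ B) : Summable (seriesTerm k f τ) := by
  obtain ⟨c, hc, hb⟩ := exists_autoFactor_bound hτ
  choose r hr using exists_ratCoset_toQ
  have hinj : Function.Injective fun x => pluecker (r x) := by
    intro x y hxy
    have hp := (mem_parabolic_of_pluecker (c := 1) (hxy.trans (one_smul ℤ _).symm)).1
    rw [← hr x, ← hr y]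
    refine (ratCoset_eq.2 ?_).symm
    rw [← map_inv, ← map_mul]
    exact mapSp_mem_parabolic _ hp
  have hs := (summable_isotropic.comp_injective hinj).mul_left (B * (c ^ k)⁻¹)
  refine Summable.of_norm_bounded hs fun x => ?_
  have hmem := pluecker_mem_isotropicVectors (r x)
  have hB0 : 0 ≤ B := (norm_nonneg _).trans (hB 1)
  conv_lhs => rw [← hr x]
  rw [seriesTerm_ratCoset hf, Function.comp_apply, Set.indicator_of_mem hmem, norm_mul, norm_inv,
    norm_pow]
  have hn : 1 ≤ ‖pluecker (r x)‖ := by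
    obtain ⟨i, hi⟩ := Function.ne_iff.1 hmem.2
    refine le_trans ?_ (norm_le_pi_norm _ i)
    rw [Int.norm_eq_abs]
    exact_mod_cast Int.one_le_abs hi
  have h1 : ‖pluecker (r x)‖ ^ (-4 : ℝ) = (‖pluecker (r x)‖ ^ 4)⁻¹ := by
    rw [Real.rpow_neg (norm_nonneg _)]
    norm_cast
  rw [h1, mul_assoc, ← mul_inv]
  gcongr
  · exact hB _
  · calc c ^ k * ‖pluecker (r x)‖ ^ 4 ≤ c ^ k * ‖pluecker (r x)‖ ^ k := by gcongr
      _ = (c * ‖pluecker (r x)‖) ^ k := (mul_pow _ _ _).symm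
      _ ≤ _ := by gcongr; exact hb _

end Convergence

/-! ### The Eisenstein series and the Hecke operator -/

section Assembly

variable {q m k : ℕ} [hq : Fact q.Prime] {φ : MulChar (ZMod m) ℂ} {ψ : MulChar (ZMod q) ℂ}
  {e₁ e₂ : ZMod m} {τ : Matrix (Fin 2) (Fin 2) ℂ}

theorem norm_ratExt_mul_delta1_le (hqm : q.Coprime m) (D : LocalDatum φ e₁ e₂) (hψ : ψ ^ 2 = 1)
    (hpar : ψ (-1) * φ (-1) = (-1) ^ k) (H : Sp2 ℤ) :
    ‖ratExt k (deepFactor φ e₁ e₂ ψ) (toQ H * delta1 q)‖ ≤ ((q : ℝ) ^ k)⁻¹ + (q : ℝ) ^ k := by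
  rw [ratExt_mul_delta1 hqm D hψ hpar, norm_mul]
  refine (mul_le_of_le_one_left (norm_nonneg _) (norm_localFactor_le D.real _)).trans ?_
  refine (norm_add_le _ _).trans (add_le_add ?_ ?_)
  · rw [norm_mul, norm_inv, norm_pow, Complex.norm_natCast]
    exact mul_le_of_le_one_right (by positivity) (norm_realChar_le hψ _)
  · rw [norm_mul, norm_pow, Complex.norm_natCast]
    refine mul_le_of_le_one_right (by positivity) ?_
    split_ifs
    · exact norm_realChar_le hψ _
    · simp

theorem summable_seriesTerm_ratExt (hk : 4 ≤ k) (hτ : τ ∈ siegelUpperHalfSpace) {F : Sp2 ℤ → ℂ}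
    (hF : IsEquivariant k F) (hB : ∀ h, ‖F h‖ ≤ 1) : Summable (seriesTerm k (ratExt k F) τ) :=
  summable_seriesTerm hk hτ hF.isRatEquivariant fun h => (hF.ratExt_toQ h).symm ▸ hB h

/-- The action of the Hecke operator on series over the cosets of the Siegel parabolic subgroup. -/
theorem sum_tsum_seriesTerm_heckeRep (hk : 4 ≤ k) (hτ : τ ∈ siegelUpperHalfSpace)
    (hqm : q.Coprime m) (D : LocalDatum φ e₁ e₂) (hψ : ψ ^ 2 = 1)
    (hpar : ψ (-1) * φ (-1) = (-1) ^ k) :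
    ∑ x : Option (ZMod q) × ZMod (q ^ 2) × ZMod q, ∑' y, seriesTerm k
        (fun g => ratExt k (deepFactor φ e₁ e₂ ψ) (g * (toQ (heckeRep x))⁻¹ * delta1 q)) τ y
      = ((q : ℂ) ^ k)⁻¹ * (q : ℂ) ^ 4 * ∑' y, seriesTerm k (ratExt k (prodFactor φ e₁ e₂ ψ 1 0)) τ y
        + ((q : ℂ) ^ k)⁻¹ * (q : ℂ) ^ 2 * (q + 1) * (∑ x, ψ x)
          * ∑' y, seriesTerm k (ratExt k (prodFactor φ e₁ e₂ ψ 1 1)) τ y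
        + (q : ℂ) ^ (k + 1) * ∑' y, seriesTerm k (ratExt k (deepFactor φ e₁ e₂ ψ)) τ y := by
  have hF₁ := isEquivariant_prodFactor D (localDatum_one_zero hψ) hpar
  have hF₂ := isEquivariant_prodFactor D (localDatum_one_one hψ) hpar
  have hF := isEquivariant_deepFactor D hψ hpar
  have hs₁ := summable_seriesTerm_ratExt hk hτ hF₁ (norm_prodFactor_le D.real hψ)
  have hs₂ := summable_seriesTerm_ratExt hk hτ hF₂ (norm_prodFactor_le D.real hψ)
  have hs := summable_seriesTerm_ratExt hk hτ hF (norm_deepFactor_le D.real hψ)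
  have heq : ∀ x : Option (ZMod q) × ZMod (q ^ 2) × ZMod q, IsRatEquivariant k
      fun g => ratExt k (deepFactor φ e₁ e₂ ψ) (g * (toQ (heckeRep x))⁻¹ * delta1 q) := fun x =>
    (hF.isRatEquivariant.mul_right (delta1 q)).mul_right _
  rw [← Summable.tsum_finsetSum, ← tsum_mul_left, ← tsum_mul_left, ← tsum_mul_left,
    ← (hs₁.mul_left _).tsum_add (hs₂.mul_left _),
    ← ((hs₁.mul_left _).add (hs₂.mul_left _)).tsum_add (hs.mul_left _)]
  · refine tsum_congr fun y => ?_
    obtain ⟨h, rfl⟩ := exists_ratCoset_toQ y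
    have hψ1 : (∑ x, ψ x) * prodFactor φ e₁ e₂ (1 : MulChar (ZMod q) ℂ) 1 1 h
        = (∑ x, ψ x) * prodFactor φ e₁ e₂ ψ 1 1 h := by
      by_cases h1 : ψ = 1
      · rw [h1]
      · rw [MulChar.sum_eq_zero_of_ne_one h1, zero_mul, zero_mul]
    simp_rw [seriesTerm_ratCoset (heq _)]
    rw [seriesTerm_ratCoset hF₁.isRatEquivariant, seriesTerm_ratCoset hF₂.isRatEquivariant,
      seriesTerm_ratCoset hF.isRatEquivariant, ← Finset.sum_mul, sum_ratExt_heckeRep hqm D hψ hpar,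
      hF₁.ratExt_toQ, hF₂.ratExt_toQ, hF.ratExt_toQ]
    linear_combination ((q : ℂ) ^ k)⁻¹ * (q : ℂ) ^ 2 * (q + 1) * (autoFactor (toQ h) τ ^ k)⁻¹ * hψ1
  · intro x _
    refine summable_seriesTerm hk hτ (heq x) (B := ((q : ℝ) ^ k)⁻¹ + (q : ℝ) ^ k) fun h => ?_
    rw [← map_inv, ← map_mul]
    exact norm_ratExt_mul_delta1_le hqm D hψ hpar _

end Assembly

section CharacterData

variable {q m k : ℕ} (hqm : q.Coprime m) {χ : DirichletCharacter ℂ (q * m)}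

theorem charDetD_eq_components (hχ : χ ^ 2 = 1) (γ : Sp2 ℤ) :
    charDetD χ γ = localComponent hqm χ (detD γ : ℤ) * coComponent hqm χ (detD γ : ℤ) := by
  rw [charDetD_eq, ← components_mul]
  by_cases hu : IsUnit ((detD γ : ℤ) : ZMod (q * m))
  · rcases mul_self_eq_one_iff.1 (realChar_sq hχ hu) with h | h <;> rw [h] <;> simp
  · rw [MulChar.map_nonunit _ hu, map_zero]

theorem components_neg_one (hpar : χ (-1) = (-1) ^ k) :
    localComponent hqm χ (-1) * coComponent hqm χ (-1) = (-1) ^ k := by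
  have := components_mul hqm χ (-1)
  push_cast at this
  rw [← this, hpar]

variable {d : Fin 2 → ℤ}

/-- The Eisenstein series of level `q m` as a series over cosets. -/
theorem eisenstein_eq_prodFactor [NeZero (q * m)] (hχ : χ ^ 2 = 1) (hpar : χ (-1) = (-1) ^ k)
    {f₁ f₂ : ZMod q} (hf₁ : (d 0 : ZMod q) = f₁) (hf₂ : (d 1 : ZMod q) = f₂)
    (D : LocalDatum (coComponent hqm χ) (d 0 : ZMod m) (d 1 : ZMod m))
    (D' : LocalDatum (localComponent hqm χ) f₁ f₂)
    (h₁ : (d 0 * d 0 : ZMod (q * m)) = d 0) (h₁₂ : (d 0 * d 1 : ZMod (q * m)) = d 1)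
    (τ : Matrix (Fin 2) (Fin 2) ℂ) :
    eisensteinTerm k χ (q * m) (lowerDiag d) τ = seriesTerm k (ratExt k (prodFactor
        (coComponent hqm χ) (d 0) (d 1) (localComponent hqm χ) f₁ f₂)) τ
          ∘ indexCoset (q * m) (lowerDiag d) ∧
      eisenstein k χ (q * m) (lowerDiag d) τ = ∑' x, seriesTerm k (ratExt k (prodFactor
        (coComponent hqm χ) (d 0) (d 1) (localComponent hqm χ) f₁ f₂)) τ x := by
  subst hf₁ hf₂
  have hF := isEquivariant_prodFactor D D' (components_neg_one hqm hpar)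
  have hval : ∀ γ ∈ Gamma0 (q * m), prodFactor (coComponent hqm χ) (d 0) (d 1)
      (localComponent hqm χ) (d 0) (d 1) (lowerDiag d * γ) = charDetD χ γ := fun γ hγ => by
    rw [prodFactor_mul_right dvd_rfl D D' hγ, lowerDiag_eq, prodFactor_lowerUnip D D', mul_one,
      charDetD_eq_components hqm hχ]
  refine ⟨eisensteinTerm_eq hF hval, eisenstein_eq hF hval fun g hg => ?_⟩
  rw [lowerDiag_eq]
  exact exists_orbit_of_prodFactor_ne_zero hqm h₁ h₁₂ hg

/-- The Eisenstein series of level `q (q m)` as a series over cosets. -/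
theorem eisenstein_eq_deepFactor [Fact q.Prime] [NeZero (q * (q * m))] (hχ : χ ^ 2 = 1)
    (hpar : χ (-1) = (-1) ^ k) (hq₁ : (d 0 : ZMod (q ^ 2)) = 1) (hq₂ : (d 1 : ZMod (q ^ 2)) = 0)
    (D : LocalDatum (coComponent hqm χ) (d 0 : ZMod m) (d 1 : ZMod m))
    (h₁ : (d 0 * d 0 : ZMod (q * (q * m))) = d 0) (h₁₂ : (d 0 * d 1 : ZMod (q * (q * m))) = d 1)
    (τ : Matrix (Fin 2) (Fin 2) ℂ) :
    eisensteinTerm k χ (q * (q * m)) (lowerDiag d) τ = seriesTerm k (ratExt k (deepFactor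
        (coComponent hqm χ) (d 0) (d 1) (localComponent hqm χ))) τ
          ∘ indexCoset (q * (q * m)) (lowerDiag d) ∧
      eisenstein k χ (q * (q * m)) (lowerDiag d) τ = ∑' x, seriesTerm k (ratExt k (deepFactor
        (coComponent hqm χ) (d 0) (d 1) (localComponent hqm χ))) τ x := by
  have hψ := localComponent_sq hqm χ hχ
  have hF := isEquivariant_deepFactor D hψ (components_neg_one hqm hpar)
  have hc : ∀ z : ℤ, (z : ZMod q) = ((z : ZMod (q ^ 2)).cast : ZMod q) := fun z =>
    (ZMod.cast_intCast (dvd_pow_self q two_ne_zero) z).symm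
  have hq : Nat.Prime q := Fact.out
  have hf₁ : (d 0 : ZMod q) = 1 := by
    rw [hc, hq₁, ZMod.cast_one (dvd_pow_self q two_ne_zero)]
  have hf₂ : (d 1 : ZMod q) = 0 := by rw [hc, hq₂, ZMod.cast_zero]
  have hone : deepFactor (coComponent hqm χ) (d 0) (d 1) (localComponent hqm χ) (lowerDiag d)
      = 1 := by
    have D' := localDatum_one_zero hψ
    rw [← hf₁, ← hf₂] at D'
    rw [deepFactor, ← hf₁, ← hf₂, lowerDiag_eq, if_pos, prodFactor_lowerUnip D D']
    rw [pluecker_lowerUnip]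
    have h2 := (ZMod.intCast_zmod_eq_zero_iff_dvd _ _).1 hq₂
    push_cast at h2
    exact h2.mul_left _
  have hval : ∀ γ ∈ Gamma0 (q * (q * m)), deepFactor (coComponent hqm χ) (d 0) (d 1)
      (localComponent hqm χ) (lowerDiag d * γ) = charDetD χ γ := fun γ hγ => by
    rw [deepFactor_mul_right dvd_rfl D hψ hγ, hone, mul_one, charDetD_eq_components hqm hχ]
  refine ⟨eisensteinTerm_eq hF hval, eisenstein_eq hF hval fun g hg => ?_⟩
  rw [lowerDiag_eq]
  exact exists_orbit_of_deepFactor_ne_zero hqm hψ h₁ h₁₂ hq₁ hq₂ hg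

end CharacterData
end SiegelEisenstein

open SiegelEisenstein in
theorem proposition5p10 (k : ℕ) (hk : 4 ≤ k) (q N₀ N₁ N₂ : ℕ) [Fact q.Prime]
    (hodd : Odd (q * (N₀ * N₁ * N₂))) (hsqf : Squarefree (q * (N₀ * N₁ * N₂)))
    (χ : DirichletCharacter ℂ (q * (N₀ * N₁ * N₂))) (hreal : χ ^ 2 = 1)
    (hparity : χ (-1) = (-1) ^ k)
    (d₁₁ d₁ d₂ : Fin 2 → ℤ)
    (hd₁₁ : SiegelEisenstein.Represents N₀ N₁ N₂ d₁₁)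
    (hd₁₁' : d₁₁ 0 ≡ 1 [ZMOD (q : ℤ) ^ 2] ∧ d₁₁ 1 ≡ 0 [ZMOD (q : ℤ) ^ 2])
    (hd₁ : SiegelEisenstein.Represents N₀ (q * N₁) N₂ d₁)
    (hd₂ : SiegelEisenstein.Represents N₀ N₁ (q * N₂) d₂)
    (τ : Matrix (Fin 2) (Fin 2) ℂ) (hτ : τ ∈ SiegelEisenstein.siegelUpperHalfSpace) :
    let N : ℕ := q * (N₀ * N₁ * N₂)
    let γ₁₁ := SiegelEisenstein.lowerDiag d₁₁
    let γ₁ := SiegelEisenstein.lowerDiag d₁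
    let γ₂ := SiegelEisenstein.lowerDiag d₂
    let E₁₁ := SiegelEisenstein.eisenstein k χ (q * N) γ₁₁
    let E₁ := SiegelEisenstein.eisenstein k χ N γ₁
    let E₂ := SiegelEisenstein.eisenstein k χ N γ₂
    -- the three series converge absolutely
    (Summable (SiegelEisenstein.eisensteinTerm k χ (q * N) γ₁₁ τ) ∧
      Summable (SiegelEisenstein.eisensteinTerm k χ N γ₁ τ) ∧
      Summable (SiegelEisenstein.eisensteinTerm k χ N γ₂ τ)) ∧
    (SiegelEisenstein.localComponent (Nat.coprime_of_squarefree_mul hsqf) χ ≠ 1 →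
      SiegelEisenstein.heckeT1 q k χ (q * N) E₁₁ τ
        = (q : ℂ) ^ (2 * (k : ℤ) - 2) * E₁₁ τ + (q : ℂ) * E₁ τ) ∧
    (SiegelEisenstein.localComponent (Nat.coprime_of_squarefree_mul hsqf) χ = 1 →
      SiegelEisenstein.heckeT1 q k χ (q * N) E₁₁ τ
        = (q : ℂ)⁻¹ * ((q : ℂ) ^ 2 - 1) * E₂ τ
          + (q : ℂ) ^ (2 * (k : ℤ) - 2) * E₁₁ τ + (q : ℂ) * E₁ τ) := by
  intro N γ₁₁ γ₁ γ₂ E₁₁ E₁ E₂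
  have hq : q.Prime := Fact.out
  have hqC : (q : ℂ) ≠ 0 := by exact_mod_cast hq.ne_zero
  have hqm := Nat.coprime_of_squarefree_mul hsqf
  have hm : Squarefree (N₀ * N₁ * N₂) := hsqf.of_mul_right
  have hN0 : q * (N₀ * N₁ * N₂) ≠ 0 := hsqf.ne_zero
  have : NeZero (q * (N₀ * N₁ * N₂)) := ⟨hN0⟩
  have : NeZero (q * (q * (N₀ * N₁ * N₂))) := ⟨mul_ne_zero hq.ne_zero hN0⟩
  have hpar := components_neg_one hqm hparity
  have hψ := localComponent_sq hqm χ hreal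
  have hφ := coComponent_sq hqm χ hreal
  -- modulo `N / q` the three matrices are congruent, and all of them are idempotent
  have D := LocalDatum.of_represents hφ hd₁₁ hm
  have c₁ := hd₁.of_mul_rank_one.congr hd₁₁ hm
  have c₂ := hd₂.of_mul_rank_two.congr hd₁₁ hm
  have hq₁ : ((d₁₁ 0 : ℤ) : ZMod (q ^ 2)) = 1 ∧ ((d₁₁ 1 : ℤ) : ZMod (q ^ 2)) = 0 := by
    have h := fun a b => ZMod.intCast_eq_intCast_iff a b (q ^ 2)
    push_cast at h
    exact ⟨by exact_mod_cast (h _ _).2 hd₁₁'.1, by exact_mod_cast (h _ _).2 hd₁₁'.2⟩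
  have key : ∀ {p : ℕ} {x y : ℤ}, x ≡ y [ZMOD p] → (x : ZMod p) = (y : ZMod p) := fun h =>
    (ZMod.intCast_eq_intCast_iff _ _ _).2 h
  have f₁ : ((d₁ 0 : ℤ) : ZMod q) = 1 ∧ ((d₁ 1 : ℤ) : ZMod q) = 0 := by
    exact_mod_cast (hd₁.rank_one q hq (dvd_mul_right _ _)).imp key key
  have f₂ : ((d₂ 0 : ℤ) : ZMod q) = 1 ∧ ((d₂ 1 : ℤ) : ZMod q) = 1 := by
    exact_mod_cast (hd₂.rank_two q hq (dvd_mul_right _ _)).imp key key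
  have i₁ : (d₁ 0 * d₁ 0 : ZMod (q * (N₀ * N₁ * N₂))) = d₁ 0 ∧
      (d₁ 0 * d₁ 1 : ZMod (q * (N₀ * N₁ * N₂))) = d₁ 1 := by
    have e : N₀ * (q * N₁) * N₂ = q * (N₀ * N₁ * N₂) := by ring
    have := hd₁.idempotent (e ▸ hsqf)
    rw [e] at this
    exact ⟨this.1, this.2.2⟩
  have i₂ : (d₂ 0 * d₂ 0 : ZMod (q * (N₀ * N₁ * N₂))) = d₂ 0 ∧
      (d₂ 0 * d₂ 1 : ZMod (q * (N₀ * N₁ * N₂))) = d₂ 1 := by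
    have e : N₀ * N₁ * (q * N₂) = q * (N₀ * N₁ * N₂) := by ring
    have := hd₂.idempotent (e ▸ hsqf)
    rw [e] at this
    exact ⟨this.1, this.2.2⟩
  have i₁₁ : (d₁₁ 0 * d₁₁ 0 : ZMod (q * (q * (N₀ * N₁ * N₂)))) = d₁₁ 0 ∧
      (d₁₁ 0 * d₁₁ 1 : ZMod (q * (q * (N₀ * N₁ * N₂)))) = d₁₁ 1 := by
    have hcrt : ∀ x y : ℤ, (x : ZMod (q ^ 2)) = y → (x : ZMod (N₀ * N₁ * N₂)) = y →
        (x : ZMod (q * (q * (N₀ * N₁ * N₂)))) = y := by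
      intro x y h2 h3
      rw [ZMod.intCast_eq_intCast_iff_dvd_sub] at h2 h3 ⊢
      have e : ((q * (q * (N₀ * N₁ * N₂)) : ℕ) : ℤ)
          = ((q ^ 2 : ℕ) : ℤ) * ((N₀ * N₁ * N₂ : ℕ) : ℤ) := by push_cast; ring
      rw [e]
      exact (Nat.isCoprime_iff_coprime.2 (hqm.pow_left 2)).mul_dvd h2 h3
    have a := hcrt (d₁₁ 0 * d₁₁ 0) (d₁₁ 0) (by simp [hq₁.1]) (by
      push_cast; exact D.idem₁)
    have b := hcrt (d₁₁ 0 * d₁₁ 1) (d₁₁ 1) (by simp [hq₁.2]) (by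
      push_cast; exact D.le)
    push_cast at a b
    exact ⟨a, b⟩
  -- the three Eisenstein series as series over the same set of cosets
  have D₁ : LocalDatum (coComponent hqm χ) (d₁ 0 : ZMod (N₀ * N₁ * N₂)) (d₁ 1) := by
    rw [c₁, c₁]; exact D
  have D₂ : LocalDatum (coComponent hqm χ) (d₂ 0 : ZMod (N₀ * N₁ * N₂)) (d₂ 1) := by
    rw [c₂, c₂]; exact D
  have s₁₁ := eisenstein_eq_deepFactor (k := k) hqm hreal hparity hq₁.1 hq₁.2 D i₁₁.1 i₁₁.2
  have s₁ := eisenstein_eq_prodFactor (k := k) hqm hreal hparity f₁.1 f₁.2 D₁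
    (localDatum_one_zero hψ) i₁.1 i₁.2
  have s₂ := eisenstein_eq_prodFactor (k := k) hqm hreal hparity f₂.1 f₂.2 D₂
    (localDatum_one_one hψ) i₂.1 i₂.2
  rw [c₁, c₁] at s₁
  rw [c₂, c₂] at s₂
  have hF₁ := isEquivariant_prodFactor D (localDatum_one_zero hψ) hpar
  have hF₂ := isEquivariant_prodFactor D (localDatum_one_one hψ) hpar
  have hF := isEquivariant_deepFactor D hψ hpar
  have hecke : heckeT1 q k χ (q * N) E₁₁ τ = (q : ℂ) ^ ((k : ℤ) - 3)
      * (((q : ℂ) ^ k)⁻¹ * (q : ℂ) ^ 4 * E₁ τ + ((q : ℂ) ^ k)⁻¹ * (q : ℂ) ^ 2 * (q + 1)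
        * (∑ x, localComponent hqm χ x) * E₂ τ + (q : ℂ) ^ (k + 1) * E₁₁ τ) := by
    rw [heckeT1_series (dvd_mul_right q N) (dvd_mul_left N q) hF (fun γ hγ g => by
        rw [deepFactor_mul_right dvd_rfl D hψ hγ, charDetD_eq_components hqm hreal])
      (fun τ' => (s₁₁ τ').2) (autoFactor_ne_zero hτ),
      sum_tsum_seriesTerm_heckeRep hk hτ hqm D hψ hpar, ← (s₁ τ).2, ← (s₂ τ).2, ← (s₁₁ τ).2]
  have hz : (q : ℂ) ^ ((k : ℤ) - 3) = (q : ℂ) ^ k * ((q : ℂ) ^ 3)⁻¹ := by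
    rw [zpow_sub₀ hqC, zpow_natCast, div_eq_mul_inv]; norm_cast
  have hz' : (q : ℂ) ^ (2 * (k : ℤ) - 2) = (q : ℂ) ^ k * (q : ℂ) ^ k * ((q : ℂ) ^ 2)⁻¹ := by
    rw [zpow_sub₀ hqC, two_mul, zpow_add₀ hqC, zpow_natCast, div_eq_mul_inv]; norm_cast
  refine ⟨⟨?_, ?_, ?_⟩, fun h => ?_, fun h => ?_⟩
  · rw [(s₁₁ τ).1]
    exact (summable_seriesTerm_ratExt hk hτ hF (norm_deepFactor_le hφ hψ)).comp_injective
      indexCoset_injective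
  · rw [(s₁ τ).1]
    exact (summable_seriesTerm_ratExt hk hτ hF₁ (norm_prodFactor_le hφ hψ)).comp_injective
      indexCoset_injective
  · rw [(s₂ τ).1]
    exact (summable_seriesTerm_ratExt hk hτ hF₂ (norm_prodFactor_le hφ hψ)).comp_injective
      indexCoset_injective
  · rw [hecke, MulChar.sum_eq_zero_of_ne_one h, hz, hz', pow_succ]
    field_simp
    ring
  · have hsum : ∑ x, localComponent hqm χ x = (q : ℂ) - 1 := by
      rw [show localComponent hqm χ = 1 from h, MulChar.sum_one_eq_card_units,
        ZMod.card_units_eq_totient, Nat.totient_prime hq, Nat.cast_sub hq.one_le, Nat.cast_one]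
    rw [hecke, hsum, hz, hz', pow_succ]
    field_simp
    ring
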